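/- A non-strict temporal graph $\mathcal{G}=\langle G_1,\dots,G_L\rangle$ with vertex set $V$, $|V|=n$, and lifetime $L\ge 1$ is a sequence of partitions $G_t$ of $V$ into components. A non-strict temporal walk starting at $v\in V$ at time $t_1$ is a nonempty sequence $C_{t_1},C_{t_1+1},\dots,C_{t_l}$ of components $C_t\in G_t$ with $1\le t_1\le t_l\le L$, $v\in C_{t_1}$, and $C_t\cap C_{t+1}\ne\emptyset$ for $t_1\le t<t_l$; its arrival time is $t_l$, and it visits all vertices of its components. A non-strict $(s,1,k)$-tour is a non-strict temporal walk that starts at $s$ at time $1$ and visits at least $k$ distinct vertices. An instance $(\mathcal{G},s,k)$ of \textsc{$k$-arbitrary NS-TEXP} consists of a non-strict temporal graph $\mathcal{G}$, a vertex $s$ and $k\in\mathbb{N}$; it asks whether a non-strict $(s,1,k)$-tour exists. For a yes-instance, an optimal solution is such a tour of minimum arrival time. The graph is given by listing, for each timestep, the vertex sets of its components. Algorithms run on a word RAM in which every instruction, including drawing a uniformly random element of $\{0,\dots,m-1\}$ for a word $m\ge 1$, takes unit time; there is an absolute constant $c$ such that any word length that is at least $c(1+\log_2 B)$ is allowed,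 where $B=(2e)^kLn^2\max\{1,\log\frac1\varepsilon\}$ for the randomized algorithms and $B=(2e)^kLn^2$ for the deterministic one. For every $\varepsilon>0$ there is a Monte Carlo algorithm that, with probability at least $1-\varepsilon$, decides a given instance $(\mathcal{G},s,k)$ of \textsc{$k$-arbitrary NS-TEXP} correctly and returns an optimal solution if it is a yes-instance, in (worst-case) time $O\big((2e)^kLn^2\max\{1,\log\frac1\varepsilon\}\big)$, where the constant in the $O$ is independent of $\varepsilon$ and of the instance. Furthermore, there is a deterministic algorithm that decides every instance $(\mathcal{G},s,k)$ of \textsc{$k$-arbitrary NS-TEXP}, and returns an optimal solution if it is a yes-instance, in $(2e)^kk^{O(\log k)}Ln^2\max\{1,\log n\}$ time, that is, in time at most $C\,(2e)^kk^{a\log k}Ln^2\max\{1,\log n\}$ for absolute constants $C$ and $a$ (with $k^{a\log k}:=1$ for $k=0$). -/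

import Mathlib

noncomputable section

namespace NSTexp

/-! ### Non-strict temporal graphs, walks and tours -/

/-- A non-strict temporal graph with vertex set `V` and lifetime `L`: a sequence of `L` partitions of
`V`. The partition of timestep `t`, for `1 ≤ t ≤ L`, is `layer ⟨t - 1, _⟩`. -/
structure TemporalGraph (V : Type) [Fintype V] [DecidableEq V] (L : ℕ) where
  layer : Fin L → Finpartition (Finset.univ : Finset V)

variable {V : Type} [Fintype V] [DecidableEq V] {L : ℕ}

/-- The components of timestep `t` (timesteps are numbered `1, …, L`; there are no components
outside of this range). -/
def TemporalGraph.components (G : TemporalGraph V L) (t : ℕ) : Finset (Finset V) :=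
  if h : 1 ≤ t ∧ t ≤ L then (G.layer ⟨t - 1, by omega⟩).parts else ∅

/-- `W` is a non-strict temporal walk starting at the vertex `v` at time `t`: a nonempty sequence of
components of the consecutive timesteps `t, t + 1, …`, all within the lifetime, such that
consecutive components intersect and the first one contains `v`. -/
structure IsWalk (G : TemporalGraph V L) (v : V) (t : ℕ) (W : List (Finset V)) : Prop where
  nonempty : W ≠ []
  one_le : 1 ≤ t
  le_lifetime : t + W.length ≤ L + 1
  mem_components : ∀ (i : ℕ) (h : i < W.length), W[i] ∈ G.components (t + i)
  inter_nonempty : ∀ (i : ℕ) (h : i + 1 < W.length), (W[i] ∩ W[i + 1]).Nonempty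
  start_mem : ∀ C ∈ W.head?, v ∈ C

/-- The arrival time of a walk that starts at time `t`: the timestep of its last component. -/
def arrivalTime (t : ℕ) (W : List (Finset V)) : ℕ := t + W.length - 1

/-- `W` is a non-strict `(v, t, X)`-tour. -/
def IsSetTour (G : TemporalGraph V L) (v : V) (t : ℕ) (X : Finset V) (W : List (Finset V)) : Prop :=
  IsWalk G v t W ∧ ∀ x ∈ X, ∃ C ∈ W, x ∈ C

/-- `W` is a non-strict `(v, t, k)`-tour. -/
def IsTour (G : TemporalGraph V L) (v : V) (t k : ℕ) (W : List (Finset V)) : Prop :=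
  ∃ X : Finset V, X.card = k ∧ IsSetTour G v t X W

/-- An instance of `k`-arbitrary NS-TEXP. The vertices are named `0, …, n - 1`. -/
structure Instance where
  /-- the number of vertices -/
  n : ℕ
  /-- the lifetime -/
  L : ℕ
  L_pos : 1 ≤ L
  graph : TemporalGraph (Fin n) L
  /-- the start vertex -/
  s : Fin n
  k : ℕ

/-- The instance is a yes-instance: there is a non-strict `(s, 1, k)`-tour. -/
def Instance.IsYes (I : Instance) : Prop := ∃ W, IsTour I.graph I.s 1 I.k W

/-- `W` is an optimal solution: an `(s, 1, k)`-tour of minimum arrival time. -/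
def Instance.IsOptimal (I : Instance) (W : List (Finset (Fin I.n))) : Prop :=
  IsTour I.graph I.s 1 I.k W ∧
    ∀ W', IsTour I.graph I.s 1 I.k W' → arrivalTime 1 W ≤ arrivalTime 1 W'

/-! ### Representation of instances -/

/-- A representation of the graph of an instance: for every timestep a list of its components, each
of them given as a list of its vertices, in any order and without repetitions. -/
structure Listing (I : Instance) where
  comps : Fin I.L → List (List (Fin I.n))
  nodup_vertices : ∀ t, ∀ c ∈ comps t, c.Nodup
  nodup_comps : ∀ t, ((comps t).map List.toFinset).Nodup
  mem_iff : ∀ t (C : Finset (Fin I.n)),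
    C ∈ (comps t).map List.toFinset ↔ C ∈ (I.graph.layer t).parts

/-- The input as a sequence of numbers: `n`, `L`, `k`, `s`, and then, for each timestep, the number
of components followed by, for each component, its size and its vertices. -/
def Listing.encode {I : Instance} (R : Listing I) : List ℕ :=
  [I.n, I.L, I.k, (I.s : ℕ)] ++ (List.finRange I.L).flatMap fun t =>
    (R.comps t).length :: (R.comps t).flatMap fun c => c.length :: c.map fun v => (v : ℕ)

/-! ### The machine model: a randomized word RAM with words of `w` bits -/

/-- Arithmetic, bitwise and comparison operations on words. -/
inductive Op
  | add | sub | mul | div | mod | and | or | xor | shl | shr | lt | eq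

/-- The value of an operation on `w`-bit words (`sub` is truncated at `0`, a comparison gives `0` or
`1`, results are reduced modulo `2 ^ w`). -/
def Op.eval (w : ℕ) (o : Op) (a b : ℕ) : ℕ :=
  (match o with
    | .add => a + b
    | .sub => a - b
    | .mul => a * b
    | .div => a / b
    | .mod => a % b
    | .and => a &&& b
    | .or => a ||| b
    | .xor => a ^^^ b
    | .shl => a <<< b
    | .shr => a >>> b
    | .lt => if a < b then 1 else 0
    | .eq => if a = b then 1 else 0) % 2 ^ w

/-- Programs. The arguments `d`, `x`, `y` are numbers of registers. -/
inductive Prog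
  | skip
  /-- `reg d := a` -/
  | const (d a : ℕ)
  /-- `reg d := o (reg x) (reg y)` -/
  | op (o : Op) (d x y : ℕ)
  /-- `reg d := mem (reg x)` -/
  | load (d x : ℕ)
  /-- `mem (reg x) := reg y` -/
  | store (x y : ℕ)
  /-- `reg d :=` a uniformly random element of `{0, …, reg x - 1}` (`0` if `reg x = 0`) -/
  | rand (d x : ℕ)
  /-- first `p`, then `q` -/
  | seq (p q : Prog)
  /-- `p` if `reg x ≠ 0`, and `q` otherwise -/
  | cond (x : ℕ) (p q : Prog)
  /-- repeat `p` as long as `reg x ≠ 0` -/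
  | loop (x : ℕ) (p : Prog)

/-- The program has no random instruction: it is a deterministic algorithm. -/
def Prog.IsDeterministic : Prog → Prop
  | .rand _ _ => False
  | .seq p q => p.IsDeterministic ∧ q.IsDeterministic
  | .cond _ p q => p.IsDeterministic ∧ q.IsDeterministic
  | .loop _ p => p.IsDeterministic
  | _ => True

/-- The contents of the registers and of the memory. -/
structure State where
  reg : ℕ → ℕ
  mem : ℕ → ℕ

def State.setReg (σ : State) (d a : ℕ) : State := { σ with reg := Function.update σ.reg d a }

def State.setMem (σ : State) (i a : ℕ) : State := { σ with mem := Function.update σ.mem i a }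

/-- A configuration: the programs that remain to be executed, in this order, and the state. -/
structure Config where
  code : List Prog
  state : State

def Config.Halted (c : Config) : Prop := c.code = []

/-- One step of the machine, which takes one unit of time: the distribution of the next
configuration. A halted configuration does not change. -/
def step (w : ℕ) : Config → PMF Config
  | ⟨[], σ⟩ => PMF.pure ⟨[], σ⟩
  | ⟨.skip :: K, σ⟩ => PMF.pure ⟨K, σ⟩
  | ⟨.const d a :: K, σ⟩ => PMF.pure ⟨K, σ.setReg d (a % 2 ^ w)⟩
  | ⟨.op o d x y :: K, σ⟩ => PMF.pure ⟨K, σ.setReg d (o.eval w (σ.reg x) (σ.reg y))⟩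
  | ⟨.load d x :: K, σ⟩ => PMF.pure ⟨K, σ.setReg d (σ.mem (σ.reg x))⟩
  | ⟨.store x y :: K, σ⟩ => PMF.pure ⟨K, σ.setMem (σ.reg x) (σ.reg y)⟩
  | ⟨.rand d x :: K, σ⟩ =>
      (PMF.uniformOfFintype (Fin (σ.reg x - 1 + 1))).map fun i => ⟨K, σ.setReg d (i : ℕ)⟩
  | ⟨.seq p q :: K, σ⟩ => PMF.pure ⟨p :: q :: K, σ⟩
  | ⟨.cond x p q :: K, σ⟩ => PMF.pure ⟨(if σ.reg x ≠ 0 then p else q) :: K, σ⟩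
  | ⟨.loop x p :: K, σ⟩ => PMF.pure ⟨if σ.reg x ≠ 0 then p :: .loop x p :: K else K, σ⟩

/-- The distribution of the configuration after `T` steps. -/
def run (w : ℕ) : ℕ → Config → PMF Config
  | 0, c => PMF.pure c
  | T + 1, c => (step w c).bind (run w T)

/-- The initial configuration of the program `P` on an input: the input is in the memory cells
`0, 1, 2, …`; all other cells and all registers hold `0`. -/
def initial (w : ℕ) (P : Prog) (input : List ℕ) : Config :=
  ⟨[P], ⟨fun _ => 0, fun i => input.getD i 0 % 2 ^ w⟩⟩

/-- With words of `w` bits, the program `P` on the given input halts within `T` steps, whatever the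
outcomes of the random instructions. -/
def HaltsWithin (w : ℕ) (P : Prog) (input : List ℕ) (T : ℕ) : Prop :=
  ∀ c ∈ (run w T (initial w P input)).support, c.Halted

/-! ### Correct outputs -/

/-- The output in the state `σ` is the walk `W` (starting in timestep `1`): cell `0` holds its number
`l` of components, and cells `1, …, l` hold the positions (counted from `0`) of its components in the
lists of components of the timesteps `1, …, l`. -/
def Outputs {I : Instance} (R : Listing I) (σ : State) (W : List (Finset (Fin I.n))) : Prop :=
  σ.mem 0 = W.length ∧
    ∀ (i : ℕ) (h : i < W.length), ∃ h' : i < I.L,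
      ((R.comps ⟨i, h'⟩)[σ.mem (i + 1)]?).map List.toFinset = some W[i]

/-- The machine has halted with the right answer: an optimal solution for a yes-instance, and the
answer no, which is given as a `0` in cell `0`, for a no-instance. -/
def Solved {I : Instance} (R : Listing I) (c : Config) : Prop :=
  c.Halted ∧ (I.IsYes → ∃ W, I.IsOptimal W ∧ Outputs R c.state W) ∧
    (¬ I.IsYes → c.state.mem 0 = 0)

end NSTexp

end

/-! One deterministic program proves both halves of the theorem. Its running time is of order
`(k+1)^6 * 4^k * L * n^2`, and since `4 < 2e` the polynomial in `k` is absorbed by `(2e)^k`. Hence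
neither random instructions nor the factors `k^(a log k)` and `log n` are needed.

Combinatorics. Let `latest v u t` be the latest time at which one can leave `v` and still be at `u`
at time `t`. It is monotone in `t`, because staying at a vertex is always possible. So a tour with
arrival time `T` that visits `k` vertices exists iff there are `k` distinct vertices which, read
backwards from some place at time `T` and always using the latest departure, lead back to `s` at a
time `≥ 1`. Without distinctness, such sequences (`Feasible`) can be summed over by dynamic
programming (`exists_feasible_of_isTour`, `Backward`).

Algebra. To enforce distinctness, give vertex `x` the vector `(1, x, ..., x^(k-1))` and weight a
sequence by the square of its `k × k` Vandermonde determinant. The weight is positive for distinct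
vertices and `0` otherwise, so the sum over all feasible sequences is nonzero iff a good sequence
exists; squares cannot cancel (`total_pos`). A determinant is a product in the exterior algebra, and
its square is a product in the tensor square of that algebra. The dynamic program therefore runs
over pairs `(A, B)` of subsets of the `k` rows, which costs `4^k` (`table_eq`).

Word size. The sums are too large for a word, so they are computed modulo each of the consecutive
numbers `N, ..., N + R` with `R` of order `k^2`. If all of them divide a sum, so does `N * choose (N
+ R) R` (`mul_choose_dvd`), which exceeds the sum (`total_lt`); thus the sum is `0`
(`total_eq_zero`). If a modulus `r` does not divide the sum, self-reducibility modulo `r` yields a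
feasible sequence whose squared determinant is nonzero modulo `r`, hence has distinct vertices
(`tr_routeStmt`), and from it a walk (`tr_walkStmt`). The best walk over all moduli is optimal
(`solved_of_excluded`).

Machine. The algorithm is written in a small structured language and compiled to the word RAM. The
triples `Tr` bound the time by the syntactic size of a statement times a product of loop bounds; the
same size bounds the exponent of the word length needed to exclude overflow. -/

noncomputable section

namespace NSTexp

/-! ### Big-step execution of programs without random instructions -/

/-- The program `p` leads from `σ` to `σ'` in exactly `t` steps, whatever remains to be executed. -/
def Exec (w : ℕ) (p : Prog) (σ σ' : State) (t : ℕ) : Prop :=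
  ∀ K, run w t ⟨p :: K, σ⟩ = PMF.pure ⟨K, σ'⟩

theorem run_add (w a b : ℕ) (c : Config) : run w (a + b) c = (run w a c).bind (run w b) := by
  induction a generalizing c with
  | zero => simp [run]
  | succ a ih =>
    rw [Nat.succ_add]
    simp only [run, PMF.bind_bind]
    congr 1
    funext d
    exact ih d

theorem run_halted (w t : ℕ) (σ : State) : run w t ⟨[], σ⟩ = PMF.pure ⟨[], σ⟩ := by
  induction t with
  | zero => rfl
  | succ t ih => simp [run, step, ih]

theorem exec_one {w : ℕ} {p : Prog} {σ σ' : State}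
    (h : ∀ K, step w ⟨p :: K, σ⟩ = PMF.pure ⟨K, σ'⟩) : Exec w p σ σ' 1 := by
  intro K
  simp [run, h]

theorem exec_of_step {w : ℕ} {p : Prog} {L : List Prog} {σ σ' : State} {t : ℕ}
    (h : ∀ K, step w ⟨p :: K, σ⟩ = PMF.pure ⟨L ++ K, σ⟩)
    (h' : ∀ K, run w t ⟨L ++ K, σ⟩ = PMF.pure ⟨K, σ'⟩) : Exec w p σ σ' (t + 1) := by
  intro K
  simp [run, h, h']

theorem exec_skip (w : ℕ) (σ : State) : Exec w .skip σ σ 1 :=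
  exec_one fun K => by simp [step]

theorem exec_const (w d a : ℕ) (σ : State) :
    Exec w (.const d a) σ (σ.setReg d (a % 2 ^ w)) 1 :=
  exec_one fun K => by simp [step]

theorem exec_op (w : ℕ) (o : Op) (d x y : ℕ) (σ : State) :
    Exec w (.op o d x y) σ (σ.setReg d (o.eval w (σ.reg x) (σ.reg y))) 1 :=
  exec_one fun K => by simp [step]

theorem exec_load (w d x : ℕ) (σ : State) :
    Exec w (.load d x) σ (σ.setReg d (σ.mem (σ.reg x))) 1 :=
  exec_one fun K => by simp [step]

theorem exec_store (w x y : ℕ) (σ : State) :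
    Exec w (.store x y) σ (σ.setMem (σ.reg x) (σ.reg y)) 1 :=
  exec_one fun K => by simp [step]

theorem exec_seq {w : ℕ} {p q : Prog} {σ σ₁ σ₂ : State} {a b : ℕ} (hp : Exec w p σ σ₁ a)
    (hq : Exec w q σ₁ σ₂ b) : Exec w (.seq p q) σ σ₂ (a + b + 1) :=
  exec_of_step (L := [p, q]) (fun K => by simp [step]) fun K => by
    rw [run_add]
    simp [hp (q :: K), hq K]

theorem exec_cond {w x t : ℕ} {p q : Prog} {σ σ' : State}
    (h : Exec w (if σ.reg x ≠ 0 then p else q) σ σ' t) : Exec w (.cond x p q) σ σ' (t + 1) :=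
  exec_of_step (L := [if σ.reg x ≠ 0 then p else q]) (fun K => by simp [step]) fun K => h K

theorem exec_loop_stop {w x : ℕ} {p : Prog} {σ : State} (h : σ.reg x = 0) :
    Exec w (.loop x p) σ σ 1 :=
  exec_one fun K => by simp [step, h]

theorem exec_loop_next {w x : ℕ} {p : Prog} {σ σ₁ σ₂ : State} {a b : ℕ} (h : σ.reg x ≠ 0)
    (hp : Exec w p σ σ₁ a) (hq : Exec w (.loop x p) σ₁ σ₂ b) :
    Exec w (.loop x p) σ σ₂ (a + b + 1) :=
  exec_of_step (L := [p, .loop x p]) (fun K => by simp [step, h]) fun K => by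
    rw [run_add]
    simp [hp (.loop x p :: K), hq K]

/-! ### A small language with immutable local variables and multidimensional arrays -/

/-- The arithmetic operations of the language. -/
inductive Arith
  | add | sub | mul | div | mod | lt | eq

/-- The machine operation. -/
def Arith.toOp : Arith → Op
  | .add => .add | .sub => .sub | .mul => .mul | .div => .div | .mod => .mod | .lt => .lt | .eq => .eq

/-- The exact value of an operation on natural numbers. -/
def Arith.val : Arith → ℕ → ℕ → ℕ
  | .add, a, b => a + b
  | .sub, a, b => a - b
  | .mul, a, b => a * b
  | .div, a, b => a / b
  | .mod, a, b => a % b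
  | .lt, a, b => if a < b then 1 else 0
  | .eq, a, b => if a = b then 1 else 0

/-- Expressions. A local variable is given by its level, counted from the outermost one; an array
element by the array and the local variables that hold its five indices. -/
inductive Expr
  | lit (c : ℕ)
  | var (i : ℕ)
  /-- a cell of the low memory -/
  | inp (e : Expr)
  | read (a : Fin 16) (i₁ i₂ i₃ i₄ i₅ : ℕ)
  | bin (o : Arith) (e₁ e₂ : Expr)

instance : Add Expr := ⟨.bin .add⟩
instance : Sub Expr := ⟨.bin .sub⟩
instance : Mul Expr := ⟨.bin .mul⟩
instance : Div Expr := ⟨.bin .div⟩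
instance : Mod Expr := ⟨.bin .mod⟩

/-- Statements. -/
inductive Stmt
  | skip
  /-- assignment to an array element -/
  | store (a : Fin 16) (i₁ i₂ i₃ i₄ i₅ : ℕ) (e : Expr)
  /-- assignment to a cell of the low memory -/
  | out (e₁ e₂ : Expr)
  | seq (s₁ s₂ : Stmt)
  /-- execution with a new local variable -/
  | letE (e : Expr) (s : Stmt)
  /-- execution for `j = 0, …, e - 1`; the new local variables are the bound and `j` -/
  | forE (e : Expr) (s : Stmt)
  | ite (e : Expr) (s₁ s₂ : Stmt)

/-- The low memory and the arrays. -/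
@[ext] structure Mem where
  low : ℕ → ℕ
  arr : Fin 16 → ℕ → ℕ → ℕ → ℕ → ℕ → ℕ

/-- Assignment to an array element. -/
def Mem.set (m : Mem) (a : Fin 16) (i₁ i₂ i₃ i₄ i₅ v : ℕ) : Mem :=
  { m with arr := fun a' j₁ j₂ j₃ j₄ j₅ =>
      if a' = a ∧ j₁ = i₁ ∧ j₂ = i₂ ∧ j₃ = i₃ ∧ j₄ = i₄ ∧ j₅ = i₅ then v else m.arr a' j₁ j₂ j₃ j₄ j₅ }

/-- Assignment to a cell of the low memory. -/
def Mem.setLow (m : Mem) (i v : ℕ) : Mem := { m with low := Function.update m.low i v }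

/-- The value of the local variable of level `i` in an environment (innermost variable first). -/
def lookup : List ℕ → ℕ → ℕ
  | [], _ => 0
  | v :: ρ, i => if i = ρ.length then v else lookup ρ i

/-- The value of an expression. -/
def Expr.val (ρ : List ℕ) (m : Mem) : Expr → ℕ
  | .lit c => c
  | .var i => lookup ρ i
  | .inp e => m.low (e.val ρ m)
  | .read a i₁ i₂ i₃ i₄ i₅ =>
    m.arr a (lookup ρ i₁) (lookup ρ i₂) (lookup ρ i₃) (lookup ρ i₄) (lookup ρ i₅)
  | .bin o e₁ e₂ => o.val (e₁.val ρ m) (e₂.val ρ m)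

/-- All accesses to the low memory are to cells below `b`. -/
def Expr.Ok (b : ℕ) (ρ : List ℕ) (m : Mem) : Expr → Prop
  | .inp e => e.Ok b ρ m ∧ e.val ρ m < b
  | .bin _ e₁ e₂ => e₁.Ok b ρ m ∧ e₂.Ok b ρ m
  | _ => True

/-- A bound for the running time and for the bit length of the intermediate results. -/
def Expr.size : Expr → ℕ
  | .lit c => c + 2
  | .var _ => 2
  | .inp e => e.size + 3
  | .read .. => 40
  | .bin _ e₁ e₂ => e₁.size + e₂.size + 4

/-- A bound for the running time of a single pass. -/
def Stmt.size : Stmt → ℕ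
  | .skip => 1
  | .store _ _ _ _ _ _ e => e.size + 50
  | .out e₁ e₂ => e₁.size + e₂.size + 5
  | .seq s₁ s₂ => s₁.size + s₂.size + 2
  | .letE e s => e.size + s.size + 5
  | .forE e s => e.size + s.size + 30
  | .ite e s₁ s₂ => e.size + s₁.size + s₂.size + 5

/-! The registers `0` and `1` hold the first address `b` of the arrays and a strict bound `Z` for all
indices; the local variable of level `i` is in register `i + 2`. -/

/-- Copying the local variable of level `i` to register `d`, if there are `D` local variables. -/
def copyVar (D i d : ℕ) : Prog := if i < D then .op .or d (i + 2) (i + 2) else .const d 0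

/-- The address of an array element. -/
def address (b Z a i₁ i₂ i₃ i₄ i₅ : ℕ) : ℕ :=
  ((((i₁ * Z + i₂) * Z + i₃) * Z + i₄) * Z + i₅) * 16 + a + b

/-- Computing `reg d * Z +` the local variable of level `i`. -/
def hornerStep (D i d : ℕ) : Prog :=
  .seq (.op .mul d d 1) (.seq (copyVar D i (d + 1)) (.op .add d d (d + 1)))

/-- Computing the address of an array element. -/
def addressProg (a : Fin 16) (i₁ i₂ i₃ i₄ i₅ D d : ℕ) : Prog :=
  .seq (copyVar D i₁ d) (.seq (hornerStep D i₂ d) (.seq (hornerStep D i₃ d)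
    (.seq (hornerStep D i₄ d) (.seq (hornerStep D i₅ d) (.seq (.const (d + 1) 16)
      (.seq (.op .mul d d (d + 1)) (.seq (.const (d + 1) a) (.seq (.op .add d d (d + 1))
        (.op .add d d 0)))))))))

/-- The code for the value of an expression. -/
def Expr.compile (D : ℕ) : Expr → ℕ → Prog
  | .lit c, d => .const d c
  | .var i, d => copyVar D i d
  | .inp e, d => .seq (e.compile D d) (.load d d)
  | .read a i₁ i₂ i₃ i₄ i₅, d => .seq (addressProg a i₁ i₂ i₃ i₄ i₅ D d) (.load d d)
  | .bin o e₁ e₂, d =>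
    .seq (e₁.compile D d) (.seq (e₂.compile D (d + 1)) (.op o.toOp d d (d + 1)))

/-- The code of a statement. -/
def Stmt.compile : Stmt → ℕ → Prog
  | .skip, _ => .skip
  | .store a i₁ i₂ i₃ i₄ i₅ e, D =>
    .seq (e.compile D (D + 2)) (.seq (addressProg a i₁ i₂ i₃ i₄ i₅ D (D + 3))
      (.store (D + 3) (D + 2)))
  | .out e₁ e₂, D =>
    .seq (e₁.compile D (D + 2)) (.seq (e₂.compile D (D + 3)) (.store (D + 2) (D + 3)))
  | .seq s₁ s₂, D => .seq (s₁.compile D) (s₂.compile D)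
  | .letE e s, D => .seq (e.compile D (D + 2)) (s.compile (D + 1))
  | .forE e s, D =>
    .seq (e.compile D (D + 2)) (.seq (.const (D + 3) 0) (.seq (.op .lt (D + 4) (D + 3) (D + 2))
      (.loop (D + 4) (.seq (s.compile (D + 2)) (.seq (.const (D + 4) 1)
        (.seq (.op .add (D + 3) (D + 3) (D + 4)) (.op .lt (D + 4) (D + 3) (D + 2))))))))
  | .ite e s₁ s₂, D => .seq (e.compile D (D + 2)) (.cond (D + 2) (s₁.compile D) (s₂.compile D))

theorem Expr.isDeterministic_compile (e : Expr) (D d : ℕ) : (e.compile D d).IsDeterministic := by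
  have hc : ∀ i d, (copyVar D i d).IsDeterministic := by
    intro i d
    unfold copyVar
    split <;> simp [Prog.IsDeterministic]
  induction e generalizing d with
  | lit c => simp [Expr.compile, Prog.IsDeterministic]
  | var i => exact hc i d
  | inp e ih => exact ⟨ih d, trivial⟩
  | read a i₁ i₂ i₃ i₄ i₅ =>
    simp [Expr.compile, addressProg, hornerStep, Prog.IsDeterministic, hc]
  | bin o e₁ e₂ h₁ h₂ => exact ⟨h₁ d, h₂ _, trivial⟩

theorem Stmt.isDeterministic_compile (s : Stmt) (D : ℕ) : (s.compile D).IsDeterministic := by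
  have hc : ∀ D i d, (copyVar D i d).IsDeterministic := by
    intro D i d
    unfold copyVar
    split <;> simp [Prog.IsDeterministic]
  induction s generalizing D with
  | skip => trivial
  | store a i₁ i₂ i₃ i₄ i₅ e =>
    simp [Stmt.compile, addressProg, hornerStep, Prog.IsDeterministic, hc,
      Expr.isDeterministic_compile]
  | out e₁ e₂ => simp [Stmt.compile, Prog.IsDeterministic, Expr.isDeterministic_compile]
  | seq s₁ s₂ h₁ h₂ => exact ⟨h₁ D, h₂ D⟩
  | letE e s h => exact ⟨e.isDeterministic_compile _ _, h _⟩
  | forE e s h => simp [Stmt.compile, Prog.IsDeterministic, Expr.isDeterministic_compile, h]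
  | ite e s₁ s₂ h₁ h₂ => exact ⟨e.isDeterministic_compile _ _, h₁ D, h₂ D⟩

/-! ### Correctness of the compiled code -/

/-- The registers hold the environment. -/
def Agree (b Z : ℕ) (ρ : List ℕ) (σ : State) : Prop :=
  σ.reg 0 = b ∧ σ.reg 1 = Z ∧ ∀ i < ρ.length, σ.reg (i + 2) = lookup ρ i

/-- The memory of the machine holds `m`. -/
def Holds (b Z : ℕ) (mem : ℕ → ℕ) (m : Mem) : Prop :=
  (∀ x < b, mem x = m.low x) ∧
    ∀ (a : Fin 16) (i₁ i₂ i₃ i₄ i₅ : ℕ), i₁ < Z → i₂ < Z → i₃ < Z → i₄ < Z → i₅ < Z →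
      mem (address b Z a i₁ i₂ i₃ i₄ i₅) = m.arr a i₁ i₂ i₃ i₄ i₅

/-- All values in the memory are less than `Z`. -/
def Mem.Small (b Z : ℕ) (m : Mem) : Prop :=
  (∀ x < b, m.low x < Z) ∧ ∀ a i₁ i₂ i₃ i₄ i₅, m.arr a i₁ i₂ i₃ i₄ i₅ < Z

theorem lookup_of_length_le {ρ : List ℕ} {i : ℕ} (h : ρ.length ≤ i) : lookup ρ i = 0 := by
  induction ρ with
  | nil => rfl
  | cons v ρ ih =>
    simp only [List.length_cons] at h
    rw [lookup, if_neg (by omega), ih (by omega)]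

theorem agree_of_reg_eq {b Z : ℕ} {ρ : List ℕ} {σ σ' : State} (h : Agree b Z ρ σ)
    (h' : ∀ i < ρ.length + 2, σ'.reg i = σ.reg i) : Agree b Z ρ σ' :=
  ⟨by rw [h' 0 (by omega), h.1], by rw [h' 1 (by omega), h.2.1],
    fun i hi => by rw [h' _ (by omega), h.2.2 i hi]⟩

theorem agree_cons {b Z v : ℕ} {ρ : List ℕ} {σ : State} (h : Agree b Z ρ σ)
    (h' : σ.reg (ρ.length + 2) = v) : Agree b Z (v :: ρ) σ := by
  refine ⟨h.1, h.2.1, fun i hi => ?_⟩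
  simp only [List.length_cons] at hi
  rw [lookup]
  split_ifs with hi'
  · rw [hi', h']
  · exact h.2.2 i (by omega)

theorem agree_tail {b Z v : ℕ} {ρ : List ℕ} {σ : State} (h : Agree b Z (v :: ρ) σ) :
    Agree b Z ρ σ := by
  refine ⟨h.1, h.2.1, fun i hi => ?_⟩
  have := h.2.2 i (by simp; omega)
  rwa [lookup, if_neg (by omega)] at this

theorem agree_head {b Z v : ℕ} {ρ : List ℕ} {σ : State} (h : Agree b Z (v :: ρ) σ) :
    σ.reg (ρ.length + 2) = v := by
  have := h.2.2 ρ.length (by simp)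
  rwa [lookup, if_pos rfl] at this

@[simp] theorem State.setReg_mem (σ : State) (d a : ℕ) : (σ.setReg d a).mem = σ.mem := rfl

theorem State.setReg_reg (σ : State) (d a i : ℕ) :
    (σ.setReg d a).reg i = if i = d then a else σ.reg i := by
  simp [State.setReg, Function.update_apply]

/-- There is no move instruction; the bitwise `or` of a word with itself serves as one. A level
outside the environment has `lookup` value `0`, which is what the constant instruction produces. -/
theorem exec_copyVar {w b Z : ℕ} {ρ : List ℕ} {σ : State} (hw : Z ≤ 2 ^ w) (hρ : ∀ i, lookup ρ i < Z)
    (hσ : Agree b Z ρ σ) (i d : ℕ) :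
    Exec w (copyVar ρ.length i d) σ (σ.setReg d (lookup ρ i)) 1 := by
  unfold copyVar
  split_ifs with h
  · have := exec_op w .or d (i + 2) (i + 2) σ
    rwa [Op.eval, hσ.2.2 i h, Nat.or_self, Nat.mod_eq_of_lt ((hρ i).trans_le hw)] at this
  · have := exec_const w d 0 σ
    rw [Nat.zero_mod] at this
    rwa [lookup_of_length_le (not_lt.1 h)]

theorem exec_hornerStep {w b Z : ℕ} {ρ : List ℕ} {σ : State} (hw : Z ≤ 2 ^ w)
    (hρ : ∀ i, lookup ρ i < Z) (hσ : Agree b Z ρ σ) (i d : ℕ) (hd : ρ.length + 2 ≤ d)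
    (hb : σ.reg d * Z + Z ≤ 2 ^ w) :
    ∃ σ', Exec w (hornerStep ρ.length i d) σ σ' 5 ∧ σ'.mem = σ.mem ∧
      σ'.reg d = σ.reg d * Z + lookup ρ i ∧ ∀ j < d, σ'.reg j = σ.reg j := by
  have h0 := hρ i
  have e₁ := exec_op w .mul d d 1 σ
  rw [Op.eval, hσ.2.1, Nat.mod_eq_of_lt (by omega)] at e₁
  have a₁ : Agree b Z ρ (σ.setReg d (σ.reg d * Z)) :=
    agree_of_reg_eq hσ fun j hj => by rw [State.setReg_reg, if_neg (by omega)]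
  have e₂ := exec_copyVar hw hρ a₁ i (d + 1)
  have e₃ := exec_op w .add d d (d + 1)
    ((σ.setReg d (σ.reg d * Z)).setReg (d + 1) (lookup ρ i))
  simp only [Op.eval, State.setReg_reg, reduceIte] at e₃
  rw [if_neg (by omega), Nat.mod_eq_of_lt (by omega)] at e₃
  refine ⟨_, exec_seq e₁ (exec_seq e₂ e₃), rfl, ?_, fun j hj => ?_⟩
  · simp [State.setReg_reg]
  · simp only [State.setReg_reg]
    rw [if_neg (by omega), if_neg (by omega), if_neg (by omega)]

/-- Horner's scheme in base `Z`. Every intermediate result is at most `Z ^ 7`, so the reductions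
modulo `2 ^ w` never take effect. -/
theorem exec_addressProg {w b Z : ℕ} {ρ : List ℕ} {σ : State} (hZ : 16 ≤ Z) (hbZ : b < Z)
    (hw : Z ^ 8 ≤ 2 ^ w) (hρ : ∀ i, lookup ρ i < Z) (hσ : Agree b Z ρ σ) (a : Fin 16)
    (i₁ i₂ i₃ i₄ i₅ d : ℕ) (hd : ρ.length + 2 ≤ d) :
    ∃ σ', Exec w (addressProg a i₁ i₂ i₃ i₄ i₅ ρ.length d) σ σ' 35 ∧ σ'.mem = σ.mem ∧
      σ'.reg d = address b Z a (lookup ρ i₁) (lookup ρ i₂) (lookup ρ i₃) (lookup ρ i₄)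
        (lookup ρ i₅) ∧ ∀ j < d, σ'.reg j = σ.reg j := by
  have hpow : ∀ i, i ≤ 8 → Z ^ i ≤ 2 ^ w := fun i hi =>
    (Nat.pow_le_pow_right (by omega) hi).trans hw
  have key : ∀ x i y, x < Z ^ i → y < Z → x * Z + y < Z ^ (i + 1) := by
    intro x i y hx hy
    have : (x + 1) * Z ≤ Z ^ i * Z := Nat.mul_le_mul_right Z hx
    rw [pow_succ]
    linarith
  have key' : ∀ x i, x < Z ^ i → x * Z + Z ≤ Z ^ (i + 1) := by
    intro x i hx
    have : (x + 1) * Z ≤ Z ^ i * Z := Nat.mul_le_mul_right Z hx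
    rw [pow_succ]
    linarith
  have hw1 : Z ≤ 2 ^ w := by simpa using hpow 1 (by omega)
  have b₁ : lookup ρ i₁ < Z ^ 1 := by simpa using hρ i₁
  have b₂ := key _ _ _ b₁ (hρ i₂)
  have b₃ := key _ _ _ b₂ (hρ i₃)
  have b₄ := key _ _ _ b₃ (hρ i₄)
  have b₅ := key _ _ _ b₄ (hρ i₅)
  have e₁ := exec_copyVar hw1 hρ hσ i₁ d
  set σ₁ := σ.setReg d (lookup ρ i₁)
  have f₁ : ∀ j < d, σ₁.reg j = σ.reg j := fun j hj => by
    rw [State.setReg_reg, if_neg (by omega)]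
  have r₁ : σ₁.reg d = lookup ρ i₁ := by rw [State.setReg_reg, if_pos rfl]
  have A₁ : Agree b Z ρ σ₁ := agree_of_reg_eq hσ fun j hj => f₁ j (by omega)
  obtain ⟨σ₂, e₂, m₂, r₂, f₂⟩ := exec_hornerStep hw1 hρ A₁ i₂ d hd
    (by rw [r₁]; exact (key' _ _ b₁).trans (hpow _ (by omega)))
  have A₂ : Agree b Z ρ σ₂ := agree_of_reg_eq A₁ fun j hj => f₂ j (by omega)
  rw [r₁] at r₂
  obtain ⟨σ₃, e₃, m₃, r₃, f₃⟩ := exec_hornerStep hw1 hρ A₂ i₃ d hd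
    (by rw [r₂]; exact (key' _ _ b₂).trans (hpow _ (by omega)))
  have A₃ : Agree b Z ρ σ₃ := agree_of_reg_eq A₂ fun j hj => f₃ j (by omega)
  rw [r₂] at r₃
  obtain ⟨σ₄, e₄, m₄, r₄, f₄⟩ := exec_hornerStep hw1 hρ A₃ i₄ d hd
    (by rw [r₃]; exact (key' _ _ b₃).trans (hpow _ (by omega)))
  have A₄ : Agree b Z ρ σ₄ := agree_of_reg_eq A₃ fun j hj => f₄ j (by omega)
  rw [r₃] at r₄
  obtain ⟨σ₅, e₅, m₅, r₅, f₅⟩ := exec_hornerStep hw1 hρ A₄ i₅ d hd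
    (by rw [r₄]; exact (key' _ _ b₄).trans (hpow _ (by omega)))
  have A₅ : Agree b Z ρ σ₅ := agree_of_reg_eq A₄ fun j hj => f₅ j (by omega)
  rw [r₄] at r₅
  set x := (((lookup ρ i₁ * Z + lookup ρ i₂) * Z + lookup ρ i₃) * Z + lookup ρ i₄) * Z
    + lookup ρ i₅
  -- The summands `16` and `Z` leave room for the array number `a < 16` and the offset `b < Z` added
  -- at the end; `17 ≤ Z ^ 2` comes from `16 ≤ Z`.
  have hx : x * 16 + 16 + Z ≤ Z ^ 7 := by
    have h5 : x + 1 ≤ Z ^ 5 := b₅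
    have h6 : Z ≤ Z ^ 5 := Nat.le_self_pow (by norm_num) Z
    calc x * 16 + 16 + Z ≤ (x + 1) * 16 + Z ^ 5 := by omega
      _ ≤ Z ^ 5 * 16 + Z ^ 5 := by omega
      _ = Z ^ 5 * 17 := by ring
      _ ≤ Z ^ 5 * Z ^ 2 := Nat.mul_le_mul_left _ (by nlinarith)
      _ = Z ^ 7 := by ring
  have hx' := hx.trans (hpow 7 (by omega))
  have ha := a.isLt
  have e₆ := exec_const w (d + 1) 16 σ₅
  rw [Nat.mod_eq_of_lt (by omega)] at e₆
  have e₇ := exec_op w .mul d d (d + 1) (σ₅.setReg (d + 1) 16)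
  simp only [Op.eval, State.setReg_reg, reduceIte] at e₇
  rw [if_neg (by omega), r₅, Nat.mod_eq_of_lt (by omega)] at e₇
  set σ₇ := (σ₅.setReg (d + 1) 16).setReg d (x * 16) with hσ₇
  have e₈ := exec_const w (d + 1) a σ₇
  rw [Nat.mod_eq_of_lt (by omega)] at e₈
  have e₉ := exec_op w .add d d (d + 1) (σ₇.setReg (d + 1) a)
  simp only [Op.eval, State.setReg_reg, hσ₇, reduceIte] at e₉
  rw [if_neg (by omega), Nat.mod_eq_of_lt (by omega)] at e₉
  rw [← hσ₇] at e₉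
  set σ₉ := (σ₇.setReg (d + 1) a).setReg d (x * 16 + a) with hσ₉
  have e₀ := exec_op w .add d d 0 σ₉
  simp only [Op.eval, State.setReg_reg, hσ₉, hσ₇, reduceIte] at e₀
  rw [ if_neg (by omega), if_neg (by omega), if_neg (by omega), if_neg (by omega),
    A₅.1, Nat.mod_eq_of_lt (by omega)] at e₀
  rw [← hσ₇, ← hσ₉] at e₀
  refine ⟨_, exec_seq e₁ (exec_seq e₂ (exec_seq e₃ (exec_seq e₄ (exec_seq e₅ (exec_seq e₆
    (exec_seq e₇ (exec_seq e₈ (exec_seq e₉ e₀)))))))), ?_, ?_, fun j hj => ?_⟩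
  · simp only [hσ₉, hσ₇, State.setReg_mem, m₅, m₄, m₃, m₂]
    rfl
  · rw [State.setReg_reg, if_pos rfl]
    rfl
  · simp only [hσ₉, hσ₇, State.setReg_reg]
    rw [if_neg (by omega), if_neg (by omega), if_neg (by omega), if_neg (by omega),
      if_neg (by omega), f₅ j hj, f₄ j hj, f₃ j hj, f₂ j hj, f₁ j hj]

/-- An operation at most multiplies the bounds of its operands or doubles their product; the extra
`4` in `Expr.size` absorbs that doubling. This is what makes exact arithmetic on naturals agree with
arithmetic on words. -/
theorem Expr.val_lt {b Z : ℕ} {ρ : List ℕ} {m : Mem} (hZ : 2 ≤ Z) (hρ : ∀ i, lookup ρ i < Z)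
    (hm : m.Small b Z) (e : Expr) (he : e.Ok b ρ m) : e.val ρ m < Z ^ e.size := by
  have hone : ∀ x i, x < Z → i ≠ 0 → x < Z ^ i := fun x i hx hi =>
    hx.trans_le (Nat.le_self_pow hi Z)
  induction e with
  | lit c =>
    calc c < 2 ^ c := Nat.lt_two_pow_self
      _ ≤ 2 ^ (c + 2) := Nat.pow_le_pow_right (by omega) (by omega)
      _ ≤ Z ^ (c + 2) := Nat.pow_le_pow_left hZ _
  | var i => exact hone _ _ (hρ i) (by simp [Expr.size])
  | inp e ih => exact hone _ _ (hm.1 _ he.2) (by simp [Expr.size])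
  | read a i₁ i₂ i₃ i₄ i₅ => exact hone _ _ (hm.2 _ _ _ _ _ _) (by simp [Expr.size])
  | bin o e₁ e₂ h₁ h₂ =>
    have h₁ := h₁ he.1
    have h₂ := h₂ he.2
    have hz : ∀ i, 1 ≤ Z ^ i := fun i => Nat.one_le_pow _ _ (by omega)
    have p : Z ^ (Expr.bin o e₁ e₂).size = Z ^ e₁.size * Z ^ e₂.size * Z ^ 4 := by
      rw [Expr.size, pow_add, pow_add]
    have p4 : 2 ≤ Z ^ 4 := hZ.trans (Nat.le_self_pow (by norm_num) Z)
    have hu := hz e₁.size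
    have hv := hz e₂.size
    rw [p]
    simp only [Expr.val]
    set x := e₁.val ρ m
    set y := e₂.val ρ m
    set u := Z ^ e₁.size
    set v := Z ^ e₂.size
    have q : u * v * 2 ≤ u * v * Z ^ 4 := Nat.mul_le_mul_left _ p4
    have q₁ : u ≤ u * v := Nat.le_mul_of_pos_right _ hv
    have q₂ : v ≤ u * v := Nat.le_mul_of_pos_left _ hu
    cases o <;> simp only [Arith.val]
    · omega
    · omega
    · have : x * y ≤ u * v := Nat.mul_le_mul h₁.le h₂.le
      omega
    · have := Nat.div_le_self x y
      omega
    · have := Nat.mod_le x y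
      omega
    · split_ifs <;> omega
    · split_ifs <;> omega

/-- Evaluation into register `d` leaves all lower registers alone. So the local variables survive,
and the first operand stays in `d` while the second one is evaluated into `d + 1`. -/
theorem Expr.exec_compile {w b Z : ℕ} {ρ : List ℕ} {m : Mem} (hZ : 16 ≤ Z) (hbZ : b < Z)
    (hρ : ∀ i, lookup ρ i < Z) (hm : m.Small b Z) (e : Expr) (hw : Z ^ e.size ≤ 2 ^ w)
    (he : e.Ok b ρ m) {σ : State} (hσ : Agree b Z ρ σ) (hσm : Holds b Z σ.mem m) (d : ℕ)
    (hd : ρ.length + 2 ≤ d) :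
    ∃ σ' t, t ≤ e.size ∧ Exec w (e.compile ρ.length d) σ σ' t ∧ σ'.mem = σ.mem ∧
      σ'.reg d = e.val ρ m ∧ ∀ j < d, σ'.reg j = σ.reg j := by
  have hlt : e.val ρ m < 2 ^ w := (e.val_lt (by omega) hρ hm he).trans_le hw
  induction e generalizing σ d with
  | lit c =>
    have := exec_const w d c σ
    rw [Nat.mod_eq_of_lt (show c < 2 ^ w from hlt)] at this
    refine ⟨_, 1, by simp [Expr.size], this, rfl, ?_, fun j hj => ?_⟩
    · rw [State.setReg_reg, if_pos rfl, Expr.val]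
    · rw [State.setReg_reg, if_neg (by omega)]
  | var i =>
    have hw1 : Z ≤ 2 ^ w := (Nat.le_self_pow (by simp [Expr.size]) Z).trans hw
    refine ⟨_, 1, by simp [Expr.size], exec_copyVar hw1 hρ hσ i d, rfl, ?_, fun j hj => ?_⟩
    · rw [State.setReg_reg, if_pos rfl, Expr.val]
    · rw [State.setReg_reg, if_neg (by omega)]
  | inp e ih =>
    have hw' : Z ^ e.size ≤ 2 ^ w :=
      (Nat.pow_le_pow_right (by omega) (by simp only [Expr.size]; omega)).trans hw
    obtain ⟨σ₁, t, ht, e₁, m₁, r₁, f₁⟩ := ih hw' he.1 hσ hσm d hd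
      ((e.val_lt (by omega) hρ hm he.1).trans_le hw')
    have e₂ := exec_load w d d σ₁
    rw [r₁, m₁, hσm.1 _ he.2] at e₂
    refine ⟨_, _, ?_, exec_seq e₁ e₂, m₁, ?_, fun j hj => ?_⟩
    · simp only [Expr.size]; omega
    · rw [State.setReg_reg, if_pos rfl, Expr.val]
    · rw [State.setReg_reg, if_neg (by omega), f₁ j hj]
  | read a i₁ i₂ i₃ i₄ i₅ =>
    have hw' : Z ^ 8 ≤ 2 ^ w :=
      (Nat.pow_le_pow_right (by omega) (by simp only [Expr.size]; omega)).trans hw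
    obtain ⟨σ₁, e₁, m₁, r₁, f₁⟩ := exec_addressProg hZ hbZ hw' hρ hσ a i₁ i₂ i₃ i₄ i₅ d hd
    have e₂ := exec_load w d d σ₁
    rw [r₁, m₁, hσm.2 _ _ _ _ _ _ (hρ _) (hρ _) (hρ _) (hρ _) (hρ _)] at e₂
    refine ⟨_, _, ?_, exec_seq e₁ e₂, m₁, ?_, fun j hj => ?_⟩
    · simp only [Expr.size]; omega
    · rw [State.setReg_reg, if_pos rfl, Expr.val]
    · rw [State.setReg_reg, if_neg (by omega), f₁ j hj]
  | bin o e₁ e₂ h₁ h₂ =>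
    have hw₁ : Z ^ e₁.size ≤ 2 ^ w :=
      (Nat.pow_le_pow_right (by omega) (by simp only [Expr.size]; omega)).trans hw
    have hw₂ : Z ^ e₂.size ≤ 2 ^ w :=
      (Nat.pow_le_pow_right (by omega) (by simp only [Expr.size]; omega)).trans hw
    obtain ⟨σ₁, t₁, ht₁, e₁', m₁, r₁, f₁⟩ := h₁ hw₁ he.1 hσ hσm d hd
      ((e₁.val_lt (by omega) hρ hm he.1).trans_le hw₁)
    obtain ⟨σ₂, t₂, ht₂, e₂', m₂, r₂, f₂⟩ := h₂ hw₂ he.2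
      (agree_of_reg_eq hσ fun j hj => f₁ j (by omega)) (by rwa [m₁]) (d + 1) (by omega)
      ((e₂.val_lt (by omega) hρ hm he.2).trans_le hw₂)
    have e₃ := exec_op w o.toOp d d (d + 1) σ₂
    have hv : o.toOp.eval w (σ₂.reg d) (σ₂.reg (d + 1)) = (Expr.bin o e₁ e₂).val ρ m := by
      rw [f₂ d (by omega), r₁, r₂, ← Nat.mod_eq_of_lt hlt]
      cases o <;> rfl
    rw [hv] at e₃
    refine ⟨_, _, ?_, exec_seq e₁' (exec_seq e₂' e₃), ?_, ?_, fun j hj => ?_⟩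
    · simp only [Expr.size]; omega
    · rw [State.setReg_mem, m₂, m₁]
    · rw [State.setReg_reg, if_pos rfl]
    · rw [State.setReg_reg, if_neg (by omega), f₂ j (by omega), f₁ j hj]

section

/-! ### Rules for the correctness and the running time of statements -/

/-- Started with the environment `ρ` and the memory `m`, the code of the statement `s` halts after at
most `s.size * I` steps with a memory that satisfies `Q`, provided that the words are long enough. -/
def Tr (w b Z : ℕ) (s : Stmt) (ρ : List ℕ) (m : Mem) (I : ℕ) (Q : Mem → Prop) : Prop :=
  16 ≤ Z → b < Z → Z ^ s.size ≤ 2 ^ w → (∀ i, lookup ρ i < Z) → m.Small b Z → 1 ≤ I →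
    ∀ σ, Agree b Z ρ σ → Holds b Z σ.mem m →
      ∃ m' σ' t, Q m' ∧ m'.Small b Z ∧ t ≤ s.size * I ∧ Exec w (s.compile ρ.length) σ σ' t ∧
        Agree b Z ρ σ' ∧ Holds b Z σ'.mem m'

variable {w b Z : ℕ}

theorem horner_inj {x x' y y' : ℕ} (hy : y < Z) (hy' : y' < Z) (h : x * Z + y = x' * Z + y') :
    x = x' ∧ y = y' := by
  have h₁ : (x * Z + y) / Z = x := by
    rw [mul_comm, Nat.mul_add_div (by omega), Nat.div_eq_of_lt hy, add_zero]
  have h₂ : (x' * Z + y') / Z = x' := by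
    rw [mul_comm, Nat.mul_add_div (by omega), Nat.div_eq_of_lt hy', add_zero]
  have : x = x' := by rw [← h₁, h, h₂]
  subst this
  exact ⟨rfl, by omega⟩

/-- Digits in base `Z` are unique. The leading digits `i₁`, `j₁` need no bound, and the sixteen
arrays are interleaved by the last factor `16`. -/
theorem address_inj {a a' : Fin 16} {i₁ i₂ i₃ i₄ i₅ j₁ j₂ j₃ j₄ j₅ : ℕ} (hi₂ : i₂ < Z)
    (hi₃ : i₃ < Z) (hi₄ : i₄ < Z) (hi₅ : i₅ < Z) (hj₂ : j₂ < Z) (hj₃ : j₃ < Z) (hj₄ : j₄ < Z)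
    (hj₅ : j₅ < Z) (h : address b Z a i₁ i₂ i₃ i₄ i₅ = address b Z a' j₁ j₂ j₃ j₄ j₅) :
    a = a' ∧ i₁ = j₁ ∧ i₂ = j₂ ∧ i₃ = j₃ ∧ i₄ = j₄ ∧ i₅ = j₅ := by
  unfold address at h
  have ha := a.isLt
  have ha' := a'.isLt
  obtain ⟨h₁, rfl⟩ := horner_inj hi₅ hj₅ (by omega :
    (((i₁ * Z + i₂) * Z + i₃) * Z + i₄) * Z + i₅ = (((j₁ * Z + j₂) * Z + j₃) * Z + j₄) * Z + j₅)
  obtain ⟨h₂, rfl⟩ := horner_inj hi₄ hj₄ h₁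
  obtain ⟨h₃, rfl⟩ := horner_inj hi₃ hj₃ h₂
  obtain ⟨rfl, rfl⟩ := horner_inj hi₂ hj₂ h₃
  exact ⟨Fin.ext (by omega), rfl, rfl, rfl, rfl, rfl⟩

theorem Tr.mono {s : Stmt} {ρ : List ℕ} {m : Mem} {I I' : ℕ} {Q Q' : Mem → Prop}
    (h : Tr w b Z s ρ m I Q) (hI : I ≤ I') (hI1 : 1 ≤ I) (hQ : ∀ m', Q m' → Q' m') :
    Tr w b Z s ρ m I' Q' := by
  intro hZ hb hw hρ hm _ σ hσ hσm
  obtain ⟨m', σ', t, hQ', hs, ht, he, ha, hh⟩ := h hZ hb hw hρ hm hI1 σ hσ hσm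
  exact ⟨m', σ', t, hQ _ hQ', hs, ht.trans (Nat.mul_le_mul_left _ hI), he, ha, hh⟩

theorem Tr.conseq {s : Stmt} {ρ : List ℕ} {m : Mem} {I : ℕ} {Q Q' : Mem → Prop}
    (h : Tr w b Z s ρ m I Q) (hQ : ∀ m', Q m' → Q' m') : Tr w b Z s ρ m I Q' := by
  intro hZ hb hw hρ hm hI
  exact h.mono le_rfl hI hQ hZ hb hw hρ hm hI

/-- The values in the memory may be assumed to be small. -/
theorem tr_small {s : Stmt} {ρ : List ℕ} {m : Mem} {I : ℕ} {Q : Mem → Prop}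
    (h : m.Small b Z → Tr w b Z s ρ m I Q) : Tr w b Z s ρ m I Q :=
  fun hZ hb hw hρ hm => h hm hZ hb hw hρ hm

theorem tr_skip {ρ : List ℕ} {m : Mem} {I : ℕ} {Q : Mem → Prop} (hQ : Q m) :
    Tr w b Z .skip ρ m I Q := by
  intro hZ hb hw hρ hm hI σ hσ hσm
  exact ⟨m, σ, 1, hQ, hm, by simpa [Stmt.size] using hI, exec_skip w σ, hσ, hσm⟩

theorem tr_seq {s₁ s₂ : Stmt} {ρ : List ℕ} {m : Mem} {I : ℕ} {Q₁ Q : Mem → Prop}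
    (h₁ : Tr w b Z s₁ ρ m I Q₁) (h₂ : ∀ m₁, Q₁ m₁ → Tr w b Z s₂ ρ m₁ I Q) :
    Tr w b Z (.seq s₁ s₂) ρ m I Q := by
  intro hZ hb hw hρ hm hI σ hσ hσm
  have hs : (Stmt.seq s₁ s₂).size = s₁.size + s₂.size + 2 := rfl
  have hp := fun i (hi : i ≤ (Stmt.seq s₁ s₂).size) =>
    (Nat.pow_le_pow_right (n := Z) (by omega) hi).trans hw
  obtain ⟨m₁, σ₁, t₁, hQ₁, hm₁, ht₁, e₁, a₁, hh₁⟩ := h₁ hZ hb (hp _ (by omega)) hρ hm hI σ hσ hσm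
  obtain ⟨m₂, σ₂, t₂, hQ₂, hm₂, ht₂, e₂, a₂, hh₂⟩ :=
    h₂ m₁ hQ₁ hZ hb (hp _ (by omega)) hρ hm₁ hI σ₁ a₁ hh₁
  refine ⟨m₂, σ₂, _, hQ₂, hm₂, ?_, exec_seq e₁ e₂, a₂, hh₂⟩
  rw [hs]
  nlinarith

theorem tr_letE {e : Expr} {s : Stmt} {ρ : List ℕ} {m : Mem} {I v : ℕ} {Q : Mem → Prop}
    (he : e.Ok b ρ m) (hv : e.val ρ m = v) (hlt : v < Z)
    (h : Tr w b Z s (v :: ρ) m I Q) : Tr w b Z (.letE e s) ρ m I Q := by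
  intro hZ hb hw hρ hm hI σ hσ hσm
  have hs : (Stmt.letE e s).size = e.size + s.size + 5 := rfl
  have hp := fun i (hi : i ≤ (Stmt.letE e s).size) =>
    (Nat.pow_le_pow_right (n := Z) (by omega) hi).trans hw
  obtain ⟨σ₁, t₁, ht₁, e₁, m₁, r₁, f₁⟩ :=
    e.exec_compile hZ hb hρ hm (hp _ (by omega)) he hσ hσm (ρ.length + 2) le_rfl
  have hρ' : ∀ i, lookup (v :: ρ) i < Z := by
    intro i
    rw [lookup]
    split_ifs
    exacts [hlt, hρ i]
  obtain ⟨m₂, σ₂, t₂, hQ₂, hm₂, ht₂, e₂, a₂, hh₂⟩ := h hZ hb (hp _ (by omega)) hρ' hm hI σ₁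
    (agree_cons (agree_of_reg_eq hσ f₁) (r₁.trans hv)) (by rwa [m₁])
  refine ⟨m₂, σ₂, _, hQ₂, hm₂, ?_, exec_seq e₁ e₂, agree_tail a₂, hh₂⟩
  rw [hs]
  nlinarith

theorem tr_ite {e : Expr} {s₁ s₂ : Stmt} {ρ : List ℕ} {m : Mem} {I : ℕ} {Q : Mem → Prop}
    (he : e.Ok b ρ m) (h₁ : e.val ρ m ≠ 0 → Tr w b Z s₁ ρ m I Q)
    (h₂ : e.val ρ m = 0 → Tr w b Z s₂ ρ m I Q) : Tr w b Z (.ite e s₁ s₂) ρ m I Q := by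
  intro hZ hb hw hρ hm hI σ hσ hσm
  have hs : (Stmt.ite e s₁ s₂).size = e.size + s₁.size + s₂.size + 5 := rfl
  have hp := fun i (hi : i ≤ (Stmt.ite e s₁ s₂).size) =>
    (Nat.pow_le_pow_right (n := Z) (by omega) hi).trans hw
  obtain ⟨σ₁, t₁, ht₁, e₁, m₁, r₁, f₁⟩ :=
    e.exec_compile hZ hb hρ hm (hp _ (by omega)) he hσ hσm (ρ.length + 2) le_rfl
  have a₁ : Agree b Z ρ σ₁ := agree_of_reg_eq hσ f₁
  by_cases hv : e.val ρ m = 0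
  · obtain ⟨m₂, σ₂, t₂, hQ₂, hm₂, ht₂, e₂, a₂, hh₂⟩ :=
      h₂ hv hZ hb (hp _ (by omega)) hρ hm hI σ₁ a₁ (by rwa [m₁])
    refine ⟨m₂, σ₂, _, hQ₂, hm₂, ?_, exec_seq e₁ (exec_cond (t := t₂) ?_), a₂, hh₂⟩
    · rw [hs]
      nlinarith
    · rwa [r₁, if_neg (by simpa using hv)]
  · obtain ⟨m₂, σ₂, t₂, hQ₂, hm₂, ht₂, e₂, a₂, hh₂⟩ :=
      h₁ hv hZ hb (hp _ (by omega)) hρ hm hI σ₁ a₁ (by rwa [m₁])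
    refine ⟨m₂, σ₂, _, hQ₂, hm₂, ?_, exec_seq e₁ (exec_cond (t := t₂) ?_), a₂, hh₂⟩
    · rw [hs]
      nlinarith
    · rwa [r₁, if_pos hv]

theorem tr_store {a : Fin 16} {i₁ i₂ i₃ i₄ i₅ : ℕ} {e : Expr} {ρ : List ℕ} {m : Mem} {I v : ℕ}
    {Q : Mem → Prop} (he : e.Ok b ρ m) (hv : e.val ρ m = v) (hlt : v < Z)
    (hQ : Q (m.set a (lookup ρ i₁) (lookup ρ i₂) (lookup ρ i₃) (lookup ρ i₄) (lookup ρ i₅) v)) :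
    Tr w b Z (.store a i₁ i₂ i₃ i₄ i₅ e) ρ m I Q := by
  intro hZ hb hw hρ hm hI σ hσ hσm
  have hs : (Stmt.store a i₁ i₂ i₃ i₄ i₅ e).size = e.size + 50 := rfl
  have hp := fun i (hi : i ≤ (Stmt.store a i₁ i₂ i₃ i₄ i₅ e).size) =>
    (Nat.pow_le_pow_right (n := Z) (by omega) hi).trans hw
  obtain ⟨σ₁, t₁, ht₁, e₁, m₁, r₁, f₁⟩ :=
    e.exec_compile hZ hb hρ hm (hp _ (by omega)) he hσ hσm (ρ.length + 2) le_rfl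
  have a₁ : Agree b Z ρ σ₁ := agree_of_reg_eq hσ f₁
  obtain ⟨σ₂, e₂, m₂, r₂, f₂⟩ := exec_addressProg hZ hb (hp 8 (by omega)) hρ a₁ a i₁ i₂ i₃ i₄ i₅
    (ρ.length + 3) (by omega)
  have e₃ := exec_store w (ρ.length + 3) (ρ.length + 2) σ₂
  rw [r₂, f₂ _ (by omega), r₁, hv] at e₃
  refine ⟨_, _, _, hQ, ⟨hm.1, fun a' j₁ j₂ j₃ j₄ j₅ => ?_⟩, ?_, exec_seq e₁ (exec_seq e₂ e₃),
    agree_of_reg_eq a₁ fun i hi => f₂ i (by omega), ⟨fun x hx => ?_, ?_⟩⟩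
  · simp only [Mem.set]
    split_ifs
    exacts [hlt, hm.2 _ _ _ _ _ _]
  · rw [hs]
    nlinarith
  · simp only [State.setMem, Mem.set]
    rw [Function.update_of_ne (by unfold address; omega), m₂, m₁, hσm.1 x hx]
  · intro a' j₁ j₂ j₃ j₄ j₅ h₁ h₂ h₃ h₄ h₅
    simp only [State.setMem, Mem.set, Function.update_apply]
    rw [m₂, m₁, ← hσm.2 _ _ _ _ _ _ h₁ h₂ h₃ h₄ h₅]
    refine if_congr ⟨fun h => address_inj h₂ h₃ h₄ h₅ (hρ _) (hρ _) (hρ _) (hρ _) h, ?_⟩ rfl rfl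
    rintro ⟨rfl, rfl, rfl, rfl, rfl, rfl⟩
    rfl

theorem tr_out {e₁ e₂ : Expr} {ρ : List ℕ} {m : Mem} {I x v : ℕ} {Q : Mem → Prop}
    (he₁ : e₁.Ok b ρ m) (he₂ : e₂.Ok b ρ m) (hx : e₁.val ρ m = x) (hxb : x < b)
    (hv : e₂.val ρ m = v) (hlt : v < Z) (hQ : Q (m.setLow x v)) :
    Tr w b Z (.out e₁ e₂) ρ m I Q := by
  intro hZ hb hw hρ hm hI σ hσ hσm
  have hs : (Stmt.out e₁ e₂).size = e₁.size + e₂.size + 5 := rfl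
  have hp := fun i (hi : i ≤ (Stmt.out e₁ e₂).size) =>
    (Nat.pow_le_pow_right (n := Z) (by omega) hi).trans hw
  obtain ⟨σ₁, t₁, ht₁, e₁', m₁, r₁, f₁⟩ :=
    e₁.exec_compile hZ hb hρ hm (hp _ (by omega)) he₁ hσ hσm (ρ.length + 2) le_rfl
  have a₁ : Agree b Z ρ σ₁ := agree_of_reg_eq hσ f₁
  obtain ⟨σ₂, t₂, ht₂, e₂', m₂, r₂, f₂⟩ := e₂.exec_compile hZ hb hρ hm (hp _ (by omega)) he₂ a₁
    (by rwa [m₁]) (ρ.length + 3) (by omega)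
  have e₃ := exec_store w (ρ.length + 2) (ρ.length + 3) σ₂
  rw [r₂, f₂ _ (by omega), r₁, hv, hx] at e₃
  refine ⟨_, _, _, hQ, ⟨fun y hy => ?_, hm.2⟩, ?_, exec_seq e₁' (exec_seq e₂' e₃),
    agree_of_reg_eq a₁ fun i hi => f₂ i (by omega), ⟨fun y hy => ?_, ?_⟩⟩
  · simp only [Mem.setLow, Function.update_apply]
    split_ifs
    exacts [hlt, hm.1 y hy]
  · rw [hs]
    nlinarith
  · simp only [State.setMem, Mem.setLow, Function.update_apply]
    rw [m₂, m₁, hσm.1 y hy]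
  · intro a' j₁ j₂ j₃ j₄ j₅ h₁ h₂ h₃ h₄ h₅
    simp only [State.setMem, Mem.setLow]
    rw [Function.update_of_ne (by unfold address; omega), m₂, m₁, hσm.2 _ _ _ _ _ _ h₁ h₂ h₃ h₄ h₅]

/-- The cost is a product `B * I`, with `B` a bound for the number of rounds that does not depend on
the state. `1 ≤ B` pays for the set-up when there are no rounds; the constant `30` in `Stmt.size`
covers the set-up and the at most ten administrative steps of each round. -/
theorem tr_forE {e : Expr} {s : Stmt} {ρ : List ℕ} {m : Mem} {N B I : ℕ} {Q : Mem → Prop}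
    (Inv : ℕ → Mem → Prop) (he : e.Ok b ρ m) (hN : e.val ρ m = N) (hNB : N ≤ B) (hB : 1 ≤ B)
    (hI : 1 ≤ I) (hNZ : N < Z) (h0 : Inv 0 m)
    (h : ∀ j < N, ∀ m', Inv j m' → Tr w b Z s (j :: N :: ρ) m' I (Inv (j + 1)))
    (hQ : ∀ m', Inv N m' → Q m') : Tr w b Z (.forE e s) ρ m (B * I) Q := by
  intro hZ hb hw hρ hm _ σ hσ hσm
  have hs : (Stmt.forE e s).size = e.size + s.size + 30 := rfl
  have hp := fun i (hi : i ≤ (Stmt.forE e s).size) =>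
    (Nat.pow_le_pow_right (n := Z) (by omega) hi).trans hw
  have hw1 : Z ≤ 2 ^ w := by simpa using hp 1 (by omega)
  obtain ⟨σ₁, t₁, ht₁, e₁, m₁, r₁, f₁⟩ :=
    e.exec_compile hZ hb hρ hm (hp _ (by omega)) he hσ hσm (ρ.length + 2) le_rfl
  rw [hN] at r₁
  have a₁ : Agree b Z (N :: ρ) σ₁ := agree_cons (agree_of_reg_eq hσ f₁) r₁
  have e₂ := exec_const w (ρ.length + 3) 0 σ₁
  rw [Nat.zero_mod] at e₂
  have a₂ : Agree b Z (0 :: N :: ρ) (σ₁.setReg (ρ.length + 3) 0) := by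
    refine agree_cons (agree_of_reg_eq a₁ fun i hi => ?_) (by simp [State.setReg_reg])
    rw [State.setReg_reg, if_neg (by simp at hi; omega)]
  set body : Prog := .seq (s.compile (ρ.length + 2)) (.seq (.const (ρ.length + 4) 1)
    (.seq (.op .add (ρ.length + 3) (ρ.length + 3) (ρ.length + 4))
      (.op .lt (ρ.length + 4) (ρ.length + 3) (ρ.length + 2))))
  have hone : 1 < 2 ^ w := by omega
  have hlt : ∀ j τ, Agree b Z (j :: N :: ρ) τ →
      Exec w (.op .lt (ρ.length + 4) (ρ.length + 3) (ρ.length + 2)) τ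
        (τ.setReg (ρ.length + 4) (if j < N then 1 else 0)) 1 ∧
      Agree b Z (j :: N :: ρ) (τ.setReg (ρ.length + 4) (if j < N then 1 else 0)) := by
    intro j τ hτ
    have e := exec_op w .lt (ρ.length + 4) (ρ.length + 3) (ρ.length + 2) τ
    have r₁ := agree_head hτ
    have r₂ := agree_head (agree_tail hτ)
    simp only [List.length_cons] at r₁
    rw [Op.eval, r₂, show ρ.length + 3 = ρ.length + 1 + 2 from rfl, r₁,
      Nat.mod_eq_of_lt (by split_ifs <;> omega)] at e
    refine ⟨e, agree_of_reg_eq hτ fun i hi => ?_⟩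
    rw [State.setReg_reg, if_neg (by simp at hi; omega)]
  -- Induction on the number `i` of rounds still to be made. Register `ρ.length + 4` holds the loop
  -- condition and may be overwritten by the body, so it is recomputed at the end of each round.
  have loop : ∀ i j τ m', i + j = N → Inv j m' → m'.Small b Z → Agree b Z (j :: N :: ρ) τ →
      Holds b Z τ.mem m' → τ.reg (ρ.length + 4) = (if j < N then 1 else 0) →
      ∃ m'' τ' t, Q m'' ∧ m''.Small b Z ∧ t ≤ i * (s.size * I + 10) + 1 ∧
        Exec w (.loop (ρ.length + 4) body) τ τ' t ∧ Agree b Z ρ τ' ∧ Holds b Z τ'.mem m'' := by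
    intro i
    induction i with
    | zero =>
      intro j τ m' hj hi hs ha hh hr
      obtain rfl : j = N := by omega
      rw [if_neg (by omega)] at hr
      exact ⟨m', τ, 1, hQ _ hi, hs, by omega, exec_loop_stop hr, agree_tail (agree_tail ha), hh⟩
    | succ i ih =>
      intro j τ m' hj hi hs' ha hh hr
      have hjN : j < N := by omega
      rw [if_pos hjN] at hr
      have hρ' : ∀ i, lookup (j :: N :: ρ) i < Z := by
        intro i
        simp only [lookup]
        split_ifs
        exacts [by omega, hNZ, hρ i]
      obtain ⟨m₃, τ₃, t₃, hQ₃, hm₃, ht₃, e₃, a₃, hh₃⟩ :=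
        h j hjN m' hi hZ hb (hp _ (by omega)) hρ' hs' hI τ ha hh
      have c₁ := agree_head a₃
      have c₂ := agree_head (agree_tail a₃)
      simp only [List.length_cons] at c₁ e₃
      have e₄ := exec_const w (ρ.length + 4) 1 τ₃
      rw [Nat.mod_eq_of_lt hone] at e₄
      have e₅ := exec_op w .add (ρ.length + 3) (ρ.length + 3) (ρ.length + 4)
        (τ₃.setReg (ρ.length + 4) 1)
      simp only [Op.eval, State.setReg_reg, reduceIte] at e₅
      rw [if_neg (by omega), show ρ.length + 3 = ρ.length + 1 + 2 from rfl, c₁,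
        Nat.mod_eq_of_lt (by omega)] at e₅
      have a₅ : Agree b Z ((j + 1) :: N :: ρ)
          ((τ₃.setReg (ρ.length + 4) 1).setReg (ρ.length + 1 + 2) (j + 1)) := by
        refine agree_cons (agree_of_reg_eq (agree_tail a₃) fun i hi => ?_)
          (by simp [State.setReg_reg])
        simp only [List.length_cons] at hi
        rw [State.setReg_reg, if_neg (by omega), State.setReg_reg, if_neg (by omega)]
      obtain ⟨e₆, a₆⟩ := hlt _ _ a₅
      obtain ⟨m₇, τ₇, t₇, hQ₇, hm₇, ht₇, e₇, a₇, hh₇⟩ := ih (j + 1) _ m₃ (by omega) hQ₃ hm₃ a₆ hh₃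
        (by rw [State.setReg_reg, if_pos rfl])
      refine ⟨m₇, τ₇, _, hQ₇, hm₇, ?_,
        exec_loop_next (by rw [hr]; exact one_ne_zero)
          (exec_seq e₃ (exec_seq e₄ (exec_seq e₅ e₆))) e₇, a₇, hh₇⟩
      rw [Nat.succ_mul]
      omega
  obtain ⟨e₃, a₃⟩ := hlt _ _ a₂
  obtain ⟨m₄, σ₄, t₄, hQ₄, hm₄, ht₄, e₄, a₄, hh₄⟩ := loop N 0 _ m (by omega) h0 hm a₃ (by
    simpa [m₁] using hσm) (by rw [State.setReg_reg, if_pos rfl])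
  refine ⟨m₄, σ₄, _, hQ₄, hm₄, ?_, exec_seq e₁ (exec_seq e₂ (exec_seq e₃ e₄)), a₄, hh₄⟩
  rw [hs]
  have h1 : N * (s.size * I + 10) ≤ B * (s.size * I + 10) := Nat.mul_le_mul_right _ hNB
  have h2 : 1 ≤ B * I := Nat.mul_pos hB hI
  have h3 : B ≤ B * I := Nat.le_mul_of_pos_right _ hI
  have h4 : e.size ≤ e.size * (B * I) := Nat.le_mul_of_pos_right _ h2
  calc _ ≤ e.size + (N * (s.size * I + 10)) + 7 := by omega
    _ ≤ e.size * (B * I) + (s.size * (B * I) + 10 * (B * I)) + 7 * (B * I) := by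
      have : B * (s.size * I + 10) = s.size * (B * I) + 10 * B := by ring
      omega
    _ ≤ _ := by nlinarith

end

/-! ### Algebra: sums of squared determinants and testing them for zero. -/

section

/-! ### Squares of determinants as exterior products

A set of rows is given by a bit mask. -/

/-- The sign of row `a` in the expansion of the minor with the rows `A`. -/
def rowSign (A a : ℕ) : ℤ := ∏ i ∈ Finset.range a, if A.testBit i then -1 else 1

/-- The coefficient of row `a` in the expansion of the minor with the rows `A` along the column of
the powers of `x`. -/
def weight (x A a : ℕ) : ℤ := if A.testBit a then rowSign A a * (x : ℤ) ^ a else 0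

/-- The minor with the rows `A` of the Vandermonde matrix with `K` rows, one column for each element
of the list. -/
def minor (K : ℕ) : List ℕ → ℕ → ℤ
  | [], A => if A = 0 then 1 else 0
  | x :: l, A => ∑ a ∈ Finset.range K, weight x A a * minor K l (A - 2 ^ a)

/-- When bit `a` is set, the subtraction needs no borrow: it removes the row `a` from the set `A`.
-/
theorem testBit_sub_two_pow' {A a : ℕ} (h : A.testBit a = true) (i : ℕ) :
    (A - 2 ^ a).testBit i = (A.testBit i && decide (i ≠ a)) := by
  have h1 : A / 2 ^ a % 2 = 1 := by simpa [Nat.testBit_eq_decide_div_mod_eq] using h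
  obtain ⟨q, hq⟩ : ∃ q, A / 2 ^ a = 2 * q + 1 := ⟨A / 2 ^ a / 2, by omega⟩
  have hr := Nat.mod_lt A (Nat.two_pow_pos a)
  have hA : 2 ^ a * (2 * q + 1) + A % 2 ^ a = A := by rw [← hq, Nat.div_add_mod]
  generalize A % 2 ^ a = r at hr hA
  have hA' : A - 2 ^ a = 2 ^ a * (2 * q) + r := by
    rw [← hA, mul_add, mul_one]
    omega
  rw [hA', ← hA, Nat.testBit_two_pow_mul_add _ hr, Nat.testBit_two_pow_mul_add _ hr]
  rcases lt_trichotomy i a with hi | hi | hi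
  · simp [hi, hi.ne]
  · subst hi
    simp
  · obtain ⟨j, rfl⟩ : ∃ j, i = a + (j + 1) := ⟨i - a - 1, by omega⟩
    rw [if_neg (by omega), if_neg (by omega), Nat.add_sub_cancel_left, Nat.testBit_add_one,
      Nat.testBit_add_one]
    simp [show (2 * q + 1) / 2 = q by omega]

theorem rowSign_sub_of_le {A a b : ℕ} (h : A.testBit a = true) (hb : b ≤ a) :
    rowSign (A - 2 ^ a) b = rowSign A b := by
  refine Finset.prod_congr rfl fun i hi => ?_
  have := Finset.mem_range.1 hi
  rw [testBit_sub_two_pow' h]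
  simp [show i ≠ a by omega]

theorem rowSign_sub_of_lt {A a b : ℕ} (h : A.testBit a = true) (hb : a < b) :
    rowSign (A - 2 ^ a) b = -rowSign A b := by
  unfold rowSign
  rw [← Finset.mul_prod_erase _ _ (Finset.mem_range.2 hb),
    ← Finset.mul_prod_erase _ (fun i => if A.testBit i then (-1 : ℤ) else 1)
      (Finset.mem_range.2 hb), testBit_sub_two_pow' h]
  rw [Finset.prod_congr rfl (g := fun i => if A.testBit i then (-1 : ℤ) else 1)]
  · simp [h]
  · intro i hi
    rw [testBit_sub_two_pow' h]
    simp [(Finset.mem_erase.1 hi).1]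

/-- The sign of a row counts the smaller rows of the set. Removing two rows in the two possible
orders changes exactly one sign, that of the larger row, according to whether the smaller one is
still present. -/
theorem weight_anticomm (x y A a b : ℕ) :
    weight x A a * weight y (A - 2 ^ a) b = -(weight y A b * weight x (A - 2 ^ b) a) := by
  unfold weight
  by_cases ha : A.testBit a
  · by_cases hb : A.testBit b
    · rw [testBit_sub_two_pow' ha, testBit_sub_two_pow' hb]
      simp only [ha, hb, Bool.true_and, decide_eq_true_eq, if_true, ne_eq]
      rcases lt_trichotomy a b with h | h | h
      · rw [if_pos (by omega), if_pos (by omega), rowSign_sub_of_lt ha h,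
          rowSign_sub_of_le hb h.le]
        ring
      · subst h
        simp
      · rw [if_pos (by omega), if_pos (by omega), rowSign_sub_of_lt hb h,
          rowSign_sub_of_le ha h.le]
        ring
    · rw [testBit_sub_two_pow' ha]
      simp [hb]
  · by_cases hb : A.testBit b
    · rw [testBit_sub_two_pow' hb]
      simp [ha]
    · simp [ha, hb]

theorem minor_swap (K x y : ℕ) (l : List ℕ) (A : ℕ) :
    minor K (x :: y :: l) A = -minor K (y :: x :: l) A := by
  simp only [minor, Finset.mul_sum, ← Finset.sum_neg_distrib]
  rw [Finset.sum_comm]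
  refine Finset.sum_congr rfl fun b _ => Finset.sum_congr rfl fun a _ => ?_
  rw [← mul_assoc, ← mul_assoc, weight_anticomm, Nat.sub_right_comm]
  ring

/-- The factor is a product of signs, but only its independence of `A` matters. -/
theorem minor_perm {K : ℕ} {l l' : List ℕ} (h : l.Perm l') :
    ∃ c : ℤ, ∀ A, minor K l A = c * minor K l' A := by
  induction h with
  | nil => exact ⟨1, fun A => by ring⟩
  | cons x _ ih =>
    obtain ⟨c, hc⟩ := ih
    refine ⟨c, fun A => ?_⟩
    simp only [minor, hc, Finset.mul_sum]
    exact Finset.sum_congr rfl fun a _ => by ring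
  | swap x y l => exact ⟨-1, fun A => by rw [minor_swap]; ring⟩
  | trans _ _ h₁ h₂ =>
    obtain ⟨c, hc⟩ := h₁
    obtain ⟨d, hd⟩ := h₂
    exact ⟨c * d, fun A => by rw [hc, hd]; ring⟩

/-- Move the second copy of `x` next to the first; exchanging the two equal columns then shows that
the minor equals its negative. -/
theorem minor_cons_of_mem {K x : ℕ} {l : List ℕ} (h : x ∈ l) (A : ℕ) : minor K (x :: l) A = 0 := by
  obtain ⟨c, hc⟩ := minor_perm (K := K) ((List.perm_cons_erase h).cons x)
  have := minor_swap K x x (l.erase x) A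
  rw [hc, show minor K (x :: x :: l.erase x) A = 0 by omega, mul_zero]

theorem nodup_of_minor_ne_zero {K : ℕ} {l : List ℕ} {A : ℕ} (h : minor K l A ≠ 0) : l.Nodup := by
  induction l generalizing A with
  | nil => exact List.nodup_nil
  | cons x l ih =>
    refine List.nodup_cons.2 ⟨fun hx => h (minor_cons_of_mem hx A), ?_⟩
    obtain ⟨a, -, ha⟩ := Finset.exists_ne_zero_of_sum_ne_zero h
    exact ih (right_ne_zero_of_mul ha)

/-- Vandermonde's argument. As a function of the first node the determinant is a polynomial of
degree at most `d` whose coefficient at degree `d` is, up to sign, the determinant of the remaining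
nodes, nonzero by induction. It vanishes at the `d` remaining nodes, so it cannot vanish at `x` as
well. -/
theorem minor_full_ne_zero {K : ℕ} {l : List ℕ} (h : l.Nodup) (hK : l.length ≤ K) :
    minor K l (2 ^ l.length - 1) ≠ 0 := by
  induction l with
  | nil => simp [minor]
  | cons x l ih =>
    obtain ⟨hx, hl⟩ := List.nodup_cons.1 h
    simp only [List.length_cons] at hK ⊢
    have ih := ih hl (by omega)
    set d := l.length
    set c : ℕ → ℤ := fun a => (if (2 ^ (d + 1) - 1).testBit a then rowSign (2 ^ (d + 1) - 1) a else 0)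
      * minor K l (2 ^ (d + 1) - 1 - 2 ^ a)
    set P : Polynomial ℤ := ∑ a ∈ Finset.range (d + 1), Polynomial.C (c a) * Polynomial.X ^ a
    have hP : ∀ y : ℕ, P.eval (y : ℤ) = minor K (y :: l) (2 ^ (d + 1) - 1) := by
      intro y
      simp only [P, Polynomial.eval_finsetSum, Polynomial.eval_mul, Polynomial.eval_C,
        Polynomial.eval_pow, Polynomial.eval_X, minor]
      -- The rows beyond `d` do not belong to the set with mask `2 ^ (d + 1) - 1`, so their weights
      -- are zero.
      rw [← Finset.sum_subset (Finset.range_subset_range.2 hK)]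
      · refine Finset.sum_congr rfl fun a _ => ?_
        simp only [c, weight]
        split_ifs <;> ring
      · intro a _ ha
        rw [Finset.mem_range] at ha
        simp [weight, Nat.testBit_two_pow_sub_one, ha]
    intro h0
    have hdeg : P.natDegree < (insert x l.toFinset).card := by
      rw [Finset.card_insert_of_notMem (by simpa using hx), List.toFinset_card_of_nodup hl]
      refine Nat.lt_succ_of_le (Polynomial.natDegree_sum_le_of_forall_le _ _ fun a ha => ?_)
      exact (Polynomial.natDegree_C_mul_X_pow_le _ _).trans (by simp at ha; omega)
    have hzero : P = 0 := by
      refine Polynomial.eq_zero_of_natDegree_lt_card_of_eval_eq_zero' P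
        ((insert x l.toFinset).map Nat.castEmbedding) ?_ (by rwa [Finset.card_map])
      intro y hy
      obtain ⟨y, hy', rfl⟩ := Finset.mem_map.1 hy
      rw [Nat.castEmbedding_apply, hP]
      rcases Finset.mem_insert.1 hy' with rfl | hy'
      · exact h0
      · exact minor_cons_of_mem (List.mem_toFinset.1 hy') _
    have hcoef : P.coeff d = c d := by
      simp [P, Polynomial.coeff_X_pow]
    rw [hzero, Polynomial.coeff_zero] at hcoef
    refine mul_ne_zero ?_ ?_ hcoef.symm
    · rw [Nat.testBit_two_pow_sub_one]
      simp only [Nat.lt_succ_self, decide_true, if_true, rowSign]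
      refine Finset.prod_ne_zero_iff.2 fun i _ => ?_
      split_ifs <;> norm_num
    · rwa [show 2 ^ (d + 1) - 1 - 2 ^ d = 2 ^ d - 1 by rw [pow_succ]; omega]

theorem abs_rowSign (A a : ℕ) : |rowSign A a| = 1 := by
  rw [rowSign, Finset.abs_prod]
  refine Finset.prod_eq_one fun i _ => ?_
  split_ifs <;> norm_num

/-- Each column contributes a sum of `K` terms with weights of absolute value at most `n ^ K`. -/
theorem abs_minor_le {K n : ℕ} {l : List ℕ} (hl : ∀ x ∈ l, x < n) (A : ℕ) :
    |minor K l A| ≤ ((K * n ^ K : ℕ) : ℤ) ^ l.length := by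
  induction l generalizing A with
  | nil =>
    simp only [minor]
    split_ifs <;> simp
  | cons x l ih =>
    have hx : x < n := hl x (by simp)
    simp only [minor, List.length_cons]
    refine (Finset.abs_sum_le_sum_abs _ _).trans ?_
    have : ∀ a ∈ Finset.range K, |weight x A a * minor K l (A - 2 ^ a)| ≤
        ((n ^ K : ℕ) : ℤ) * ((K * n ^ K : ℕ) : ℤ) ^ l.length := by
      intro a ha
      rw [abs_mul]
      refine mul_le_mul ?_ (ih (fun y hy => hl y (by simp [hy])) _) (abs_nonneg _) (by positivity)
      unfold weight
      split_ifs
      · rw [abs_mul, abs_rowSign, one_mul, abs_pow, Nat.abs_cast]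
        have h1 : x ^ a ≤ n ^ a := Nat.pow_le_pow_left hx.le a
        have h2 : n ^ a ≤ n ^ K := Nat.pow_le_pow_right (by omega) (Finset.mem_range.1 ha).le
        exact_mod_cast h1.trans h2
      · simp
    refine (Finset.sum_le_sum this).trans (le_of_eq ?_)
    rw [Finset.sum_const, Finset.card_range, nsmul_eq_mul, pow_succ]
    push_cast
    ring

/-! ### Sums over feasible sequences of vertices

`τ v u t` is the latest time at which one can leave `v` in order to be at `u` at time `t`, and `0` if
there is none. Sequences of vertices are listed backwards; the vertex before the first one is `s`. -/

section Sequences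

variable (n s K : ℕ) (τ : ℕ → ℕ → ℕ → ℕ)

/-- The vertices of the list can be visited one after the other so that one is at `u` at time `t`,
where `u` is the last one of them. -/
def Feasible : List ℕ → ℕ → ℕ → Prop
  | [], u, t => u = s ∧ 1 ≤ t
  | x :: l, u, t => x = u ∧ ∃ v < n, Feasible l v (τ v u t)

/-- The sum of `f` over the feasible lists of length `p`. -/
def sumFeasible : ℕ → ℕ → ℕ → (List ℕ → ℤ) → ℤ
  | 0, u, t, f => if u = s ∧ 1 ≤ t then f [] else 0
  | p + 1, u, t, f => ∑ v ∈ Finset.range n, sumFeasible p v (τ v u t) fun l => f (u :: l)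

/-- Exterior multiplication, in both factors, with the vector of the powers of `x`. -/
def extend (x : ℕ) (E : ℕ → ℕ → ℤ) (A B : ℕ) : ℤ :=
  ∑ a ∈ Finset.range K, ∑ b ∈ Finset.range K,
    weight x A a * weight x B b * E (A - 2 ^ a) (B - 2 ^ b)

/-- The table of the dynamic program. -/
def table : ℕ → ℕ → ℕ → ℕ → ℕ → ℤ
  | 0, u, t => fun A B => if u = s ∧ 1 ≤ t ∧ A = 0 ∧ B = 0 then 1 else 0
  | p + 1, u, t => extend K u fun A B => ∑ v ∈ Finset.range n, table p v (τ v u t) A B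

variable {n s K τ}

theorem sumFeasible_sum {ι : Type*} (S : Finset ι) (p u t : ℕ) (f : ι → List ℕ → ℤ) :
    sumFeasible n s τ p u t (fun l => ∑ i ∈ S, f i l) = ∑ i ∈ S, sumFeasible n s τ p u t (f i) := by
  induction p generalizing u t f with
  | zero =>
    simp only [sumFeasible]
    split_ifs <;> simp
  | succ p ih =>
    simp only [sumFeasible, ih]
    exact Finset.sum_comm

theorem sumFeasible_mul (c : ℤ) (p u t : ℕ) (f : List ℕ → ℤ) :
    sumFeasible n s τ p u t (fun l => c * f l) = c * sumFeasible n s τ p u t f := by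
  induction p generalizing u t f with
  | zero => simp [sumFeasible]
  | succ p ih => simp only [sumFeasible, ih, Finset.mul_sum]

/-- Exterior multiplication is linear, and on a single sequence it is the expansion of both
determinants along the new column `x`. The prefix `L` is carried along for the reconstruction of a
sequence, where vertices are multiplied on after the sum has been formed. -/
theorem extend_sumFeasible (x p u t : ℕ) (L : List ℕ) (A B : ℕ) :
    extend K x (fun A B => sumFeasible n s τ p u t fun l => minor K (L ++ l) A * minor K (L ++ l) B) A B =
      sumFeasible n s τ p u t fun l => minor K (x :: L ++ l) A * minor K (x :: L ++ l) B := by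
  simp only [extend, List.cons_append, minor, Finset.sum_mul_sum, sumFeasible_sum,
    ← sumFeasible_mul]
  refine Finset.sum_congr rfl fun a _ => Finset.sum_congr rfl fun b _ => ?_
  congr 1
  funext l
  ring

theorem extend_sum {ι : Type*} (S : Finset ι) (x : ℕ) (E : ι → ℕ → ℕ → ℤ) (A B : ℕ) :
    extend K x (fun A B => ∑ i ∈ S, E i A B) A B = ∑ i ∈ S, extend K x (E i) A B := by
  simp only [extend, Finset.mul_sum]
  rw [Finset.sum_comm]
  rw [Finset.sum_comm (s := S)]
  rw [Finset.sum_comm]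
  refine Finset.sum_congr rfl fun a _ => ?_
  rw [Finset.sum_comm]

/-- Correctness of the recursion: only the last vertex and the time matter for continuing a
sequence, and its set of vertices enters solely through the two exterior products. -/
theorem table_eq (p u t A B : ℕ) :
    table n s K τ p u t A B = sumFeasible n s τ p u t fun l => minor K l A * minor K l B := by
  induction p generalizing u t A B with
  | zero =>
    simp only [table, sumFeasible, minor]
    split_ifs <;> simp_all
  | succ p ih =>
    simp only [table, ih, sumFeasible]
    rw [extend_sum]
    refine Finset.sum_congr rfl fun v _ => ?_
    have := extend_sumFeasible (n := n) (s := s) (K := K) (τ := τ) u p v (τ v u t) [] A B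
    simpa using this

/-- With `L` a known final part of a sequence, this evaluates the sum over all its completions; it
is the test used in the backward search. -/
theorem foldr_extend_table (L : List ℕ) (p u t A B : ℕ) :
    L.foldr (extend K) (table n s K τ p u t) A B =
      sumFeasible n s τ p u t fun l => minor K (L ++ l) A * minor K (L ++ l) B := by
  induction L generalizing A B with
  | nil => simp [table_eq]
  | cons x L ih =>
    rw [List.foldr_cons, ← extend_sumFeasible]
    congr 1
    funext A B
    exact ih A B

theorem sumFeasible_nonneg {f : List ℕ → ℤ} (hf : ∀ l, 0 ≤ f l) (p u t : ℕ) :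
    0 ≤ sumFeasible n s τ p u t f := by
  induction p generalizing u t f with
  | zero =>
    simp only [sumFeasible]
    split_ifs
    exacts [hf _, le_rfl]
  | succ p ih => exact Finset.sum_nonneg fun v _ => ih (fun l => hf _) v _

/-- With nonnegative summands there is no cancellation; this is why the determinants are squared. -/
theorem sumFeasible_pos {f : List ℕ → ℤ} (hf : ∀ l, 0 ≤ f l) {l : List ℕ} {u t : ℕ}
    (hl : Feasible n s τ l u t) (hl0 : f l ≠ 0) : 0 < sumFeasible n s τ l.length u t f := by
  induction l generalizing u t f with
  | nil =>
    simp only [List.length_nil, sumFeasible]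
    rw [if_pos (show u = s ∧ 1 ≤ t from hl)]
    exact lt_of_le_of_ne (hf _) hl0.symm
  | cons x l ih =>
    obtain ⟨rfl, v, hv, hl⟩ := hl
    simp only [List.length_cons, sumFeasible]
    exact Finset.sum_pos' (fun w _ => sumFeasible_nonneg (fun _ => hf _) _ _ _)
      ⟨v, Finset.mem_range.2 hv, ih (fun _ => hf _) hl hl0⟩

theorem sumFeasible_le {f : List ℕ → ℤ} {M : ℤ} (hM : 0 ≤ M) {p : ℕ}
    (hf : ∀ l : List ℕ, l.length = p → (∀ x ∈ l, x < n) → f l ≤ M) {u : ℕ} (hu : u < n) (t : ℕ) :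
    sumFeasible n s τ p u t f ≤ (n : ℤ) ^ p * M := by
  induction p generalizing u t f with
  | zero =>
    simp only [sumFeasible, pow_zero, one_mul]
    split_ifs
    exacts [hf _ rfl (by simp), hM]
  | succ p ih =>
    simp only [sumFeasible]
    refine (Finset.sum_le_sum fun v hv => ih (fun l hl hln => hf (u :: l) (by simp [hl]) ?_)
      (Finset.mem_range.1 hv) _).trans (le_of_eq ?_)
    · simpa [hu] using hln
    · rw [Finset.sum_const, Finset.card_range, nsmul_eq_mul, pow_succ]
      ring

end Sequences

/-! ### Divisibility by consecutive numbers -/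

/-- By induction `S = N * choose (N+R) R * c` and `S = (N+1) * choose (N+1+R) R * d`. Writing `(R+1)
* S = (N+R+1) * S - N * S` and substituting these in the two terms produces the common factor `N *
(R+1) * choose (N+R+1) (R+1)` with cofactor `c - d`. -/
theorem mul_choose_dvd {S : ℤ} {N : ℕ} (hN : 1 ≤ N) (R : ℕ)
    (h : ∀ j ≤ R, ((N + j : ℕ) : ℤ) ∣ S) : ((N * (N + R).choose R : ℕ) : ℤ) ∣ S := by
  induction R generalizing N with
  | zero => simpa using h 0 le_rfl
  | succ R ih =>
    obtain ⟨c, hc⟩ := ih hN fun j hj => h j (by omega)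
    obtain ⟨d, hd⟩ := ih (N := N + 1) (by omega) fun j hj => by
      have := h (j + 1) (by omega)
      rwa [show N + (j + 1) = N + 1 + j by ring] at this
    refine ⟨c - d, ?_⟩
    have h1 := Nat.add_one_mul_choose_eq (N + R) R
    have h2 : (N + R + 1).choose (R + 1) * (R + 1) = (N + R + 1).choose R * (N + 1) := by
      have := Nat.choose_succ_right_eq (N + R + 1) R
      rwa [show N + R + 1 - R = N + 1 by omega] at this
    have h3 : (N + R + 1).choose (R + 1) = (N + R).choose R + (N + R).choose (R + 1) :=
      Nat.choose_succ_succ _ _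
    have h4 : (N + R).choose (R + 1) * (R + 1) = (N + R).choose R * N := by
      have := Nat.choose_succ_right_eq (N + R) R
      rwa [show N + R - R = N by omega] at this
    have e1 : N + 1 + R = N + R + 1 := by ring
    rw [e1] at hd
    rw [show N + (R + 1) = N + R + 1 by ring]
    generalize (N + R + 1).choose (R + 1) = X at *
    generalize (N + R + 1).choose R = Y at *
    generalize (N + R).choose R = U at *
    generalize (N + R).choose (R + 1) = V at *
    have hX0 : ((N : ℤ) * (U : ℤ)) * c = S := by rw [hc]; push_cast; ring
    have hY0 : (((N : ℤ) + 1) * (Y : ℤ)) * d = S := by rw [hd]; push_cast; ring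
    have h1' : ((N : ℤ) + R + 1) * U = X * (R + 1) := by exact_mod_cast h1
    have h2' : (X : ℤ) * (R + 1) = Y * (N + 1) := by exact_mod_cast h2
    have hR : ((R : ℤ) + 1) ≠ 0 := by positivity
    apply mul_left_cancel₀ hR
    push_cast
    calc ((R : ℤ) + 1) * S = ((N : ℤ) + R + 1) * S - N * S := by ring
      _ = ((N : ℤ) + R + 1) * (N * U * c) - N * ((N + 1) * Y * d) := by rw [hX0, hY0]
      _ = N * ((((N : ℤ) + R + 1) * U) * c - (Y * (N + 1)) * d) := by ring
      _ = N * ((X * (R + 1)) * c - (X * (R + 1)) * d) := by rw [h1', ← h2']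
      _ = _ := by ring

/-- The binomial coefficient is the product of the factors `(N + i) / i` for `1 ≤ i ≤ R`, each of
which is at least `X`. -/
theorem pow_le_choose_add {N X R : ℕ} (h : X * R ≤ N) : X ^ R ≤ (N + R).choose R := by
  induction R with
  | zero => simp
  | succ R ih =>
    have h1 := Nat.add_one_mul_choose_eq (N + R) R
    have ih := ih (le_trans (Nat.mul_le_mul_left _ (by omega)) h)
    rw [show N + (R + 1) = N + R + 1 by ring]
    refine Nat.le_of_mul_le_mul_right (c := R + 1) ?_ (by omega)
    rw [← h1, pow_succ]
    calc X ^ R * X * (R + 1) = (X * (R + 1)) * X ^ R := by ring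
      _ ≤ (N + R + 1) * (N + R).choose R := Nat.mul_le_mul (by omega) ih

end

/-! ### Combinatorics: tours versus feasible sequences of vertices. -/

section

/-! ### Latest departure times -/

section Latest

variable (n : ℕ) (cid : ℕ → ℕ → ℕ)

/-- The latest time at which one can leave `v` in order to be in the component `c` at time `t`, and
`0` if there is none; `cid t v` is the component of `v` at time `t`. -/
def latestAt : ℕ → ℕ → ℕ → ℕ
  | 0, _, _ => 0
  | t + 1, v, c => if c = cid (t + 1) v then t + 1 else
      (Finset.range n).sup fun w => if cid (t + 1) w = c then latestAt t v (cid t w) else 0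

/-- The latest time at which one can leave `v` in order to be at `u` at time `t`. -/
def latest (v u t : ℕ) : ℕ := latestAt n cid t v (cid t u)

variable {n cid}

theorem latestAt_le (t v c : ℕ) : latestAt n cid t v c ≤ t := by
  induction t generalizing c with
  | zero => exact le_rfl
  | succ t ih =>
    rw [latestAt]
    split_ifs
    · exact le_rfl
    · refine Finset.sup_le fun w _ => ?_
      split_ifs
      exacts [(ih _).trans (Nat.le_succ t), Nat.zero_le _]

theorem latest_le (v u t : ℕ) : latest n cid v u t ≤ t := latestAt_le _ _ _

theorem latestAt_succ_ge {t v w c : ℕ} (hw : w < n) (h : cid (t + 1) w = c) :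
    latestAt n cid t v (cid t w) ≤ latestAt n cid (t + 1) v c := by
  rw [latestAt]
  split_ifs
  · exact (latestAt_le _ _ _).trans (Nat.le_succ t)
  · refine le_trans ?_ (Finset.le_sup (Finset.mem_range.2 hw))
    rw [if_pos h]

/-- Whoever is at `u` at time `t` can stay there: `u` lies in its components at both times. -/
theorem latest_mono {v u t t' : ℕ} (hu : u < n) (h : t ≤ t') :
    latest n cid v u t ≤ latest n cid v u t' := by
  induction t', h using Nat.le_induction with
  | base => exact le_rfl
  | succ t' _ ih => exact ih.trans (latestAt_succ_ge hu rfl)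

theorem latestAt_self {t v c : ℕ} (h : cid t v = c) : latestAt n cid t v c = t := by
  cases t with
  | zero => rfl
  | succ t => rw [latestAt, if_pos h.symm]

theorem cid_eq_of_latest_eq {t v u : ℕ} (ht : 1 ≤ t) (h : latest n cid v u t = t) :
    cid t u = cid t v := by
  obtain ⟨t, rfl⟩ : ∃ s, t = s + 1 := ⟨t - 1, by omega⟩
  by_contra hc
  rw [latest, latestAt, if_neg hc] at h
  have : ((Finset.range n).sup fun w =>
      if cid (t + 1) w = cid (t + 1) u then latestAt n cid t v (cid t w) else 0) ≤ t := by
    refine Finset.sup_le fun w _ => ?_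
    split_ifs
    exacts [latestAt_le _ _ _, Nat.zero_le _]
  omega

/-- If the journey neither starts at time `t + 1` nor is impossible, the maximum in `latestAt` is
attained. Its witness is the vertex through which a walk is traced one step back in time. -/
theorem exists_latest_eq {t v u : ℕ} (h : latest n cid v u (t + 1) ≠ t + 1)
    (h0 : latest n cid v u (t + 1) ≠ 0) :
    ∃ w < n, cid (t + 1) w = cid (t + 1) u ∧ latest n cid v w t = latest n cid v u (t + 1) := by
  have hc : cid (t + 1) u ≠ cid (t + 1) v := fun hc => h (latestAt_self hc.symm)
  rw [latest, latestAt, if_neg hc] at h0 ⊢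
  have hne : (Finset.range n).Nonempty := by
    by_contra hne
    rw [Finset.not_nonempty_iff_eq_empty] at hne
    simp [hne] at h0
  obtain ⟨w, hw, hw'⟩ := Finset.exists_mem_eq_sup _ hne fun w =>
    if cid (t + 1) w = cid (t + 1) u then latestAt n cid t v (cid t w) else 0
  rw [hw'] at h0 ⊢
  by_cases hcw : cid (t + 1) w = cid (t + 1) u
  · exact ⟨w, Finset.mem_range.1 hw, hcw, by rw [if_pos hcw, latest]⟩
  · rw [if_neg hcw] at h0
    exact absurd rfl h0

/-- A later deadline never hurts. This justifies recording only the latest departure instead of all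
possible ones. -/
theorem Feasible.mono {s : ℕ} {l : List ℕ} {u t t' : ℕ} (hu : u < n) (htt : t ≤ t')
    (h : Feasible n s (latest n cid) l u t) : Feasible n s (latest n cid) l u t' := by
  induction l generalizing u t t' with
  | nil => exact ⟨h.1, h.2.trans htt⟩
  | cons x l ih =>
    obtain ⟨rfl, v, hv, h⟩ := h
    exact ⟨rfl, v, hv, ih hv (latest_mono hu htt) h⟩

/-- A walk through the components `c 1, …, c T` leads to a feasible sequence. -/
theorem exists_feasible {s T : ℕ} (c : ℕ → ℕ) (hT : 1 ≤ T) (hs : s < n) (h1 : cid 1 s = c 1)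
    (hstep : ∀ t, 1 ≤ t → t < T → ∃ w < n, cid t w = c t ∧ cid (t + 1) w = c (t + 1))
    (X : Finset ℕ) (hX : ∀ x ∈ X, x < n ∧ ∃ t, 1 ≤ t ∧ t ≤ T ∧ cid t x = c t) :
    ∃ l : List ℕ, ∃ u < n, l.Nodup ∧ l.toFinset = X ∧ Feasible n s (latest n cid) l u T := by
  -- Following the given walk from time `t₀` to time `t` is one way to travel, so the latest
  -- departure is at least `t₀`.
  have hreach : ∀ v t₀ t, 1 ≤ t₀ → t₀ ≤ t → t ≤ T → cid t₀ v = c t₀ →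
      t₀ ≤ latestAt n cid t v (c t) := by
    intro v t₀ t h0 h ht hv
    induction t, h using Nat.le_induction with
    | base => rw [latestAt_self hv]
    | succ t h ih =>
      obtain ⟨w, hw, hw1, hw2⟩ := hstep t (by omega) (by omega)
      refine (ih (by omega)).trans ?_
      rw [← hw1]
      exact latestAt_succ_ge hw hw2
  -- `f x` is a time at which the walk visits `x`. The sequence lists the vertices in the order of
  -- these times, by an induction that adds a vertex of maximal `f` last.
  choose! f hf using fun x hx => (hX x hx).2
  have main : ∀ Y : Finset ℕ, Y ⊆ X → ∃ l : List ℕ, ∃ u < n, ∃ t₀, l.Nodup ∧ l.toFinset = Y ∧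
      Feasible n s (latest n cid) l u t₀ ∧ 1 ≤ t₀ ∧ cid t₀ u = c t₀ ∧
      (t₀ = 1 ∨ ∃ x ∈ Y, t₀ = f x) := by
    intro Y
    induction Y using Finset.induction_on_max_value f with
    | empty => exact fun _ => ⟨[], s, hs, 1, List.nodup_nil, rfl, ⟨rfl, le_rfl⟩, le_rfl, h1, .inl rfl⟩
    | insert x Y hx hmax ih =>
      intro hY
      obtain ⟨l, u, hu, t₀, hl, rfl, hF, ht₀, hcu, hor⟩ :=
        ih ((Finset.subset_insert _ _).trans hY)
      have hxX := hY (Finset.mem_insert_self _ _)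
      obtain ⟨f1, f2, f3⟩ := hf x hxX
      have hle : t₀ ≤ f x := by
        rcases hor with rfl | ⟨y, hy, rfl⟩
        exacts [f1, hmax y hy]
      refine ⟨x :: l, x, (hX x hxX).1, f x, List.nodup_cons.2 ⟨by simpa using hx, hl⟩, by simp,
        ⟨rfl, u, hu, hF.mono hu ?_⟩, f1, f3, .inr ⟨x, by simp, rfl⟩⟩
      rw [latest, f3]
      exact hreach u t₀ (f x) ht₀ hle f2 hcu
  obtain ⟨l, u, hu, t₀, hl, hlX, hF, -, -, hor⟩ := main X subset_rfl
  refine ⟨l, u, hu, hl, hlX, hF.mono hu ?_⟩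
  rcases hor with rfl | ⟨x, hx, rfl⟩
  exacts [hT, (hf x hx).2.1]

end Latest

/-! ### The components of a listing -/

section Listing

variable {I : Instance} (R : Listing I)

/-- The position of the component of `v` in the list of the components of timestep `t`. -/
def Listing.compIndex (t v : ℕ) : ℕ :=
  if h : 1 ≤ t ∧ t ≤ I.L then
    (R.comps ⟨t - 1, by omega⟩).findIdx fun c => decide (v ∈ c.map Fin.val) else 0

variable {R}

/-- Distinct components are disjoint, and the listing names each component only once; so a vertex
determines a position. -/
theorem Listing.eq_of_mem {t : Fin I.L} {i j : ℕ} {ci cj : List (Fin I.n)} {v : Fin I.n}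
    (hi : (R.comps t)[i]? = some ci) (hj : (R.comps t)[j]? = some cj) (hvi : v ∈ ci)
    (hvj : v ∈ cj) : i = j := by
  have hmi := (R.mem_iff t _).1 (List.mem_map_of_mem (List.mem_of_getElem? hi))
  have hmj := (R.mem_iff t _).1 (List.mem_map_of_mem (List.mem_of_getElem? hj))
  have he := (I.graph.layer t).eq_of_mem_parts hmi hmj (a := v) (by simpa using hvi)
    (by simpa using hvj)
  obtain ⟨hi', rfl⟩ := List.getElem?_eq_some_iff.1 hi
  obtain ⟨hj', rfl⟩ := List.getElem?_eq_some_iff.1 hj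
  have := (R.nodup_comps t).getElem_inj_iff (i := i) (j := j) (hi := by simpa using hi')
    (hj := by simpa using hj')
  rw [← this]
  simpa using he

theorem Listing.compIndex_spec {t v : ℕ} (ht : 1 ≤ t) (htL : t ≤ I.L) (hv : v < I.n) :
    ∃ c, (R.comps ⟨t - 1, by omega⟩)[R.compIndex t v]? = some c ∧ (⟨v, hv⟩ : Fin I.n) ∈ c := by
  rw [compIndex, dif_pos ⟨ht, htL⟩]
  set t' : Fin I.L := ⟨t - 1, by omega⟩
  obtain ⟨C, hC, hvC⟩ := (I.graph.layer t').exists_mem (Finset.mem_univ (⟨v, hv⟩ : Fin I.n))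
  rw [← R.mem_iff] at hC
  obtain ⟨c, hc, rfl⟩ := List.mem_map.1 hC
  have hlt : (R.comps t').findIdx (fun c => decide (v ∈ c.map Fin.val)) < (R.comps t').length :=
    List.findIdx_lt_length_of_exists ⟨c, hc, decide_eq_true (List.mem_map.2 ⟨⟨v, hv⟩, by simpa using hvC, rfl⟩)⟩
  refine ⟨_, List.getElem?_eq_getElem hlt, ?_⟩
  obtain ⟨x, hx, hxv⟩ := List.mem_map.1 (of_decide_eq_true (List.findIdx_getElem (w := hlt)))
  rwa [show (⟨v, hv⟩ : Fin I.n) = x from Fin.ext hxv.symm]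

theorem Listing.compIndex_eq {t v i : ℕ} {c : List (Fin I.n)} (ht : 1 ≤ t) (htL : t ≤ I.L)
    (hv : v < I.n) (hi : (R.comps ⟨t - 1, by omega⟩)[i]? = some c)
    (hvc : (⟨v, hv⟩ : Fin I.n) ∈ c) : R.compIndex t v = i := by
  obtain ⟨c', hc', hv'⟩ := R.compIndex_spec ht htL hv
  exact eq_of_mem hc' hi hv' hvc

/-- The component of `v` at time `t`. -/
def Listing.component (R : Listing I) (t v : ℕ) : Finset (Fin I.n) :=
  Finset.univ.filter fun w => R.compIndex t w = R.compIndex t v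

theorem Listing.component_eq {t v : ℕ} (ht : 1 ≤ t) (htL : t ≤ I.L) (hv : v < I.n) :
    ((R.comps ⟨t - 1, by omega⟩)[R.compIndex t v]?).map List.toFinset = some (R.component t v) := by
  obtain ⟨c, hc, hvc⟩ := R.compIndex_spec ht htL hv
  rw [hc, Option.map_some, Option.some_inj]
  ext w
  simp only [List.mem_toFinset, component, Finset.mem_filter, Finset.mem_univ, true_and]
  constructor
  · exact fun hw => compIndex_eq ht htL w.2 hc hw
  · intro hw
    obtain ⟨c', hc', hw'⟩ := R.compIndex_spec ht htL w.2
    rw [hw, hc] at hc'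
    cases hc'
    exact hw'

theorem Listing.component_mem {t v : ℕ} (ht : 1 ≤ t) (htL : t ≤ I.L) (hv : v < I.n) :
    R.component t v ∈ I.graph.components t := by
  rw [TemporalGraph.components, dif_pos ⟨ht, htL⟩, ← R.mem_iff]
  have := R.component_eq ht htL hv
  rw [Option.map_eq_some_iff] at this
  obtain ⟨c, hc, hc'⟩ := this
  exact List.mem_map.2 ⟨c, List.mem_of_getElem? hc, hc'⟩

theorem Listing.compIndex_eq_of_mem {t : ℕ} {C : Finset (Fin I.n)}
    (hC : C ∈ I.graph.components t) {v w : Fin I.n} (hv : v ∈ C) (hw : w ∈ C) :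
    R.compIndex t v = R.compIndex t w := by
  rw [TemporalGraph.components] at hC
  split_ifs at hC with h
  · rw [← R.mem_iff] at hC
    obtain ⟨c, hc, rfl⟩ := List.mem_map.1 hC
    obtain ⟨i, hi⟩ := List.getElem?_of_mem hc
    rw [compIndex_eq h.1 h.2 v.2 hi (by simpa using hv),
      compIndex_eq h.1 h.2 w.2 hi (by simpa using hw)]
  · simp at hC

/-- Completeness: every tour of length `T` shows up as a feasible repetition-free sequence at time
`T`. Components are nonempty, so each is named by the index of an arbitrary one of its vertices. -/
theorem exists_feasible_of_isTour {W : List (Finset (Fin I.n))}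
    (hW : IsTour I.graph I.s 1 I.k W) :
    1 ≤ W.length ∧ W.length ≤ I.L ∧ ∃ l : List ℕ, ∃ u < I.n, l.Nodup ∧ l.length = I.k ∧
      Feasible I.n I.s (latest I.n R.compIndex) l u W.length := by
  obtain ⟨X, hXk, hw, hX⟩ := hW
  have hpos : 1 ≤ W.length := List.length_pos_iff.2 hw.nonempty
  have hne : ∀ C t, C ∈ I.graph.components t → C.Nonempty := by
    intro C t hC
    rw [TemporalGraph.components] at hC
    split_ifs at hC
    · exact (I.graph.layer _).nonempty_of_mem_parts hC
    · simp at hC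
  have hmem : ∀ i (h : i < W.length), W[i] ∈ I.graph.components (i + 1) := fun i h => by
    rw [add_comm]
    exact hw.mem_components i h
  set c : ℕ → ℕ := fun t => if h : t - 1 < W.length then
    R.compIndex t (hne _ _ (hmem (t - 1) h)).choose else 0
  have hc : ∀ i (h : i < W.length) (v : Fin I.n), v ∈ W[i] → R.compIndex (i + 1) v = c (i + 1) := by
    intro i h v hv
    simp only [c]
    rw [dif_pos (show i + 1 - 1 < W.length from h)]
    exact Listing.compIndex_eq_of_mem (hmem i h) hv (hne _ _ (hmem i h)).choose_spec
  refine ⟨hpos, by have := hw.le_lifetime; omega, ?_⟩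
  have key := exists_feasible (n := I.n) (cid := R.compIndex) (s := I.s) (T := W.length) c hpos
    I.s.2 ?_ ?_ (X.map Fin.valEmbedding) ?_
  · obtain ⟨l, u, hu, hl, hlX, hF⟩ := key
    refine ⟨l, u, hu, hl, ?_, hF⟩
    rw [← List.toFinset_card_of_nodup hl, hlX, Finset.card_map, hXk]
  · refine hc 0 hpos I.s ?_
    refine hw.start_mem _ ?_
    rw [List.head?_eq_getElem?, List.getElem?_eq_getElem hpos]
    rfl
  · intro t ht htT
    obtain ⟨i, rfl⟩ : ∃ i, t = i + 1 := ⟨t - 1, by omega⟩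
    obtain ⟨v, hv⟩ := hw.inter_nonempty i htT
    rw [Finset.mem_inter] at hv
    exact ⟨v, v.2, hc i (by omega) v hv.1, hc (i + 1) htT v hv.2⟩
  · intro x hx
    obtain ⟨x, hxX, rfl⟩ := Finset.mem_map.1 hx
    obtain ⟨C, hC, hxC⟩ := hX x hxX
    obtain ⟨i, hi, rfl⟩ := List.getElem_of_mem hC
    exact ⟨x.2, i + 1, by omega, by omega, hc i hi x hxC⟩

/-- `Y 1, …, Y T` are vertices of the components of a walk that visits the vertices in `V`. -/
structure IsPath (R : Listing I) (V : List ℕ) (T : ℕ) (Y : ℕ → ℕ) : Prop where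
  one_le : 1 ≤ T
  le_lifetime : T ≤ I.L
  lt : ∀ t, 1 ≤ t → t ≤ T → Y t < I.n
  start : R.compIndex 1 I.s = R.compIndex 1 (Y 1)
  next : ∀ t, 1 ≤ t → t < T → ∃ w < I.n, R.compIndex t w = R.compIndex t (Y t) ∧
    R.compIndex (t + 1) w = R.compIndex (t + 1) (Y (t + 1))
  visits : ∀ x ∈ V, ∃ t, 1 ≤ t ∧ t ≤ T ∧ R.compIndex t x = R.compIndex t (Y t)

/-- Soundness: the components of the representatives `Y t` form the walk, and their positions in the
listing are what the output has to contain. -/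
theorem IsPath.exists_isTour {V : List ℕ} {T : ℕ} {Y : ℕ → ℕ} (h : IsPath R V T Y)
    (hV : V.Nodup) (hVk : V.length = I.k) (hVn : ∀ x ∈ V, x < I.n) {σ : State} (h0 : σ.mem 0 = T)
    (hσ : ∀ t, 1 ≤ t → t ≤ T → σ.mem t = R.compIndex t (Y t)) :
    ∃ W, W.length = T ∧ IsTour I.graph I.s 1 I.k W ∧ Outputs R σ W := by
  have hT := h.one_le
  have hL := h.le_lifetime
  refine ⟨(List.range T).map fun i => R.component (i + 1) (Y (i + 1)), by simp, ?_, ?_⟩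
  · refine ⟨V.toFinset.attachFin fun x hx => hVn x (List.mem_toFinset.1 hx), ?_, ⟨?_, le_rfl, ?_, ?_,
      ?_, ?_⟩, ?_⟩
    · rw [Finset.card_attachFin, List.toFinset_card_of_nodup hV, hVk]
    · simp only [ne_eq, List.map_eq_nil_iff, List.range_eq_nil]
      omega
    · simp only [List.length_map, List.length_range]
      omega
    · intro i hi
      simp only [List.length_map, List.length_range] at hi
      rw [List.getElem_map, List.getElem_range, add_comm 1 i]
      exact R.component_mem (by omega) (by omega) (h.lt _ (by omega) (by omega))
    · intro i hi
      simp only [List.length_map, List.length_range] at hi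
      simp only [List.getElem_map, List.getElem_range]
      obtain ⟨w, hw, hw1, hw2⟩ := h.next (i + 1) (by omega) (by omega)
      exact ⟨⟨w, hw⟩, by simp [Listing.component, hw1, hw2]⟩
    · intro C hC
      rw [List.head?_eq_getElem?, List.getElem?_eq_getElem (by simp; omega)] at hC
      simp only [List.getElem_map, List.getElem_range, Option.mem_def, Option.some_inj] at hC
      subst hC
      simp [Listing.component, h.start]
    · intro x hx
      rw [Finset.mem_attachFin, List.mem_toFinset] at hx
      obtain ⟨t, h1, h2, h3⟩ := h.visits x hx
      refine ⟨_, List.mem_map.2 ⟨t - 1, List.mem_range.2 (by omega), rfl⟩, ?_⟩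
      rw [Nat.sub_add_cancel h1]
      simp [Listing.component, h3]
  · refine ⟨by simpa using h0, fun i hi => ?_⟩
    simp only [List.length_map, List.length_range] at hi
    refine ⟨by omega, ?_⟩
    rw [List.getElem_map, List.getElem_range, hσ _ (by omega) (by omega)]
    exact R.component_eq (t := i + 1) (by omega) (by omega) (h.lt _ (by omega) (by omega))

end Listing

end

/-! ### The algorithm as a program in the small language, with its loop invariants. -/

section

/-! ### Rules for expressions without access to the low memory -/

/-- The expression does not refer to the low memory. -/
def Expr.noInp : Expr → Bool
  | .inp _ => false
  | .bin _ e₁ e₂ => e₁.noInp && e₂.noInp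
  | _ => true

theorem Expr.ok_of_noInp {b : ℕ} {ρ : List ℕ} {m : Mem} {e : Expr} (h : e.noInp = true) :
    e.Ok b ρ m := by
  induction e with
  | inp e _ => simp [Expr.noInp] at h
  | bin o e₁ e₂ h₁ h₂ =>
    simp only [Expr.noInp, Bool.and_eq_true] at h
    exact ⟨h₁ h.1, h₂ h.2⟩
  | _ => trivial

section Rules

variable {w b Z : ℕ}

theorem tr_let {e : Expr} {s : Stmt} {ρ : List ℕ} {m : Mem} {I : ℕ} {Q : Mem → Prop} (v : ℕ)
    (hv : e.val ρ m = v) (hlt : v < Z) (h : Tr w b Z s (v :: ρ) m I Q)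
    (he : e.noInp = true := by rfl) : Tr w b Z (.letE e s) ρ m I Q :=
  tr_letE (Expr.ok_of_noInp he) hv hlt h

/-- The bound needed for a new local variable is free of charge here, since every value in the
memory is below `Z`. -/
theorem tr_letRead {a : Fin 16} {i₁ i₂ i₃ i₄ i₅ : ℕ} {s : Stmt} {ρ : List ℕ} {m : Mem} {I : ℕ}
    {Q : Mem → Prop} (v : ℕ) (hv : (Expr.read a i₁ i₂ i₃ i₄ i₅).val ρ m = v)
    (h : v < Z → Tr w b Z s (v :: ρ) m I Q) :
    Tr w b Z (.letE (.read a i₁ i₂ i₃ i₄ i₅) s) ρ m I Q :=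
  tr_small fun hm => tr_let v hv (hv ▸ hm.2 _ _ _ _ _ _) (h (hv ▸ hm.2 _ _ _ _ _ _))

theorem tr_set {a : Fin 16} {i₁ i₂ i₃ i₄ i₅ : ℕ} {e : Expr} {ρ : List ℕ} {m : Mem} {I : ℕ}
    {Q : Mem → Prop} (j₁ j₂ j₃ j₄ j₅ v : ℕ) (hv : e.val ρ m = v) (hlt : v < Z)
    (hQ : Q (m.set a j₁ j₂ j₃ j₄ j₅ v)) (h₁ : lookup ρ i₁ = j₁ := by rfl)
    (h₂ : lookup ρ i₂ = j₂ := by rfl) (h₃ : lookup ρ i₃ = j₃ := by rfl)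
    (h₄ : lookup ρ i₄ = j₄ := by rfl) (h₅ : lookup ρ i₅ = j₅ := by rfl)
    (he : e.noInp = true := by rfl) : Tr w b Z (.store a i₁ i₂ i₃ i₄ i₅ e) ρ m I Q :=
  tr_store (Expr.ok_of_noInp he) hv hlt (by rwa [h₁, h₂, h₃, h₄, h₅])

theorem tr_if {e : Expr} {s₁ s₂ : Stmt} {ρ : List ℕ} {m : Mem} {I : ℕ} {Q : Mem → Prop}
    (h₁ : e.val ρ m ≠ 0 → Tr w b Z s₁ ρ m I Q) (h₂ : e.val ρ m = 0 → Tr w b Z s₂ ρ m I Q)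
    (he : e.noInp = true := by rfl) : Tr w b Z (.ite e s₁ s₂) ρ m I Q :=
  tr_ite (Expr.ok_of_noInp he) h₁ h₂

theorem tr_for {e : Expr} {s : Stmt} {ρ : List ℕ} {m : Mem} {Q : Mem → Prop} (N B I : ℕ)
    (Inv : ℕ → Mem → Prop) (hN : e.val ρ m = N) (hNB : N ≤ B) (hB : 0 < B)
    (hI : 0 < I) (hNZ : N < Z) (h0 : Inv 0 m)
    (h : ∀ j < N, ∀ m', Inv j m' → Tr w b Z s (j :: N :: ρ) m' I (Inv (j + 1)))
    (hQ : ∀ m', Inv N m' → Q m') (he : e.noInp = true := by rfl) :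
    Tr w b Z (.forE e s) ρ m (B * I) Q :=
  tr_forE Inv (Expr.ok_of_noInp he) hN hNB hB hI hNZ h0 h hQ

end Rules

/-! ### Memories that differ only in some places -/

/-- The memories have the same low part and differ only in places that satisfy `P`. -/
def Frame (P : Fin 16 → ℕ → ℕ → ℕ → Prop) (m m' : Mem) : Prop :=
  m'.low = m.low ∧ ∀ a i₁ i₂ i₃ i₄ i₅, ¬ P a i₁ i₂ i₃ → m'.arr a i₁ i₂ i₃ i₄ i₅ = m.arr a i₁ i₂ i₃ i₄ i₅

theorem Frame.refl (P : Fin 16 → ℕ → ℕ → ℕ → Prop) (m : Mem) : Frame P m m :=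
  ⟨rfl, fun _ _ _ _ _ _ _ => rfl⟩

theorem Frame.trans {P : Fin 16 → ℕ → ℕ → ℕ → Prop} {m₁ m₂ m₃ : Mem} (h : Frame P m₁ m₂)
    (h' : Frame P m₂ m₃) : Frame P m₁ m₃ :=
  ⟨h'.1.trans h.1, fun a i₁ i₂ i₃ i₄ i₅ hP => (h'.2 a i₁ i₂ i₃ i₄ i₅ hP).trans
    (h.2 a i₁ i₂ i₃ i₄ i₅ hP)⟩

theorem Frame.mono {P P' : Fin 16 → ℕ → ℕ → ℕ → Prop} {m m' : Mem} (h : Frame P m m')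
    (hP : ∀ a i₁ i₂ i₃, P a i₁ i₂ i₃ → P' a i₁ i₂ i₃) : Frame P' m m' :=
  ⟨h.1, fun a i₁ i₂ i₃ i₄ i₅ hn => h.2 a i₁ i₂ i₃ i₄ i₅ fun hp => hn (hP _ _ _ _ hp)⟩

theorem Frame.set {P : Fin 16 → ℕ → ℕ → ℕ → Prop} {m m' : Mem} (h : Frame P m m') {a : Fin 16}
    {i₁ i₂ i₃ : ℕ} (hP : P a i₁ i₂ i₃) (i₄ i₅ v : ℕ) : Frame P m (m'.set a i₁ i₂ i₃ i₄ i₅ v) := by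
  refine ⟨h.1, fun a' j₁ j₂ j₃ j₄ j₅ hn => ?_⟩
  rw [← h.2 a' j₁ j₂ j₃ j₄ j₅ hn]
  simp only [Mem.set]
  rw [if_neg]
  rintro ⟨rfl, rfl, rfl, rfl, -⟩
  exact hn hP

theorem Mem.set_arr (m : Mem) (a a' : Fin 16) (i₁ i₂ i₃ i₄ i₅ j₁ j₂ j₃ j₄ j₅ v : ℕ) :
    (m.set a i₁ i₂ i₃ i₄ i₅ v).arr a' j₁ j₂ j₃ j₄ j₅ =
      if a' = a ∧ j₁ = i₁ ∧ j₂ = i₂ ∧ j₃ = i₃ ∧ j₄ = i₄ ∧ j₅ = i₅ then v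
      else m.arr a' j₁ j₂ j₃ j₄ j₅ := rfl

theorem Mem.set_arr_self (m : Mem) (a : Fin 16) (i₁ i₂ i₃ i₄ i₅ v : ℕ) :
    (m.set a i₁ i₂ i₃ i₄ i₅ v).arr a i₁ i₂ i₃ i₄ i₅ = v := by
  simp [Mem.set_arr]

theorem Mem.set_arr_ne {m : Mem} {a a' : Fin 16} (h : a' ≠ a) (i₁ i₂ i₃ i₄ i₅ j₁ j₂ j₃ j₄ j₅ v : ℕ) :
    (m.set a i₁ i₂ i₃ i₄ i₅ v).arr a' j₁ j₂ j₃ j₄ j₅ = m.arr a' j₁ j₂ j₃ j₄ j₅ := by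
  simp [Mem.set_arr, h]

theorem Mem.set_set (m : Mem) (a : Fin 16) (i₁ i₂ i₃ i₄ i₅ v v' : ℕ) :
    (m.set a i₁ i₂ i₃ i₄ i₅ v).set a i₁ i₂ i₃ i₄ i₅ v' = m.set a i₁ i₂ i₃ i₄ i₅ v' := by
  ext a' j₁ j₂ j₃ j₄ j₅
  · rfl
  · simp only [Mem.set_arr]
    split_ifs <;> rfl

/-! ### The program: exterior multiplication -/

/-- The number of moduli is one more. -/
def numModuli (k : ℕ) : ℕ := 3 * (k + 1) * (k + 1)

/-- The least modulus. -/
def firstModulus (n k : ℕ) : ℕ := n * (k + 1) * numModuli k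

/-- The global variables: `0`, the number of vertices, the lifetime, `k`, the start vertex, `2 ^ k`,
the number of moduli and the least modulus. -/
abbrev globals (n L k s : ℕ) : List ℕ :=
  [firstModulus n k, numModuli k, 2 ^ k, s, k, L, n, 0]

/-- The bound `Z` is large enough. -/
structure Large (Z n L k : ℕ) : Prop where
  n_lt : n < Z
  L_lt : L + 1 < Z
  k_lt : k + 2 < Z
  pow_lt : 2 ^ (k + 1) < Z
  moduli_lt : firstModulus n k + numModuli k + 1 < Z
  pos : 1 ≤ n

/-- The table entry of the vertex `x`, for the set `A` and the row `a`, holds the weight. -/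
def WeightsOk (n k r : ℕ) (m : Mem) : Prop :=
  ∀ x < n, ∀ A < 2 ^ k, ∀ a < k, (m.arr 4 x A a 0 0 : ZMod r) = (weight x A a : ℤ)

/-- The table of the powers of two. -/
def PowersOk (k : ℕ) (m : Mem) : Prop := ∀ a ≤ k, m.arr 1 a 0 0 0 0 = 2 ^ a

/-- A block of the array `5` represents `E` modulo `r`. -/
def Represents (k r : ℕ) (m : Mem) (i₁ i₂ i₃ : ℕ) (E : ℕ → ℕ → ℤ) : Prop :=
  ∀ A < 2 ^ k, ∀ B < 2 ^ k, m.arr 5 i₁ i₂ i₃ A B < r ∧ (m.arr 5 i₁ i₂ i₃ A B : ZMod r) = (E A B : ℤ)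

/-- Multiplication of the block given by the local variables `27, 28, 29` with the vertex `33`; the
result goes to the block given by the local variables `30, 31, 32`. -/
def extendStmt : Stmt :=
  .forE (.var 5) <| .forE (.var 5) <|
    .seq (.store 7 0 0 0 0 0 (.lit 0)) <|
    .seq (.forE (.var 3) <| .letE (.var 35 - .read 1 39 0 0 0 0) <| .letE (.read 4 33 35 39 0 0) <|
      .forE (.var 3) <| .letE (.var 37 - .read 1 43 0 0 0 0) <|
        .store 7 0 0 0 0 0 ((.read 7 0 0 0 0 0 +
          .var 41 * .read 4 33 37 43 0 0 % .var 10 * .read 5 27 28 29 40 44) % .var 10)) <|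
    .store 5 30 31 32 35 37 (.read 7 0 0 0 0 0)

variable {w b Z n L k s : ℕ}

/-- Local variables have absolute levels, and the statement is used at two places of different
depth; the sixteen values `y₁, ..., z₇` are padding that puts its arguments at the levels `27` to
`33` in both. Source and target block must differ because entries of the source are still read after
others of the target have been written. -/
theorem tr_extendStmt (hL : Large Z n L k) {r i N x p₁ p₂ p₃ q₁ q₂ q₃ : ℕ}
    {y₁ y₂ y₃ y₄ y₅ y₆ y₇ y₈ y₉ z₁ z₂ z₃ z₄ z₅ z₆ z₇ : ℕ} {m : Mem} {E : ℕ → ℕ → ℤ} (hr : 0 < r)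
    (hrZ : r < Z) (hx : x < n) (hW : WeightsOk n k r m) (hP : PowersOk k m)
    (hE : Represents k r m p₁ p₂ p₃ E) (hpq : ¬ (p₁ = q₁ ∧ p₂ = q₂ ∧ p₃ = q₃)) :
    Tr w b Z extendStmt (x :: q₃ :: q₂ :: q₁ :: p₃ :: p₂ :: p₁ :: y₁ :: y₂ :: y₃ :: y₄ :: y₅ :: y₆ ::
      y₇ :: y₈ :: y₉ :: z₁ :: z₂ :: z₃ :: z₄ :: z₅ :: z₆ :: z₇ :: r :: i :: N :: globals n L k s) m
      (2 ^ k * (2 ^ k * ((k + 1) * ((k + 1) * 1)))) fun m' =>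
      Frame (fun a i₁ i₂ i₃ => a = 7 ∨ a = 5 ∧ i₁ = q₁ ∧ i₂ = q₂ ∧ i₃ = q₃) m m' ∧
        Represents k r m' q₁ q₂ q₃ (extend k x E) := by
  set F : Fin 16 → ℕ → ℕ → ℕ → Prop :=
    fun a i₁ i₂ i₃ => a = 7 ∨ a = 5 ∧ i₁ = q₁ ∧ i₂ = q₂ ∧ i₃ = q₃ with hF
  have hpow := hL.pow_lt
  have hkZ := hL.k_lt
  rw [pow_succ] at hpow
  have hp1 := Nat.one_le_two_pow (n := k)
  have : NeZero r := ⟨hr.ne'⟩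
  set good : Mem → ℕ → ℕ → Prop := fun m' A B => m'.arr 5 q₁ q₂ q₃ A B < r ∧
    (m'.arr 5 q₁ q₂ q₃ A B : ZMod r) = (extend k x E A B : ℤ) with hgood
  refine tr_for (2 ^ k) _ _ (fun j m' => Frame F m m' ∧ ∀ A < j, ∀ B < 2 ^ k, good m' A B) rfl le_rfl
    hp1 (by positivity) (by omega) ⟨Frame.refl _ _, by simp⟩ ?_ fun m' h => h
  intro A hA m₁ h₁
  refine tr_for (2 ^ k) _ _ (fun j m' => Frame F m m' ∧ (∀ A' < A, ∀ B < 2 ^ k, good m' A' B) ∧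
    ∀ B < j, good m' A B) rfl le_rfl hp1 (by positivity) (by omega) ⟨h₁.1, h₁.2, by simp⟩ ?_ ?_
  swap
  · rintro m' ⟨h1, h2, h3⟩
    refine ⟨h1, fun A' hA' B hB => ?_⟩
    rcases Nat.lt_succ_iff_lt_or_eq.1 hA' with h | rfl
    exacts [h2 _ h B hB, h3 B hB]
  intro B hB m₂ h₂
  refine tr_seq (Q₁ := fun m' => m' = m₂.set 7 0 0 0 0 0 0) (tr_set 0 0 0 0 0 0 rfl (by omega) rfl) ?_
  rintro _ rfl
  have hfr : ∀ v, Frame F m (m₂.set 7 0 0 0 0 0 v) := fun v =>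
    h₂.1.set (show F 7 0 0 0 by simp [hF]) _ _ _
  set term : ℕ → ℕ → ZMod r := fun a b => (weight x A a : ℤ) * (weight x B b : ℤ) *
    (E (A - 2 ^ a) (B - 2 ^ b) : ℤ) with hterm
  refine tr_seq (Q₁ := fun m' => ∃ v < r, m' = m₂.set 7 0 0 0 0 0 v ∧
    (v : ZMod r) = (extend k x E A B : ℤ)) ?_ ?_
  swap
  · rintro _ ⟨v, hv, rfl, hv'⟩
    refine tr_set q₁ q₂ q₃ A B v (Mem.set_arr_self _ _ _ _ _ _ _ _) (hv.trans hrZ) ?_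
    refine ⟨(hfr v).set (by simp [hF]) _ _ _, fun A' hA' B' hB' => ?_, fun B' hB' => ?_⟩
    · simp only [hgood, Mem.set_arr, hA'.ne, if_false, and_false, false_and,
        show (5 : Fin 16) ≠ 7 by decide]
      exact h₂.2.1 A' hA' B' hB'
    · by_cases h : B' = B
      · subst h
        simp only [hgood, Mem.set_arr, and_true, if_true]
        exact ⟨hv, hv'⟩
      · simp only [hgood, Mem.set_arr, h, if_false, and_false, false_and,
          show (5 : Fin 16) ≠ 7 by decide]
        exact h₂.2.2 B' (by omega)
  refine tr_for k _ _ (fun j m' => ∃ v < r, m' = m₂.set 7 0 0 0 0 0 v ∧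
    (v : ZMod r) = ∑ a ∈ Finset.range j, ∑ b ∈ Finset.range k, term a b) rfl (Nat.le_succ k)
    (Nat.succ_pos k) (by positivity) (by omega) ⟨0, hr, rfl, by simp⟩ ?_ ?_
  swap
  · rintro _ ⟨v, hv, rfl, hv'⟩
    refine ⟨v, hv, rfl, ?_⟩
    rw [hv', extend]
    push_cast
    rfl
  rintro a ha _ ⟨v, hv, rfl, hv'⟩
  have hPa : (m₂.set 7 0 0 0 0 0 v).arr 1 a 0 0 0 0 = 2 ^ a := by
    rw [(hfr v).2 _ _ _ _ _ _ (by simp [hF]), hP a ha.le]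
  -- If row `a` is not in `A`, this (possibly truncated) difference is meaningless as a set. It is
  -- still an index below `2 ^ k`, and its coefficient is zero; `extend` contains the same
  -- expression.
  refine tr_let (A - 2 ^ a) (congrArg (A - ·) hPa) (by omega) ?_
  refine tr_letRead _ rfl fun hwa => ?_
  have hWa : (((m₂.set 7 0 0 0 0 0 v).arr 4 x A a 0 0 : ℕ) : ZMod r) = (weight x A a : ℤ) := by
    rw [(hfr v).2 _ _ _ _ _ _ (by simp [hF]), hW x hx A hA a ha]
  change Tr w b Z _ ((m₂.set 7 0 0 0 0 0 v).arr 4 x A a 0 0 :: _) _ _ _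
  generalize (m₂.set 7 0 0 0 0 0 v).arr 4 x A a 0 0 = wa at hWa hwa
  refine tr_for k _ _ (fun j m' => ∃ v < r, m' = m₂.set 7 0 0 0 0 0 v ∧
    (v : ZMod r) = (∑ a ∈ Finset.range a, ∑ b ∈ Finset.range k, term a b) +
      ∑ b ∈ Finset.range j, term a b) rfl (Nat.le_succ k)
    (Nat.succ_pos k) one_pos (by omega) ⟨v, hv, rfl, by simp [hv']⟩ ?_ ?_
  swap
  · rintro _ ⟨v, hv, rfl, hv'⟩
    exact ⟨v, hv, rfl, by rw [hv', Finset.sum_range_succ]⟩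
  rintro c hc _ ⟨v, hv, rfl, hv'⟩
  have hPc : (m₂.set 7 0 0 0 0 0 v).arr 1 c 0 0 0 0 = 2 ^ c := by
    rw [(hfr v).2 _ _ _ _ _ _ (by simp [hF]), hP c hc.le]
  refine tr_let (B - 2 ^ c) (congrArg (B - ·) hPc) (by omega) ?_
  have hlt := Nat.mod_lt (v + wa * (m₂.set 7 0 0 0 0 0 v).arr 4 x B c 0 0 % r *
    (m₂.set 7 0 0 0 0 0 v).arr 5 p₁ p₂ p₃ (A - 2 ^ a) (B - 2 ^ c)) hr
  refine tr_set 0 0 0 0 0 ((v + wa * (m₂.set 7 0 0 0 0 0 v).arr 4 x B c 0 0 % r *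
    (m₂.set 7 0 0 0 0 0 v).arr 5 p₁ p₂ p₃ (A - 2 ^ a) (B - 2 ^ c)) % r) ?_ (hlt.trans hrZ)
    ⟨_, hlt, Mem.set_set _ _ _ _ _ _ _ _ _, ?_⟩
  · rfl
  · rw [Finset.sum_range_succ, ← add_assoc, ← hv']
    simp only [ZMod.natCast_mod, Nat.cast_add, Nat.cast_mul, hterm, hWa]
    congr 2
    · rw [(hfr v).2 _ _ _ _ _ _ (by simp [hF]), hW x hx B hB c hc]
    · rw [(hfr v).2 _ _ _ _ _ _ (by simp [hF]; tauto),
        (hE _ (by omega) _ (by omega)).2]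

end

section

variable {w b Z n L k s : ℕ}

/-! ### The program: the powers of two, reading the input, latest departure times -/

/-- Computing the powers of two; the local variables are `0, n, L, k, s`. -/
def powersStmt : Stmt :=
  .seq (.store 1 0 0 0 0 0 (.lit 1)) <|
  .forE (.var 3) <| .letE (.var 6 + .lit 1) <| .store 1 7 0 0 0 0 (.read 1 6 0 0 0 0 * .lit 2)

theorem tr_powersStmt (hL : Large Z n L k) {m : Mem} :
    Tr w b Z powersStmt [s, k, L, n, 0] m ((k + 1) * 1)
      fun m' => Frame (fun a _ _ _ => a = 1) m m' ∧ PowersOk k m' := by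
  have hk := hL.k_lt
  have hp := hL.pow_lt
  refine tr_seq (Q₁ := fun m' => m' = m.set 1 0 0 0 0 0 1)
    (tr_set 0 0 0 0 0 1 rfl (by omega) rfl) ?_
  rintro _ rfl
  refine tr_for k _ _ (fun j m' => Frame (fun a _ _ _ => a = 1) m m' ∧
    ∀ a ≤ j, m'.arr 1 a 0 0 0 0 = 2 ^ a) rfl (Nat.le_succ k) (Nat.succ_pos k) one_pos (by omega)
    ⟨(Frame.refl _ m).set rfl _ _ _, ?_⟩ ?_ fun m' h => h
  · intro a ha
    obtain rfl : a = 0 := by omega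
    simp [Mem.set_arr]
  · rintro j hj m' ⟨h1, h2⟩
    refine tr_let (j + 1) rfl (by omega) ?_
    have e : m'.arr 1 j 0 0 0 0 * 2 = 2 ^ (j + 1) := by rw [h2 j le_rfl, pow_succ]
    have hle : 2 ^ (j + 1) ≤ 2 ^ (k + 1) := Nat.pow_le_pow_right (by norm_num) (by omega)
    refine tr_set (j + 1) 0 0 0 0 (2 ^ (j + 1)) e (by omega) ⟨h1.set rfl _ _ _, fun a ha => ?_⟩
    rw [Mem.set_arr]
    by_cases h : a = j + 1
    · simp [h]
    · simp only [h, false_and, and_false, if_false]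
      exact h2 a (by omega)

/-- Computing the components of the vertices from the input. -/
def parseStmt : Stmt :=
  .seq (.store 15 0 0 0 0 0 (.lit 4)) <|
  .forE (.var 2) <| .letE (.var 9 + .lit 1) <| .letE (.inp (.read 15 0 0 0 0 0)) <|
    .seq (.store 15 0 0 0 0 0 (.read 15 0 0 0 0 0 + .lit 1)) <|
    .forE (.var 11) <| .letE (.inp (.read 15 0 0 0 0 0)) <|
      .seq (.store 15 0 0 0 0 0 (.read 15 0 0 0 0 0 + .lit 1)) <|
      .forE (.var 14) <| .letE (.inp (.read 15 0 0 0 0 0)) <|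
        .seq (.store 2 10 17 0 0 0 (.var 13)) <|
        .store 15 0 0 0 0 0 (.read 15 0 0 0 0 0 + .lit 1)

/-- The components of the vertices at the times `1, …, L`. -/
def CompsOk (n L : ℕ) (cid : ℕ → ℕ → ℕ) (m : Mem) : Prop :=
  ∀ t, 1 ≤ t → t ≤ L → ∀ v < n, m.arr 2 t v 0 0 0 = cid t v

/-- The input is in the low memory. -/
def InputOk (b : ℕ) (l : List ℕ) (m : Mem) : Prop :=
  l.length < b ∧ ∀ x < b, m.low x = l.getD x 0

theorem drop_eq_cons {l r : List ℕ} {p x : ℕ} (h : l.drop p = x :: r) :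
    p < l.length ∧ l.getD p 0 = x ∧ l.drop (p + 1) = r := by
  have hp : p < l.length := by
    by_contra hp
    rw [List.drop_eq_nil_of_le (not_lt.1 hp)] at h
    exact absurd h (by simp)
  rw [List.drop_eq_getElem_cons hp] at h
  obtain ⟨h1, h2⟩ := List.cons.inj h
  exact ⟨hp, by rw [List.getD_eq_getElem _ _ hp, h1], h2⟩

theorem tr_letInp {e : Expr} {s : Stmt} {ρ : List ℕ} {m : Mem} {I : ℕ} {Q : Mem → Prop} {l : List ℕ}
    (hin : InputOk b l m) {p x : ℕ} {r : List ℕ} (he : e.val ρ m = p) (hl : l.drop p = x :: r)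
    (h : x < Z → Tr w b Z s (x :: ρ) m I Q) (hn : e.noInp = true := by rfl) :
    Tr w b Z (.letE (.inp e) s) ρ m I Q := by
  obtain ⟨h1, h2, -⟩ := drop_eq_cons hl
  have hv : (Expr.inp e).val ρ m = x := by
    rw [Expr.val, he, hin.2 p (h1.trans hin.1), h2]
  refine tr_small fun hm => ?_
  have hx : x < Z := by
    rw [← hv]
    exact hm.1 _ (by rw [he]; exact h1.trans hin.1)
  exact tr_letE ⟨Expr.ok_of_noInp hn, by rw [he]; exact h1.trans hin.1⟩ hv hx (h hx)

theorem flatMap_drop_finRange {N : ℕ} (f : Fin N → List ℕ) {t : ℕ} (ht : t < N) :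
    ((List.finRange N).drop t).flatMap f =
      f ⟨t, ht⟩ ++ ((List.finRange N).drop (t + 1)).flatMap f := by
  rw [List.drop_eq_getElem_cons (by simpa using ht)]
  simp

theorem Listing.encode_eq {I : Instance} (R : Listing I) : R.encode = [I.n, I.L, I.k, (I.s : ℕ)] ++
    (List.finRange I.L).flatMap fun t =>
      (R.comps t).length :: (R.comps t).flatMap fun c => c.length :: c.map Fin.val := by
  have hmap : ∀ c : List (Fin I.n), (c.map fun v : Fin I.n => [(v : ℕ)]).flatten = c.map Fin.val :=
    fun c => by rw [← List.flatMap_def, List.map_eq_flatMap]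
  simp [Listing.encode, List.flatMap_def, hmap]
  rfl

theorem Listing.length_le {I : Instance} (R : Listing I) {t : Fin I.L} {c : List (Fin I.n)}
    (hc : c ∈ R.comps t) : c.length ≤ I.n := by
  simpa using (R.nodup_vertices t c hc).length_le_card

theorem Listing.length_comps_le {I : Instance} (R : Listing I) (t : Fin I.L) :
    (R.comps t).length ≤ I.n := by
  have h1 := List.toFinset_card_of_nodup (R.nodup_comps t)
  rw [List.length_map] at h1
  rw [← h1]
  have h2 : ((R.comps t).map List.toFinset).toFinset = (I.graph.layer t).parts := by
    ext C
    rw [List.mem_toFinset, R.mem_iff]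
  rw [h2]
  simpa using (I.graph.layer t).card_parts_le_card

/-- The invariants say that the part of the input from the reading position on is the encoding of
what has not been read yet. At most `n` components of at most `n` vertices per timestep are a crude
bound, but it stays within `L * n ^ 2`. -/
theorem tr_parseStmt {I : Instance} (R : Listing I) (hL : Large Z I.n I.L I.k) (hbZ : b < Z)
    {m : Mem} (hin : InputOk b R.encode m) :
    Tr w b Z parseStmt (globals I.n I.L I.k I.s) m (I.L * (I.n * (I.n * 1)))
      fun m' => Frame (fun a _ _ _ => a = 2 ∨ a = 15) m m' ∧ CompsOk I.n I.L R.compIndex m' := by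
  have hn := hL.n_lt
  have hLZ := hL.L_lt
  have hnp := hL.pos
  have hLp := I.L_pos
  set F : Fin 16 → ℕ → ℕ → ℕ → Prop := fun a _ _ _ => a = 2 ∨ a = 15 with hF
  set g : List (Fin I.n) → List ℕ := fun c => c.length :: c.map Fin.val
  set f : Fin I.L → List ℕ := fun t => (R.comps t).length :: (R.comps t).flatMap g
  have hstart : R.encode.drop 4 = ((List.finRange I.L).drop 0).flatMap f := by
    rw [R.encode_eq]
    rfl
  have hlow : ∀ m', Frame F m m' → InputOk b R.encode m' := fun m' h =>
    ⟨hin.1, fun x hx => by rw [h.1, hin.2 x hx]⟩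
  have hlen : ∀ p : ℕ, ∀ x r, R.encode.drop p = x :: r → p + 1 < Z := fun p x r h => by
    have := (drop_eq_cons h).1
    have := hin.1
    omega
  set ptr : Mem → ℕ := fun m' => m'.arr 15 0 0 0 0 0 with hptr
  refine tr_seq (Q₁ := fun m' => m' = m.set 15 0 0 0 0 0 4)
    (tr_set 0 0 0 0 0 4 rfl ?_ rfl) ?_
  · have := hin.1
    simp only [Listing.encode, List.length_append, List.length_cons] at this
    omega
  rintro _ rfl
  set good : Mem → ℕ → ℕ → Prop := fun m' t v => m'.arr 2 t v 0 0 0 = R.compIndex t v with hgood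
  refine tr_for I.L _ _ (fun t m' => Frame F m m' ∧
    R.encode.drop (ptr m') = ((List.finRange I.L).drop t).flatMap f ∧
    ∀ t', 1 ≤ t' → t' ≤ t → ∀ v < I.n, good m' t' v) rfl le_rfl hLp (by positivity) (by omega)
    ⟨(Frame.refl _ m).set (.inr rfl) _ _ _, hstart, by omega⟩ ?_ ?_
  swap
  · rintro m' ⟨h1, -, h3⟩
    exact ⟨h1, h3⟩
  rintro t ht m₁ ⟨hfr, hdrop, hdone⟩
  set t' : Fin I.L := ⟨t, ht⟩ with ht'
  set rest := ((List.finRange I.L).drop (t + 1)).flatMap f with hrest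
  rw [flatMap_drop_finRange f ht] at hdrop
  refine tr_let (t + 1) rfl (by omega) ?_
  refine tr_letInp (hlow _ hfr) rfl hdrop fun hcz => ?_
  refine tr_seq (Q₁ := fun m' => m' = m₁.set 15 0 0 0 0 0 (ptr m₁ + 1))
    (tr_set 0 0 0 0 0 (ptr m₁ + 1) rfl (hlen _ _ _ hdrop) rfl) ?_
  rintro _ rfl
  refine tr_for (R.comps t').length _ _ (fun c m' => Frame F m m' ∧
    R.encode.drop (ptr m') = ((R.comps t').drop c).flatMap g ++ rest ∧
    (∀ t', 1 ≤ t' → t' ≤ t → ∀ v < I.n, good m' t' v) ∧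
    ∀ i < c, ∀ l, (R.comps t')[i]? = some l → ∀ v ∈ l, good m' (t + 1) v) rfl (R.length_comps_le _) hnp
    (by positivity) hcz ⟨hfr.set (.inr rfl) _ _ _, (drop_eq_cons hdrop).2.2, ?_, by simp⟩ ?_ ?_
  · intro t' h1 h2 v hv
    simp only [hgood, Mem.set_arr_ne (show (2 : Fin 16) ≠ 15 by decide)]
    exact hdone t' h1 h2 v hv
  swap
  · rintro m' ⟨h1, h2, h3, h4⟩
    refine ⟨h1, by simpa [List.drop_length] using h2, fun t₁ ht₁ ht₁' v hv => ?_⟩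
    rcases Nat.lt_succ_iff_lt_or_eq.1 (Nat.lt_succ_of_le ht₁') with h | rfl
    · exact h3 t₁ ht₁ (by omega) v hv
    · obtain ⟨c, hc, hvc⟩ := R.compIndex_spec (t := t + 1) (by omega) (by omega) hv
      exact h4 _ (List.getElem?_eq_some_iff.1 hc).1 c hc ⟨v, hv⟩ hvc
  rintro c hc m₂ ⟨hfr₂, hdrop₂, hdone₂, hcur₂⟩
  set l := (R.comps t')[c] with hl
  have hlc : (R.comps t')[c]? = some l := List.getElem?_eq_getElem hc
  set rest₂ := ((R.comps t').drop (c + 1)).flatMap g ++ rest with hrest₂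
  rw [List.drop_eq_getElem_cons hc, List.flatMap_cons, List.append_assoc, ← hrest₂] at hdrop₂
  refine tr_letInp (hlow _ hfr₂) rfl hdrop₂ fun hlz => ?_
  refine tr_seq (Q₁ := fun m' => m' = m₂.set 15 0 0 0 0 0 (ptr m₂ + 1))
    (tr_set 0 0 0 0 0 (ptr m₂ + 1) rfl (hlen _ _ _ hdrop₂) rfl) ?_
  rintro _ rfl
  refine tr_for l.length _ _ (fun i m' => Frame F m m' ∧
    R.encode.drop (ptr m') = (l.drop i).map Fin.val ++ rest₂ ∧
    (∀ t', 1 ≤ t' → t' ≤ t → ∀ v < I.n, good m' t' v) ∧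
    (∀ i < c, ∀ l, (R.comps t')[i]? = some l → ∀ v ∈ l, good m' (t + 1) v) ∧
    ∀ j < i, ∀ v, l[j]? = some v → good m' (t + 1) v) rfl
    (R.length_le (List.getElem_mem hc)) hnp one_pos hlz
    ⟨hfr₂.set (.inr rfl) _ _ _, (drop_eq_cons hdrop₂).2.2, ?_, ?_, by simp⟩ ?_ ?_
  · intro t' h1 h2 v hv
    simp only [hgood, Mem.set_arr_ne (show (2 : Fin 16) ≠ 15 by decide)]
    exact hdone₂ t' h1 h2 v hv
  · intro i hi l' hl' v hv
    simp only [hgood, Mem.set_arr_ne (show (2 : Fin 16) ≠ 15 by decide)]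
    exact hcur₂ i hi l' hl' v hv
  swap
  · rintro m' ⟨h1, h2, h3, h4, h5⟩
    refine ⟨h1, by simpa [List.drop_length] using h2, h3, fun i hi l' hl' v hv => ?_⟩
    rcases Nat.lt_succ_iff_lt_or_eq.1 hi with h | rfl
    · exact h4 i h l' hl' v hv
    · obtain rfl : l = l' := Option.some_inj.1 (hlc.symm.trans hl')
      obtain ⟨j, hj⟩ := List.getElem?_of_mem hv
      exact h5 j (List.getElem?_eq_some_iff.1 hj).1 v hj
  rintro i hi m₃ ⟨hfr₃, hdrop₃, hdone₃, hcur₃, hpart₃⟩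
  rw [List.drop_eq_getElem_cons hi, List.map_cons, List.cons_append] at hdrop₃
  refine tr_letInp (hlow _ hfr₃) rfl hdrop₃ fun hvz => ?_
  have hci : R.compIndex (t + 1) l[i] = c :=
    Listing.compIndex_eq (by omega) (by omega) (l[i]).2 hlc (List.getElem_mem hi)
  refine tr_seq (Q₁ := fun m' => m' = m₃.set 2 (t + 1) l[i] 0 0 0 c)
    (tr_set (t + 1) l[i] 0 0 0 c rfl (lt_trans hc hcz) rfl) ?_
  rintro _ rfl
  -- The value written is the right one for its place, so no earlier correct entry can be spoiled.
  have hkeep : ∀ t₁ v, good m₃ t₁ v → good (m₃.set 2 (t + 1) l[i] 0 0 0 c) t₁ v := by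
    intro t₁ v h
    simp only [hgood, Mem.set_arr]
    split_ifs with h'
    · rw [h'.2.1, h'.2.2.1, hci]
    · exact h
  have hne : ∀ q t₁ v, good ((m₃.set 2 (t + 1) l[i] 0 0 0 c).set 15 0 0 0 0 0 q) t₁ v ↔
      good (m₃.set 2 (t + 1) l[i] 0 0 0 c) t₁ v := by
    intro q t₁ v
    simp only [hgood, Mem.set_arr_ne (show (2 : Fin 16) ≠ 15 by decide)]
  refine tr_set 0 0 0 0 0 (ptr m₃ + 1) rfl (hlen _ _ _ hdrop₃)
    ⟨(hfr₃.set (.inl rfl) _ _ _).set (.inr rfl) _ _ _, (drop_eq_cons hdrop₃).2.2,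
      fun t₁ h1 h2 v hv => (hne _ _ _).2 (hkeep _ _ (hdone₃ t₁ h1 h2 v hv)),
      fun j hj l' hl' v hv => (hne _ _ _).2 (hkeep _ _ (hcur₃ j hj l' hl' v hv)),
      fun j hj v hv => (hne _ _ _).2 ?_⟩
  rcases Nat.lt_succ_iff_lt_or_eq.1 hj with h | rfl
  · exact hkeep _ _ (hpart₃ j h v hv)
  · rw [List.getElem?_eq_getElem hi] at hv
    cases hv
    simp only [hgood, Mem.set_arr_self, hci]

/-- Computing the latest departure times. -/
def latestStmt : Stmt :=
  .forE (.var 2) <| .letE (.var 9 + .lit 1) <| .forE (.var 1) <|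
    .seq (.forE (.var 1) <| .letE (.read 2 10 14 0 0 0) <| .letE (.read 2 9 14 0 0 0) <|
      .ite (.bin .lt (.read 3 10 12 15 0 0) (.read 3 9 12 16 0 0))
        (.store 3 10 12 15 0 0 (.read 3 9 12 16 0 0)) .skip) <|
    .letE (.read 2 10 12 0 0 0) <| .store 3 10 12 13 0 0 (.var 10)

/-- The table of the latest departure times. -/
def LatestOk (n L : ℕ) (cid : ℕ → ℕ → ℕ) (m : Mem) : Prop :=
  ∀ t ≤ L, ∀ v < n, ∀ u < n, m.arr 3 t v (m.arr 2 t u 0 0 0) 0 0 = latest n cid v u t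

/-- The maxima for all components `c` are formed simultaneously: each vertex `w` contributes to the
entry of its own component at the new time, so a pair of `t` and `v` costs `n` steps. This needs
entries that are `0` at the beginning. The component of `v` itself is overwritten last, with the
current time. -/
theorem tr_latestStmt (hL : Large Z n L k) (hLp : 1 ≤ L) {cid : ℕ → ℕ → ℕ} {m : Mem}
    (hc : CompsOk n L cid m) (h0 : ∀ t v c, m.arr 3 t v c 0 0 = 0) :
    Tr w b Z latestStmt (globals n L k s) m (L * (n * (n * 1)))
      fun m' => Frame (fun a _ _ _ => a = 3) m m' ∧ LatestOk n L cid m' := by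
  have hn := hL.n_lt
  have hLZ := hL.L_lt
  have hnp := hL.pos
  set F : Fin 16 → ℕ → ℕ → ℕ → Prop := fun a _ _ _ => a = 3 with hF
  refine tr_for L _ _ (fun t m' => Frame F m m' ∧ ∀ t' v c, m'.arr 3 t' v c 0 0 =
    if t' ≤ t ∧ v < n then latestAt n cid t' v c else 0) rfl le_rfl hLp (by positivity) (by omega)
    ⟨Frame.refl _ m, ?_⟩ ?_ ?_
  · intro t' v c
    rw [h0]
    split_ifs with h
    · obtain rfl : t' = 0 := by omega
      rfl
    · rfl
  swap
  · rintro m' ⟨h1, h2⟩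
    refine ⟨h1, fun t ht v hv u hu => ?_⟩
    rw [h2, if_pos ⟨ht, hv⟩, h1.2 2 _ _ _ _ _ (by simp [hF])]
    -- No component indices are known for time `0`, but there all latest departure times are `0`
    -- whatever the component.
    cases t with
    | zero => rfl
    | succ t => rw [hc (t + 1) (by omega) ht u hu, latest]
  rintro t ht m₁ ⟨hfr₁, h₁⟩
  refine tr_let (t + 1) rfl (by omega) ?_
  have hcid : ∀ m', Frame F m m' → ∀ t', 1 ≤ t' → t' ≤ L → ∀ v < n, m'.arr 2 t' v 0 0 0 = cid t' v :=
    fun m' h t' h1 h2 v hv => by rw [h.2 2 _ _ _ _ _ (by simp [hF]), hc t' h1 h2 v hv]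
  refine tr_for n _ _ (fun v m' => Frame F m m' ∧ ∀ t' v' c, m'.arr 3 t' v' c 0 0 =
    if (t' ≤ t ∨ t' = t + 1 ∧ v' < v) ∧ v' < n then latestAt n cid t' v' c else 0) rfl le_rfl hnp
    (by positivity) hn ⟨hfr₁, ?_⟩ ?_ ?_
  · intro t' v' c
    rw [h₁]
    simp
  swap
  · rintro m' ⟨h1, h2⟩
    refine ⟨h1, fun t' v' c => ?_⟩
    rw [h2]
    refine if_congr ?_ rfl rfl
    omega
  rintro v hv m₂ ⟨hfr₂, h₂⟩
  refine tr_seq (Q₁ := fun m' => Frame F m m' ∧ (∀ t' v' c, ¬ (t' = t + 1 ∧ v' = v) →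
    m'.arr 3 t' v' c 0 0 = m₂.arr 3 t' v' c 0 0) ∧ ∀ c, m'.arr 3 (t + 1) v c 0 0 =
      (Finset.range n).sup fun w => if cid (t + 1) w = c then latestAt n cid t v (cid t w) else 0)
    ?_ ?_
  · refine tr_for n _ _ (fun j m' => Frame F m m' ∧ (∀ t' v' c, ¬ (t' = t + 1 ∧ v' = v) →
      m'.arr 3 t' v' c 0 0 = m₂.arr 3 t' v' c 0 0) ∧ ∀ c, m'.arr 3 (t + 1) v c 0 0 =
      (Finset.range j).sup fun w => if cid (t + 1) w = c then latestAt n cid t v (cid t w) else 0)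
      rfl le_rfl hnp one_pos hn ⟨hfr₂, fun _ _ _ _ => rfl, ?_⟩ ?_ fun _ h => h
    · intro c
      rw [h₂, if_neg (by omega)]
      simp
    rintro x hx m₃ ⟨hfr₃, hoth₃, h₃⟩
    refine tr_letRead _ (hcid _ hfr₃ (t + 1) (by omega) (by omega) x hx) fun hc1 => ?_
    refine tr_letRead (m₃.arr 2 t x 0 0 0) rfl fun hc0 => ?_
    have hval : m₃.arr 3 t v (m₃.arr 2 t x 0 0 0) 0 0 = latestAt n cid t v (cid t x) := by
      rw [hoth₃ _ _ _ (by omega), h₂, if_pos (by omega)]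
      cases t with
      | zero => rfl
      | succ t => rw [hcid _ hfr₃ (t + 1) (by omega) (by omega) x hx]
    have hsup : ∀ c, ((Finset.range (x + 1)).sup fun w =>
        if cid (t + 1) w = c then latestAt n cid t v (cid t w) else 0) =
        if cid (t + 1) x = c then max (m₃.arr 3 t v (m₃.arr 2 t x 0 0 0) 0 0)
          (m₃.arr 3 (t + 1) v c 0 0) else m₃.arr 3 (t + 1) v c 0 0 := by
      intro c
      rw [Finset.range_add_one, Finset.sup_insert, ← h₃ c, hval]
      split_ifs
      · rfl
      · simp
    refine tr_if (fun hif => ?_) fun hif => tr_skip ?_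
    · have hif : m₃.arr 3 (t + 1) v (cid (t + 1) x) 0 0 <
          m₃.arr 3 t v (m₃.arr 2 t x 0 0 0) 0 0 := by
        by_contra h
        exact hif (if_neg h)
      have hltL := latestAt_le (n := n) (cid := cid) t v (cid t x)
      refine tr_set (t + 1) v (cid (t + 1) x) 0 0 (m₃.arr 3 t v (m₃.arr 2 t x 0 0 0) 0 0) rfl
        (by omega) ⟨hfr₃.set rfl _ _ _, fun t' v' c h => ?_, fun c => ?_⟩
      · rw [Mem.set_arr, if_neg (by tauto), hoth₃ _ _ _ h]
      · rw [hsup, Mem.set_arr]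
        by_cases hcx : cid (t + 1) x = c
        · subst hcx
          simp [hif.le]
        · simp [hcx, Ne.symm hcx]
    · have hif : ¬ m₃.arr 3 (t + 1) v (cid (t + 1) x) 0 0 <
          m₃.arr 3 t v (m₃.arr 2 t x 0 0 0) 0 0 := by
        intro h
        exact absurd (hif.symm.trans (if_pos h)) (by norm_num)
      refine ⟨hfr₃, hoth₃, fun c => ?_⟩
      rw [hsup]
      split_ifs with hcx
      · subst hcx
        rw [max_eq_right (not_lt.1 hif)]
      · rfl
  rintro m₄ ⟨hfr₄, hoth₄, h₄⟩
  refine tr_letRead _ (hcid _ hfr₄ (t + 1) (by omega) (by omega) v hv) fun hcz => ?_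
  refine tr_set (t + 1) v (cid (t + 1) v) 0 0 (t + 1) rfl (by omega)
    ⟨hfr₄.set rfl _ _ _, fun t' v' c => ?_⟩
  rw [Mem.set_arr]
  by_cases htv : t' = t + 1 ∧ v' = v
  · obtain ⟨rfl, rfl⟩ := htv
    rw [if_pos (show _ ∧ v' < n by omega), latestAt, h₄]
    by_cases hcv : c = cid (t + 1) v'
    · simp [hcv]
    · simp [hcv]
  · rw [if_neg (by tauto), hoth₄ _ _ _ htv, h₂]
    refine if_congr ?_ rfl rfl
    omega

end

section

variable {w b Z n L k s : ℕ}

/-! ### The program: the table of the dynamic program -/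

/-- Computing the weights. -/
def weightsStmt : Stmt :=
  .forE (.var 1) <| .forE (.var 5) <|
    .seq (.store 0 0 0 0 0 0 (.lit 1)) <| .seq (.store 7 0 0 0 0 0 (.lit 1)) <|
    .forE (.var 3) <|
      .seq (.ite (.var 14 / .read 1 16 0 0 0 0 % .lit 2)
        (.seq (.store 4 12 14 16 0 0 (.read 0 0 0 0 0 0 * .read 7 0 0 0 0 0 % .var 10))
          (.store 0 0 0 0 0 0 ((.var 10 - .read 0 0 0 0 0 0) % .var 10)))
        (.store 4 12 14 16 0 0 (.lit 0))) <|
      .store 7 0 0 0 0 0 (.read 7 0 0 0 0 0 * .var 12 % .var 10)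

theorem rowSign_succ (A a : ℕ) :
    rowSign A (a + 1) = if A.testBit a then -rowSign A a else rowSign A a := by
  rw [rowSign, Finset.prod_range_succ, ← rowSign]
  split_ifs <;> simp

/-- For fixed `x` and `A` the rows are passed in increasing order; array `0` holds the current sign
modulo `r` (negated as `r - _`) and array `7` the current power of `x`. -/
theorem tr_weightsStmt (hL : Large Z n L k) {r i N : ℕ} {m : Mem} (hr : 2 ≤ r) (hrZ : r < Z)
    (hP : PowersOk k m) :
    Tr w b Z weightsStmt (r :: i :: N :: globals n L k s) m (n * (2 ^ k * ((k + 1) * 1)))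
      fun m' => Frame (fun a _ _ _ => a = 0 ∨ a = 4 ∨ a = 7) m m' ∧ WeightsOk n k r m' := by
  have hn := hL.n_lt
  have hnp := hL.pos
  have hpow := hL.pow_lt
  have hkZ := hL.k_lt
  rw [pow_succ] at hpow
  have hp1 := Nat.one_le_two_pow (n := k)
  have hr0 : 0 < r := by omega
  set F : Fin 16 → ℕ → ℕ → ℕ → Prop := fun a _ _ _ => a = 0 ∨ a = 4 ∨ a = 7 with hF
  set good : Mem → ℕ → ℕ → ℕ → Prop := fun m' x A a =>
    (m'.arr 4 x A a 0 0 : ZMod r) = (weight x A a : ℤ) with hgood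
  refine tr_for n _ _ (fun j m' => Frame F m m' ∧ ∀ x < j, ∀ A < 2 ^ k, ∀ a < k, good m' x A a) rfl
    le_rfl hnp (by positivity) hn ⟨Frame.refl _ m, by simp⟩ ?_ fun m' h => h
  rintro x hx m₁ ⟨hfr₁, h₁⟩
  refine tr_for (2 ^ k) _ _ (fun j m' => Frame F m m' ∧ ∀ x' A, (x' < x ∧ A < 2 ^ k ∨ x' = x ∧ A < j) →
    ∀ a < k, good m' x' A a) rfl le_rfl hp1 (by positivity) (by omega)
    ⟨hfr₁, fun x' A h => h₁ x' (by omega) A (by omega)⟩ ?_ fun m' h =>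
      ⟨h.1, fun x' hx' A hA => h.2 x' A (by omega)⟩
  rintro A hA m₂ ⟨hfr₂, h₂⟩
  refine tr_seq (Q₁ := fun m' => m' = m₂.set 0 0 0 0 0 0 1)
    (tr_set 0 0 0 0 0 1 rfl (by omega) rfl) ?_
  rintro _ rfl
  refine tr_seq (Q₁ := fun m' => m' = (m₂.set 0 0 0 0 0 0 1).set 7 0 0 0 0 0 1)
    (tr_set 0 0 0 0 0 1 rfl (by omega) rfl) ?_
  rintro _ rfl
  refine tr_for k _ _ (fun j m' => Frame F m m' ∧
    (∀ x' A', (x' < x ∧ A' < 2 ^ k ∨ x' = x ∧ A' < A) → ∀ a < k, good m' x' A' a) ∧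
    (∀ a < j, good m' x A a) ∧
    (m'.arr 0 0 0 0 0 0 < r ∧ (m'.arr 0 0 0 0 0 0 : ZMod r) = (rowSign A j : ℤ)) ∧
    (m'.arr 7 0 0 0 0 0 : ZMod r) = ((x : ℤ) ^ j : ℤ)) rfl (Nat.le_succ k) (Nat.succ_pos k) one_pos
    (by omega)
    ⟨(hfr₂.set (.inl rfl) _ _ _).set (.inr (.inr rfl)) _ _ _, ?_, by simp, ?_, ?_⟩ ?_ ?_
  · intro x' A' h a ha
    simpa [hgood, Mem.set_arr] using h₂ x' A' h a ha
  · simp [Mem.set_arr, rowSign]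
    omega
  · simp [Mem.set_arr]
  swap
  · rintro m' ⟨h1, h2, h3, -⟩
    refine ⟨h1, fun x' A' h => ?_⟩
    by_cases hc : x' = x ∧ A' = A
    · obtain ⟨rfl, rfl⟩ := hc
      exact h3
    · exact h2 x' A' (by omega)
  rintro a ha m₃ ⟨hfr₃, hold₃, hcur₃, ⟨hslt, hs⟩, hp⟩
  have hbit : (Expr.val (a :: k :: A :: 2 ^ k :: x :: n :: r :: i :: N :: globals n L k s) m₃
      (.var 14 / .read 1 16 0 0 0 0 % .lit 2)) = A / 2 ^ a % 2 := by
    change A / m₃.arr 1 a 0 0 0 0 % 2 = _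
    rw [hfr₃.2 1 _ _ _ _ _ (by simp [hF]), hP a ha.le]
  have htest : A.testBit a = decide (A / 2 ^ a % 2 = 1) := Nat.testBit_eq_decide_div_mod_eq
  refine tr_seq (Q₁ := fun m' => Frame F m m' ∧
    (∀ x' A', (x' < x ∧ A' < 2 ^ k ∨ x' = x ∧ A' < A) → ∀ a < k, good m' x' A' a) ∧
    (∀ a' < a + 1, good m' x A a') ∧
    (m'.arr 0 0 0 0 0 0 < r ∧ (m'.arr 0 0 0 0 0 0 : ZMod r) = (rowSign A (a + 1) : ℤ)) ∧
    m'.arr 7 0 0 0 0 0 = m₃.arr 7 0 0 0 0 0) ?_ ?_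
  · refine tr_if (fun hb => ?_) fun hb => ?_
    · rw [hbit] at hb
      have ht : A.testBit a = true := by
        rw [htest]
        exact decide_eq_true (by omega)
      have hlt := Nat.mod_lt (m₃.arr 0 0 0 0 0 0 * m₃.arr 7 0 0 0 0 0) hr0
      refine tr_seq (tr_set x A a 0 0 (m₃.arr 0 0 0 0 0 0 * m₃.arr 7 0 0 0 0 0 % r) rfl
        (hlt.trans hrZ) rfl) ?_
      rintro _ rfl
      have hlt' := Nat.mod_lt (r - m₃.arr 0 0 0 0 0 0) hr0
      refine tr_set 0 0 0 0 0 ((r - m₃.arr 0 0 0 0 0 0) % r) rfl (hlt'.trans hrZ)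
        ⟨(hfr₃.set (.inr (.inl rfl)) _ _ _).set (.inl rfl) _ _ _, fun x' A' h a' ha' => ?_,
          fun a' ha' => ?_, ⟨by simpa [Mem.set_arr] using hlt', ?_⟩, by simp [Mem.set_arr]⟩
      · simp only [hgood, Mem.set_arr]
        rw [if_neg (by simp), if_neg (by omega)]
        exact hold₃ x' A' h a' ha'
      · simp only [hgood, Mem.set_arr]
        rw [if_neg (by simp)]
        by_cases hc : a' = a
        · subst hc
          simp [hs, hp, weight, ht]
        · rw [if_neg (by omega)]
          exact hcur₃ a' (by omega)
      · simp [Mem.set_arr, rowSign_succ, ht, Nat.cast_sub hslt.le, hs]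
    · rw [hbit] at hb
      have ht : A.testBit a = false := by
        rw [htest]
        exact decide_eq_false (by omega)
      refine tr_set x A a 0 0 0 rfl (by omega)
        ⟨hfr₃.set (.inr (.inl rfl)) _ _ _, fun x' A' h a' ha' => ?_, fun a' ha' => ?_,
          ⟨by simpa [Mem.set_arr] using hslt, by simpa [Mem.set_arr, rowSign_succ, ht] using hs⟩,
          by simp [Mem.set_arr]⟩
      · simp only [hgood, Mem.set_arr]
        rw [if_neg (by omega)]
        exact hold₃ x' A' h a' ha'
      · simp only [hgood, Mem.set_arr]
        by_cases hc : a' = a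
        · subst hc
          simp [weight, ht]
        · rw [if_neg (by omega)]
          exact hcur₃ a' (by omega)
  rintro m₄ ⟨hfr₄, hold₄, hcur₄, hs₄, hp₄⟩
  have hlt := Nat.mod_lt (m₄.arr 7 0 0 0 0 0 * x) hr0
  refine tr_set 0 0 0 0 0 (m₄.arr 7 0 0 0 0 0 * x % r) rfl (hlt.trans hrZ)
    ⟨hfr₄.set (.inr (.inr rfl)) _ _ _, fun x' A' h a' ha' => ?_, fun a' ha' => ?_, ?_, ?_⟩
  · simpa [hgood, Mem.set_arr] using hold₄ x' A' h a' ha'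
  · simpa [hgood, Mem.set_arr] using hcur₄ a' ha'
  · simpa [Mem.set_arr] using hs₄
  · simp [Mem.set_arr, hp₄, hp, pow_succ]

/-- Initializing the table. -/
def baseStmt : Stmt :=
  .forE (.var 2 + .lit 1) <| .forE (.var 1) <| .forE (.var 5) <| .forE (.var 5) <|
    .store 5 0 12 14 16 18 (.bin .eq (.var 14) (.var 4) * .bin .lt (.var 0) (.var 12) *
      .bin .eq (.var 16) (.var 0) * .bin .eq (.var 18) (.var 0))

theorem tr_baseStmt (hL : Large Z n L k) {r i N : ℕ} {m : Mem} {τ : ℕ → ℕ → ℕ → ℕ} (hr : 2 ≤ r) :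
    Tr w b Z baseStmt (r :: i :: N :: globals n L k s) m ((L + 1) * (n * (2 ^ k * (2 ^ k * 1))))
      fun m' => Frame (fun a _ _ _ => a = 5) m m' ∧
        ∀ t ≤ L, ∀ v < n, Represents k r m' 0 t v (table n s k τ 0 v t) := by
  have hn := hL.n_lt
  have hnp := hL.pos
  have hLZ := hL.L_lt
  have hpow := hL.pow_lt
  rw [pow_succ] at hpow
  have hp1 := Nat.one_le_two_pow (n := k)
  set F : Fin 16 → ℕ → ℕ → ℕ → Prop := fun a _ _ _ => a = 5 with hF
  set e : ℕ → ℕ → ℕ → ℕ → ℕ := fun t v A B => if v = s ∧ 1 ≤ t ∧ A = 0 ∧ B = 0 then 1 else 0 with he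
  set good : Mem → ℕ → ℕ → ℕ → ℕ → Prop := fun m' t v A B => m'.arr 5 0 t v A B = e t v A B with hgood
  refine tr_for (L + 1) _ _ (fun j m' => Frame F m m' ∧ ∀ t v A B, t < j → v < n → A < 2 ^ k →
    B < 2 ^ k → good m' t v A B) rfl le_rfl (Nat.succ_pos L) (by positivity) hLZ
    ⟨Frame.refl _ m, by simp⟩ ?_ ?_
  swap
  · rintro m' ⟨h1, h2⟩
    refine ⟨h1, fun t ht v hv A hA B hB => ?_⟩
    have := h2 t v A B (by omega) hv hA hB
    simp only [hgood] at this
    rw [this]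
    simp only [he, table]
    split_ifs <;> constructor <;> first | omega | simp
  rintro t ht m₁ ⟨hfr₁, h₁⟩
  refine tr_for n _ _ (fun j m' => Frame F m m' ∧ ∀ t' v A B, (t' < t ∧ v < n ∨ t' = t ∧ v < j) →
    A < 2 ^ k → B < 2 ^ k → good m' t' v A B) rfl le_rfl hnp (by positivity) hn
    ⟨hfr₁, fun t' v A B h hA hB => h₁ t' v A B (by omega) (by omega) hA hB⟩ ?_
    fun m' h => ⟨h.1, fun t' v A B h1 h2 hA hB => h.2 t' v A B (by omega) hA hB⟩
  rintro v hv m₂ ⟨hfr₂, h₂⟩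
  refine tr_for (2 ^ k) _ _ (fun j m' => Frame F m m' ∧ ∀ t' v' A B,
    ((t' < t ∧ v' < n ∨ t' = t ∧ v' < v) ∧ A < 2 ^ k ∨ t' = t ∧ v' = v ∧ A < j) →
    B < 2 ^ k → good m' t' v' A B) rfl le_rfl hp1 (by positivity) (by omega)
    ⟨hfr₂, fun t' v' A B h hB => h₂ t' v' A B (by omega) (by omega) hB⟩ ?_
    fun m' h => ⟨h.1, fun t' v' A B h1 h2 hB => h.2 t' v' A B (by omega) hB⟩
  rintro A hA m₃ ⟨hfr₃, h₃⟩
  refine tr_for (2 ^ k) _ _ (fun j m' => Frame F m m' ∧ ∀ t' v' A' B,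
    (((t' < t ∧ v' < n ∨ t' = t ∧ v' < v) ∧ A' < 2 ^ k ∨ t' = t ∧ v' = v ∧ A' < A) ∧ B < 2 ^ k ∨
      t' = t ∧ v' = v ∧ A' = A ∧ B < j) → good m' t' v' A' B) rfl le_rfl hp1 one_pos (by omega)
    ⟨hfr₃, fun t' v' A' B h => h₃ t' v' A' B (by omega) (by omega)⟩ ?_
    fun m' h => ⟨h.1, fun t' v' A' B h1 hB => h.2 t' v' A' B (by omega)⟩
  rintro B hB m₄ ⟨hfr₄, h₄⟩
  refine tr_set 0 t v A B (e t v A B) ?_ ?_ ⟨hfr₄.set rfl _ _ _, fun t' v' A' B' h => ?_⟩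
  · change (if v = s then 1 else 0) * (if 0 < t then 1 else 0) * (if A = 0 then 1 else 0) *
      (if B = 0 then 1 else 0) = e t v A B
    simp only [he]
    split_ifs <;> first | rfl | omega
  · simp only [he]
    split_ifs <;> omega
  · simp only [hgood, Mem.set_arr]
    by_cases hc : t' = t ∧ v' = v ∧ A' = A ∧ B' = B
    · obtain ⟨rfl, rfl, rfl, rfl⟩ := hc
      simp
    · rw [if_neg (by tauto)]
      exact h₄ t' v' A' B' (by omega)

/-- Filling the table. -/
def tableStmt : Stmt :=
  .forE (.var 3) <| .forE (.var 2 + .lit 1) <| .forE (.var 1) <|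
    .letE (.var 3 + .lit 1) <| .letE (.var 12 + .lit 1) <| .letE (.read 2 14 16 0 0 0) <|
    .seq (.forE (.var 5) <| .forE (.var 5) <|
      .seq (.store 7 0 0 0 0 0 (.lit 0)) <|
      .seq (.forE (.var 1) <| .letE (.read 3 14 25 19 0 0) <|
        .store 7 0 0 0 0 0 ((.read 7 0 0 0 0 0 + .read 5 12 26 25 21 23) % .var 10)) <|
      .store 5 17 0 0 21 23 (.read 7 0 0 0 0 0)) <|
    .letE (.lit 0) <| .letE (.lit 0) <| .letE (.lit 0) <| .letE (.lit 0) <| .letE (.lit 0) <|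
    .letE (.lit 0) <| .letE (.lit 0) <| .letE (.var 17) <| .letE (.lit 0) <| .letE (.lit 0) <|
    .letE (.var 18) <| .letE (.var 14) <| .letE (.var 16) <| .letE (.var 16) extendStmt

/-- The tables that do not depend on the modulus. -/
structure Ready (n L k : ℕ) (cid : ℕ → ℕ → ℕ) (m : Mem) : Prop where
  powers : PowersOk k m
  comps : CompsOk n L cid m
  latest : LatestOk n L cid m

theorem Ready.frame {cid : ℕ → ℕ → ℕ} {m m' : Mem} {P : Fin 16 → ℕ → ℕ → ℕ → Prop}
    (h : Ready n L k cid m) (hf : Frame P m m') (h₁ : ∀ i j l, ¬ P 1 i j l)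
    (h₂ : ∀ i j l, ¬ P 2 i j l) (h₃ : ∀ i j l, ¬ P 3 i j l) : Ready n L k cid m' := by
  refine ⟨fun a ha => ?_, fun t h1 h2 v hv => ?_, fun t ht v hv u hu => ?_⟩
  · rw [hf.2 _ _ _ _ _ _ (h₁ _ _ _), h.powers a ha]
  · rw [hf.2 _ _ _ _ _ _ (h₂ _ _ _), h.comps t h1 h2 v hv]
  · rw [hf.2 _ _ _ _ _ _ (h₃ _ _ _), hf.2 _ _ _ _ _ _ (h₂ _ _ _), h.latest t ht v hv u hu]

/-- The table of the dynamic program modulo `r`. -/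
def TableOk (n L k s r : ℕ) (cid : ℕ → ℕ → ℕ) (m : Mem) : Prop :=
  ∀ p ≤ k, ∀ t ≤ L, ∀ v < n, Represents k r m p t v (table n s k (latest n cid) p v t)

theorem le_of_eq_mul {a c d : ℕ} (h : d = a * c) (hc : 0 < c) : a ≤ d :=
  h ▸ Nat.le_mul_of_pos_right a hc

/-- Multiplication by the vector of `u` is linear, so the sum over the `n` predecessors is formed
first and extended only once. The sum is put in a block with first index `k + 1`, which no layer `p
≤ k` of the table uses. -/
theorem tr_tableStmt (hL : Large Z n L k) {r i N : ℕ} {m : Mem} {cid : ℕ → ℕ → ℕ} (hr : 0 < r)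
    (hrZ : r < Z) (hR : Ready n L k cid m) (hW : WeightsOk n k r m)
    (h0 : ∀ t ≤ L, ∀ v < n, Represents k r m 0 t v (table n s k (latest n cid) 0 v t)) :
    Tr w b Z tableStmt (r :: i :: N :: globals n L k s) m
      ((k + 1) * ((L + 1) * (n * (2 ^ k * (2 ^ k * ((k + 1) * ((k + 1) * n)))))))
      fun m' => Frame (fun a _ _ _ => a = 5 ∨ a = 7) m m' ∧ TableOk n L k s r cid m' := by
  have hn := hL.n_lt
  have hnp := hL.pos
  have hLZ := hL.L_lt
  have hkZ := hL.k_lt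
  have hpow := hL.pow_lt
  rw [pow_succ] at hpow
  have hp1 := Nat.one_le_two_pow (n := k)
  set F : Fin 16 → ℕ → ℕ → ℕ → Prop := fun a _ _ _ => a = 5 ∨ a = 7 with hF
  set T := table n s k (latest n cid) with hT
  refine tr_for k _ _ (fun j m' => Frame F m m' ∧ ∀ p t v, p ≤ j → t ≤ L → v < n →
    Represents k r m' p t v (T p v t)) rfl (Nat.le_succ k) (Nat.succ_pos k) (by positivity) (by omega)
    ⟨Frame.refl _ m, fun p t v hp ht hv => ?_⟩ ?_
    fun m' h => ⟨h.1, fun p hp t ht v hv => h.2 p t v hp ht hv⟩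
  · obtain rfl : p = 0 := by omega
    exact h0 t ht v hv
  rintro p hp m₁ ⟨hfr₁, h₁⟩
  refine tr_for (L + 1) _ _ (fun j m' => Frame F m m' ∧ ∀ p' t v, (p' ≤ p ∧ t ≤ L ∨ p' = p + 1 ∧ t < j) →
    v < n → Represents k r m' p' t v (T p' v t)) rfl le_rfl (Nat.succ_pos L) (by positivity) hLZ
    ⟨hfr₁, fun p' t v h hv => h₁ p' t v (by omega) (by omega) hv⟩ ?_
    fun m' h => ⟨h.1, fun p' t v h1 h2 hv => h.2 p' t v (by omega) hv⟩
  rintro t ht m₂ ⟨hfr₂, h₂⟩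
  refine tr_for n _ _ (fun j m' => Frame F m m' ∧ ∀ p' t' v,
    ((p' ≤ p ∧ t' ≤ L ∨ p' = p + 1 ∧ t' < t) ∧ v < n ∨ p' = p + 1 ∧ t' = t ∧ v < j) →
    Represents k r m' p' t' v (T p' v t')) rfl le_rfl hnp (by positivity) hn
    ⟨hfr₂, fun p' t' v h => h₂ p' t' v (by omega) (by omega)⟩ ?_
    fun m' h => ⟨h.1, fun p' t' v h1 hv => h.2 p' t' v (by omega)⟩
  rintro u hu m₃ ⟨hfr₃, h₃⟩
  refine tr_let (k + 1) rfl (by omega) ?_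
  refine tr_let (p + 1) rfl (by omega) ?_
  refine tr_letRead _ rfl fun hcz => ?_
  change Tr w b Z _ (m₃.arr 2 t u 0 0 0 :: _) _ _ _
  have hR₃ : Ready n L k cid m₃ := hR.frame hfr₃ (by simp [hF]) (by simp [hF]) (by simp [hF])
  have hlat := hR₃.latest t (by omega)
  generalize hc : m₃.arr 2 t u 0 0 0 = c at hcz
  have hlat : ∀ v < n, m₃.arr 3 t v c 0 0 = latest n cid v u t := fun v hv => by
    rw [← hc, hlat v hv u hu]
  set G : Fin 16 → ℕ → ℕ → ℕ → Prop :=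
    fun a i₁ i₂ i₃ => a = 7 ∨ a = 5 ∧ i₁ = k + 1 ∧ i₂ = 0 ∧ i₃ = 0 with hG
  set E : ℕ → ℕ → ℤ := fun A B => ∑ v ∈ Finset.range n, T p v (latest n cid v u t) A B with hE
  refine tr_seq (Q₁ := fun m' => Frame G m₃ m' ∧ Represents k r m' (k + 1) 0 0 E) ?_ ?_
  · set good : Mem → ℕ → ℕ → Prop := fun m' A B => m'.arr 5 (k + 1) 0 0 A B < r ∧
      (m'.arr 5 (k + 1) 0 0 A B : ZMod r) = (E A B : ℤ) with hgood
    refine (tr_for (2 ^ k) (2 ^ k) (2 ^ k * (n * 1)) (fun j m' => Frame G m₃ m' ∧ ∀ A < j, ∀ B < 2 ^ k,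
      good m' A B) rfl le_rfl hp1 (by positivity) (by omega) ⟨Frame.refl _ _, by simp⟩ ?_
      fun m' h => h).mono (le_of_eq_mul (c := (k + 1) * (k + 1)) (by ring) (by positivity))
      (Nat.succ_le_of_lt (by positivity)) fun _ h => h
    rintro A hA m₄ ⟨hfr₄, h₄⟩
    refine tr_for (2 ^ k) _ _ (fun j m' => Frame G m₃ m' ∧ ∀ A' B, (A' < A ∧ B < 2 ^ k ∨
      A' = A ∧ B < j) → good m' A' B) rfl le_rfl hp1 (by positivity) (by omega)
      ⟨hfr₄, fun A' B h => h₄ A' (by omega) B (by omega)⟩ ?_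
      fun m' h => ⟨h.1, fun A' hA' B hB => h.2 A' B (by omega)⟩
    rintro B hB m₅ ⟨hfr₅, h₅⟩
    refine tr_seq (Q₁ := fun m' => m' = m₅.set 7 0 0 0 0 0 0)
      (tr_set 0 0 0 0 0 0 rfl (by omega) rfl) ?_
    rintro _ rfl
    have hfr : ∀ v, Frame G m₃ (m₅.set 7 0 0 0 0 0 v) := fun v =>
      hfr₅.set (show G 7 0 0 0 by simp [hG]) _ _ _
    refine tr_seq (Q₁ := fun m' => ∃ v < r, m' = m₅.set 7 0 0 0 0 0 v ∧
      (v : ZMod r) = (E A B : ℤ)) ?_ ?_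
    · refine tr_for n _ _ (fun j m' => ∃ v < r, m' = m₅.set 7 0 0 0 0 0 v ∧
        (v : ZMod r) = ((∑ v ∈ Finset.range j, T p v (latest n cid v u t) A B : ℤ) : ZMod r)) rfl
        le_rfl hnp one_pos hn ⟨0, hr, rfl, by simp⟩ ?_ fun _ h => h
      rintro v hv _ ⟨y, hy, rfl, hy'⟩
      refine tr_letRead (latest n cid v u t) ?_ fun htz => ?_
      · change (m₅.set 7 0 0 0 0 0 y).arr 3 t v c 0 0 = _
        rw [(hfr y).2 _ _ _ _ _ _ (by simp [hG]), hlat v hv]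
      have hle := latest_le (n := n) (cid := cid) v u t
      have hval : (m₅.set 7 0 0 0 0 0 y).arr 5 p (latest n cid v u t) v A B =
          m₃.arr 5 p (latest n cid v u t) v A B :=
        (hfr y).2 _ _ _ _ _ _ (by simp [hG]; omega)
      have hrep := (h₃ p (latest n cid v u t) v (by omega) A hA B hB).2
      have hlt := Nat.mod_lt (y + (m₅.set 7 0 0 0 0 0 y).arr 5 p (latest n cid v u t) v A B) hr
      refine tr_set 0 0 0 0 0
        ((y + (m₅.set 7 0 0 0 0 0 y).arr 5 p (latest n cid v u t) v A B) % r) rfl (hlt.trans hrZ)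
        ⟨_, hlt, Mem.set_set _ _ _ _ _ _ _ _ _, ?_⟩
      rw [hval, ZMod.natCast_mod, Nat.cast_add, hy', hrep, Finset.sum_range_succ, Int.cast_add]
    · rintro _ ⟨v, hv, rfl, hv'⟩
      refine tr_set (k + 1) 0 0 A B v (Mem.set_arr_self _ _ _ _ _ _ _ _) (hv.trans hrZ)
        ⟨(hfr v).set (by simp [hG]) _ _ _, fun A' B' h => ?_⟩
      by_cases hc : A' = A ∧ B' = B
      · obtain ⟨rfl, rfl⟩ := hc
        simp only [hgood, Mem.set_arr_self]
        exact ⟨hv, hv'⟩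
      · simp only [hgood]
        rw [Mem.set_arr, if_neg (by tauto), Mem.set_arr, if_neg (by simp)]
        exact h₅ A' B' (by omega)
  rintro m₄ ⟨hfr₄, h₄⟩
  have hZ1 : 0 < Z := by omega
  refine tr_let 0 rfl hZ1 <| tr_let 0 rfl hZ1 <| tr_let 0 rfl hZ1 <| tr_let 0 rfl hZ1 <|
    tr_let 0 rfl hZ1 <| tr_let 0 rfl hZ1 <| tr_let 0 rfl hZ1 ?_
  refine tr_let (k + 1) rfl (by omega) <| tr_let 0 rfl hZ1 <| tr_let 0 rfl hZ1 <|
    tr_let (p + 1) rfl (by omega) <| tr_let t rfl (by omega) <| tr_let u rfl (by omega) <|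
    tr_let u rfl (by omega) ?_
  have hfr34 : Frame F m m₄ := hfr₃.trans (hfr₄.mono fun a i₁ i₂ i₃ h => by
    simp only [hG] at h
    simp only [hF]
    tauto)
  have hW₄ : WeightsOk n k r m₄ := fun x hx A hA a ha => by
    rw [hfr34.2 _ _ _ _ _ _ (by simp [hF]), hW x hx A hA a ha]
  have hP₄ : PowersOk k m₄ :=
    (hR.frame hfr34 (by simp [hF]) (by simp [hF]) (by simp [hF])).powers
  refine (tr_extendStmt hL hr hrZ hu hW₄ hP₄ h₄ (by omega)).mono
    (le_of_eq_mul (c := n) (by ring) hnp) (Nat.succ_le_of_lt (by positivity)) ?_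
  rintro m₅ ⟨hfr₅, h₅⟩
  refine ⟨hfr34.trans (hfr₅.mono fun a i₁ i₂ i₃ h => by simp only [hF]; tauto), fun p' t' v h => ?_⟩
  by_cases hc : p' = p + 1 ∧ t' = t ∧ v = u
  · obtain ⟨rfl, rfl, rfl⟩ := hc
    exact h₅
  · intro A hA B hB
    rw [hfr₅.2 _ _ _ _ _ _ (by simp; tauto), hfr₄.2 _ _ _ _ _ _ (by simp [hG]; omega)]
    exact h₃ p' t' v (by omega) A hA B hB

end

section

variable {w b Z n L k s : ℕ}

/-! ### The program: the first time with a nonzero entry -/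

/-- Looking for the first time at which an entry of the last layer of the table is nonzero. -/
def findStmt : Stmt :=
  .seq (.store 8 0 0 0 0 0 (.lit 0)) <| .seq (.store 9 0 0 0 0 0 (.lit 0)) <|
  .letE (.var 5 - .lit 1) <| .forE (.var 2) <| .letE (.var 13 + .lit 1) <| .forE (.var 1) <|
    .ite (.bin .eq (.read 8 0 0 0 0 0) (.lit 0) * .bin .lt (.lit 0) (.read 5 3 14 16 11 11))
      (.seq (.store 8 0 0 0 0 0 (.var 14)) (.store 9 0 0 0 0 0 (.var 16))) .skip

/-- `T` is the first time, up to `L`, with a nonzero value, and `U` is a place of such a value; if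
there is none, then `T = 0`. -/
def IsFirst (n L : ℕ) (g : ℕ → ℕ → ℕ) (T U : ℕ) : Prop :=
  (∀ t, 1 ≤ t → t ≤ L → (T = 0 ∨ t < T) → ∀ u < n, g t u = 0) ∧
    (T ≠ 0 → T ≤ L ∧ U < n ∧ g T U ≠ 0)

/-- Time `0` does not occur, so the value `0` in array `8` means that nothing has been found yet;
testing it preserves the first hit. -/
theorem tr_findStmt (hL : Large Z n L k) (hLp : 1 ≤ L) {r i N : ℕ} {m : Mem} :
    Tr w b Z findStmt (r :: i :: N :: globals n L k s) m (L * (n * 1))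
      fun m' => Frame (fun a _ _ _ => a = 8 ∨ a = 9) m m' ∧
        IsFirst n L (fun t u => m.arr 5 k t u (2 ^ k - 1) (2 ^ k - 1)) (m'.arr 8 0 0 0 0 0)
          (m'.arr 9 0 0 0 0 0) := by
  have hn := hL.n_lt
  have hnp := hL.pos
  have hLZ := hL.L_lt
  have hpow := hL.pow_lt
  rw [pow_succ] at hpow
  set F : Fin 16 → ℕ → ℕ → ℕ → Prop := fun a _ _ _ => a = 8 ∨ a = 9 with hF
  set g : ℕ → ℕ → ℕ := fun t u => m.arr 5 k t u (2 ^ k - 1) (2 ^ k - 1) with hg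
  refine tr_seq (Q₁ := fun m' => m' = m.set 8 0 0 0 0 0 0) (tr_set 0 0 0 0 0 0 rfl (by omega) rfl) ?_
  rintro _ rfl
  refine tr_seq (Q₁ := fun m' => m' = (m.set 8 0 0 0 0 0 0).set 9 0 0 0 0 0 0)
    (tr_set 0 0 0 0 0 0 rfl (by omega) rfl) ?_
  rintro _ rfl
  refine tr_let (2 ^ k - 1) rfl (by omega) ?_
  refine tr_for L _ _ (fun j m' => Frame F m m' ∧
    IsFirst n j g (m'.arr 8 0 0 0 0 0) (m'.arr 9 0 0 0 0 0)) rfl le_rfl hLp (by positivity) (by omega)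
    ⟨((Frame.refl _ _).set (.inl rfl) _ _ _).set (.inr rfl) _ _ _, fun t h1 h2 => by omega,
      fun h => absurd (by simp [Mem.set_arr]) h⟩ ?_ fun _ h => h
  rintro t ht m₁ ⟨hfr₁, h₁, h₁'⟩
  refine tr_let (t + 1) rfl (by omega) ?_
  refine tr_for n _ _ (fun j m' => Frame F m m' ∧
    (∀ t', 1 ≤ t' → t' ≤ t → (m'.arr 8 0 0 0 0 0 = 0 ∨ t' < m'.arr 8 0 0 0 0 0) →
      ∀ u < n, g t' u = 0) ∧ (m'.arr 8 0 0 0 0 0 = 0 → ∀ u < j, g (t + 1) u = 0) ∧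
    (m'.arr 8 0 0 0 0 0 ≠ 0 → m'.arr 8 0 0 0 0 0 ≤ t + 1 ∧ m'.arr 9 0 0 0 0 0 < n ∧
      g (m'.arr 8 0 0 0 0 0) (m'.arr 9 0 0 0 0 0) ≠ 0)) rfl le_rfl hnp one_pos hn
    ⟨hfr₁, h₁, by simp, fun h => ⟨(h₁' h).1.trans (Nat.le_succ t), (h₁' h).2⟩⟩ ?_ ?_
  swap
  · rintro m' ⟨h1, h2, h3, h4⟩
    refine ⟨h1, fun t' ht1 ht2 hor u hu => ?_, h4⟩
    rcases Nat.lt_succ_iff_lt_or_eq.1 (Nat.lt_succ_of_le ht2) with h | rfl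
    · exact h2 t' ht1 (by omega) hor u hu
    · rcases hor with h | h
      · exact h3 h u hu
      · exact absurd (h4 (by omega)).1 (by omega)
  rintro u hu m₂ ⟨hfr₂, h2, h3, h4⟩
  have hval : m₂.arr 5 k (t + 1) u (2 ^ k - 1) (2 ^ k - 1) = g (t + 1) u :=
    hfr₂.2 _ _ _ _ _ _ (by simp [hF])
  have hif : (Expr.val (u :: n :: (t + 1) :: t :: L :: (2 ^ k - 1) :: r :: i :: N :: globals n L k s) m₂
      (.bin .eq (.read 8 0 0 0 0 0) (.lit 0) * .bin .lt (.lit 0) (.read 5 3 14 16 11 11))) =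
      (if m₂.arr 8 0 0 0 0 0 = 0 then 1 else 0) * (if 0 < g (t + 1) u then 1 else 0) := by
    rw [← hval]
    rfl
  refine tr_if (fun hc => ?_) fun hc => tr_skip ⟨hfr₂, h2, fun h0 u' hu' => ?_, h4⟩
  · rw [hif] at hc
    have hc8 : m₂.arr 8 0 0 0 0 0 = 0 := by
      by_contra h
      simp [h] at hc
    have hcg : g (t + 1) u ≠ 0 := by
      intro h
      simp [h] at hc
    refine tr_seq (tr_set 0 0 0 0 0 (t + 1) rfl (by omega) rfl) ?_
    rintro _ rfl
    refine tr_set 0 0 0 0 0 u rfl (by omega) ⟨(hfr₂.set (.inl rfl) _ _ _).set (.inr rfl) _ _ _, ?_⟩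
    simp only [Mem.set_arr, and_self, and_true, if_true, show (8 : Fin 16) ≠ 9 by decide, if_false]
    exact ⟨fun t' h1 h2' _ => h2 t' h1 h2' (.inl hc8), by omega, fun _ => ⟨le_rfl, hu, hcg⟩⟩
  · rw [hif] at hc
    rcases Nat.lt_succ_iff_lt_or_eq.1 hu' with h | rfl
    · exact h3 h0 u' h
    · by_contra h
      simp [h0, Nat.pos_of_ne_zero h] at hc

/-! ### The program: a feasible sequence of vertices -/

/-- `V (j + d), …, V (j + 1)`. -/
def segment (V : ℕ → ℕ) (j : ℕ) : ℕ → List ℕ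
  | 0 => []
  | d + 1 => V (j + d + 1) :: segment V j d

theorem segment_congr {V V' : ℕ → ℕ} {j d : ℕ} (h : ∀ i, j < i → i ≤ j + d → V i = V' i) :
    segment V j d = segment V' j d := by
  induction d with
  | zero => rfl
  | succ d ih =>
    rw [segment, segment, h _ (by omega) (by omega), ih fun i h1 h2 => h i h1 (by omega)]

theorem segment_succ (V : ℕ → ℕ) (j d : ℕ) :
    segment V j (d + 1) = segment V (j + 1) d ++ [V (j + 1)] := by
  induction d with
  | zero => rfl
  | succ d ih =>
    rw [segment, ih, segment, List.cons_append]
    congr 2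
    omega

theorem length_segment (V : ℕ → ℕ) (j d : ℕ) : (segment V j d).length = d := by
  induction d with
  | zero => rfl
  | succ d ih => rw [segment, List.length_cons, ih]

theorem mem_segment {V : ℕ → ℕ} {j d x : ℕ} : x ∈ segment V j d ↔ ∃ i, j < i ∧ i ≤ j + d ∧ V i = x := by
  induction d with
  | zero =>
    simp only [segment, List.not_mem_nil, false_iff]
    rintro ⟨i, h1, h2, -⟩
    omega
  | succ d ih =>
    rw [segment, List.mem_cons, ih]
    constructor
    · rintro (rfl | ⟨i, h1, h2, h3⟩)
      exacts [⟨_, by omega, by omega, rfl⟩, ⟨i, h1, by omega, h3⟩]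
    · rintro ⟨i, h1, h2, h3⟩
      rcases Nat.lt_or_ge (j + d) i with h | h
      · obtain rfl : i = j + d + 1 := by omega
        exact .inl h3.symm
      · exact .inr ⟨i, h1, h, h3⟩

/-- The square of a Vandermonde determinant. -/
def square (k : ℕ) (l : List ℕ) : ℤ := minor k l (2 ^ k - 1) * minor k l (2 ^ k - 1)

/-- `V 0 = s, …, V k` are vertices, the last `k` of them distinct, that can be visited in this order,
`V i` being left at time `D i`. -/
structure Route (n k s T : ℕ) (τ : ℕ → ℕ → ℕ → ℕ) (V D : ℕ → ℕ) : Prop where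
  lt : ∀ i ≤ k, V i < n
  start : V 0 = s
  pos : 1 ≤ D 0
  last : D k = T
  chain : ∀ i < k, D i = τ (V i) (V (i + 1)) (D (i + 1))
  nodup : (segment V 0 k).Nodup

/-- The vertices from `V j` to `V k` are known to be the last ones of a feasible sequence. -/
structure PartialRoute (n k s T r : ℕ) (τ : ℕ → ℕ → ℕ → ℕ) (j : ℕ) (V D : ℕ → ℕ) : Prop where
  lt : ∀ i, j ≤ i → i ≤ k → V i < n
  last : D k = T
  chain : ∀ i, j ≤ i → i < k → D i = τ (V i) (V (i + 1)) (D (i + 1))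
  ne_zero : ((sumFeasible n s τ j (V j) (D j) fun l => square k (segment V j (k - j) ++ l) : ℤ) :
    ZMod r) ≠ 0

/-- For `j = 0` the sum has at most one term. If it is nonzero modulo `r`, then the sequence really
starts at `s` at a time `≥ 1` and its integer determinant is nonzero, which forces distinct
vertices. -/
theorem PartialRoute.route {T r : ℕ} {τ : ℕ → ℕ → ℕ → ℕ} {V D : ℕ → ℕ}
    (h : PartialRoute n k s T r τ 0 V D) : Route n k s T τ V D := by
  have h0 := h.ne_zero
  rw [sumFeasible] at h0
  by_cases hc : V 0 = s ∧ 1 ≤ D 0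
  · rw [if_pos hc, List.append_nil, Nat.sub_zero] at h0
    refine ⟨fun i => h.lt i (Nat.zero_le i), hc.1, hc.2, h.last, fun i => h.chain i (Nat.zero_le i),
      nodup_of_minor_ne_zero (K := k) (A := 2 ^ k - 1) fun hm => h0 ?_⟩
    rw [square, hm]
    simp
  · rw [if_neg hc] at h0
    simp at h0

/-- The possible next vertices. -/
def IsNext (n k s r : ℕ) (τ : ℕ → ℕ → ℕ → ℕ) (j : ℕ) (V D : ℕ → ℕ) (v : ℕ) : Prop :=
  ((sumFeasible n s τ j v (τ v (V (j + 1)) (D (j + 1))) fun l =>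
    square k (segment V j (k - j) ++ l) : ℤ) : ZMod r) ≠ 0

/-- A sum that is nonzero modulo `r` has a summand that is nonzero modulo `r`. Only additivity is
used, so `r` need not be prime. -/
theorem PartialRoute.exists_isNext {T r j : ℕ} {τ : ℕ → ℕ → ℕ → ℕ} {V D : ℕ → ℕ} (hj : j < k)
    (h : PartialRoute n k s T r τ (j + 1) V D) : ∃ v < n, IsNext n k s r τ j V D v := by
  have h0 := h.ne_zero
  rw [sumFeasible, Int.cast_sum] at h0
  obtain ⟨v, hv, hv'⟩ := Finset.exists_ne_zero_of_sum_ne_zero h0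
  refine ⟨v, Finset.mem_range.1 hv, ?_⟩
  rw [IsNext, show k - j = k - (j + 1) + 1 by omega, segment_succ]
  simpa using hv'

theorem PartialRoute.cons {T r j : ℕ} {τ : ℕ → ℕ → ℕ → ℕ} {V D V' D' : ℕ → ℕ} (hj : j < k)
    (h : PartialRoute n k s T r τ (j + 1) V D) (hV : ∀ i, j < i → i ≤ k → V' i = V i)
    (hD : ∀ i, j < i → i ≤ k → D' i = D i) (hlt : V' j < n) (hn : IsNext n k s r τ j V D (V' j))
    (hDj : D' j = τ (V' j) (V (j + 1)) (D (j + 1))) : PartialRoute n k s T r τ j V' D' := by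
  refine ⟨fun i h1 h2 => ?_, by rw [hD k hj le_rfl, h.last], fun i h1 h2 => ?_, ?_⟩
  · rcases h1.eq_or_lt with rfl | h1
    · exact hlt
    · rw [hV i h1 h2]
      exact h.lt i h1 h2
  · rcases h1.eq_or_lt with rfl | h1
    · rw [hDj, hV (j + 1) (by omega) (by omega), hD (j + 1) (by omega) (by omega)]
    · rw [hD i h1 (by omega), hD _ (by omega) (by omega), hV i h1 (by omega),
        hV _ (by omega) (by omega)]
      exact h.chain i h1 h2
  · rw [hDj, segment_congr (V' := V) fun i h1 h2 => hV i h1 (by omega)]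
    exact hn

/-- Computing a feasible sequence of vertices, backwards. -/
def routeStmt : Stmt :=
  .seq (.store 10 3 0 0 0 0 (.read 9 0 0 0 0 0)) <| .seq (.store 11 3 0 0 0 0 (.var 11)) <|
  .forE (.var 3) <| .letE (.var 3 - .var 14 - .lit 1) <| .letE (.var 15 + .lit 1) <|
    .letE (.read 10 16 0 0 0 0) <| .letE (.read 11 16 0 0 0 0) <| .letE (.read 2 18 17 0 0 0) <|
    .forE (.var 1) <| .letE (.var 3 + .lit 1) <| .letE (.read 3 18 21 19 0 0) <|
    .seq (.forE (.var 5) <| .forE (.var 5) <| .store 5 22 0 0 25 27 (.read 5 15 23 21 25 27)) <|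
    .seq (.forE (.var 3 - .var 15) <| .letE (.var 16 + .var 25) <| .letE (.var 22) <|
      .letE (.var 25) <| .letE (.lit 0) <| .letE (.var 22) <| .letE (.var 25 + .lit 1) <|
      .letE (.lit 0) <| .letE (.read 10 26 0 0 0 0) extendStmt) <|
    .letE (.var 3 - .var 15) <| .ite (.read 5 22 24 0 12 12)
      (.seq (.store 10 15 0 0 0 0 (.var 21)) (.store 11 15 0 0 0 0 (.var 23))) .skip

/-- Self-reduction. To test a candidate `v` for the position `j`, its entry in layer `j` of the
table is multiplied with the vectors of the vertices already fixed, and the top coefficient is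
inspected. Only blocks with first index `k + 1` are overwritten, so the table remains intact. -/
theorem tr_routeStmt (hL : Large Z n L k) {r i N T : ℕ} {m : Mem} {cid : ℕ → ℕ → ℕ} (hr : 0 < r)
    (hrZ : r < Z) (hR : Ready n L k cid m) (hW : WeightsOk n k r m) (hQ : TableOk n L k s r cid m)
    (hT : T ≤ L) (hU : m.arr 9 0 0 0 0 0 < n)
    (hne : m.arr 5 k T (m.arr 9 0 0 0 0 0) (2 ^ k - 1) (2 ^ k - 1) ≠ 0) :
    Tr w b Z routeStmt ((2 ^ k - 1) :: T :: r :: i :: N :: globals n L k s) m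
      ((k + 1) * (n * ((k + 1) * (2 ^ k * (2 ^ k * ((k + 1) * ((k + 1) * 1)))))))
      fun m' => Frame (fun a _ _ _ => a = 5 ∨ a = 7 ∨ a = 10 ∨ a = 11) m m' ∧
        Route n k s T (latest n cid) (fun i => m'.arr 10 i 0 0 0 0)
          (fun i => m'.arr 11 i 0 0 0 0) := by
  have hn := hL.n_lt
  have hnp := hL.pos
  have hLZ := hL.L_lt
  have hkZ := hL.k_lt
  have hpow := hL.pow_lt
  rw [pow_succ] at hpow
  have hp1 := Nat.one_le_two_pow (n := k)
  have : NeZero r := ⟨hr.ne'⟩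
  set τ := latest n cid with hτ
  set F : Fin 16 → ℕ → ℕ → ℕ → Prop :=
    fun a i₁ _ _ => a = 5 ∧ i₁ = k + 1 ∨ a = 7 ∨ a = 10 ∨ a = 11 with hF
  have hFP : ∀ a i₁ i₂ i₃, F a i₁ i₂ i₃ → a = 5 ∨ a = 7 ∨ a = 10 ∨ a = 11 := by
    intro a i₁ i₂ i₃ h
    simp only [hF] at h
    tauto
  have hRf : ∀ m', Frame F m m' → Ready n L k cid m' := fun m' h =>
    hR.frame h (by simp [hF]) (by simp [hF]) (by simp [hF])
  have hQf : ∀ m', Frame F m m' → TableOk n L k s r cid m' := fun m' h p hp t ht v hv A hA B hB => by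
    rw [h.2 _ _ _ _ _ _ (by simp [hF]; omega)]
    exact hQ p hp t ht v hv A hA B hB
  have hWf : ∀ m', Frame F m m' → WeightsOk n k r m' := fun m' h x hx A hA a ha => by
    rw [h.2 _ _ _ _ _ _ (by simp [hF]), hW x hx A hA a ha]
  have cast_ne : ∀ x : ℕ, x < r → ((x : ZMod r) ≠ 0 ↔ x ≠ 0) := by
    intro x hx
    rw [not_iff_not, ZMod.natCast_eq_zero_iff]
    exact ⟨fun h => Nat.eq_zero_of_dvd_of_lt h hx, fun h => h ▸ dvd_zero r⟩
  generalize hUU : m.arr 9 0 0 0 0 0 = U at hU hne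
  refine tr_seq (Q₁ := fun m' => m' = m.set 10 k 0 0 0 0 U)
    (tr_set k 0 0 0 0 U hUU (by omega) rfl) ?_
  rintro _ rfl
  refine tr_seq (Q₁ := fun m' => m' = (m.set 10 k 0 0 0 0 U).set 11 k 0 0 0 0 T)
    (tr_set k 0 0 0 0 T rfl (by omega) rfl) ?_
  rintro _ rfl
  refine tr_for k _ _ (fun j m' => Frame F m m' ∧ PartialRoute n k s T r τ (k - j)
    (fun i => m'.arr 10 i 0 0 0 0) (fun i => m'.arr 11 i 0 0 0 0)) rfl (Nat.le_succ k)
    (Nat.succ_pos k) (by positivity) (by omega)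
    ⟨((Frame.refl _ _).set (by simp [hF]) _ _ _).set (by simp [hF]) _ _ _, ?_⟩ ?_ ?_
  · refine ⟨fun i h1 h2 => ?_, by simp [Mem.set_arr], fun i h1 h2 => by omega, ?_⟩
    · obtain rfl : i = k := by omega
      simpa [Mem.set_arr] using hU
    · have h1 := hQ k le_rfl T hT U hU (2 ^ k - 1) (by omega) (2 ^ k - 1) (by omega)
      rw [table_eq] at h1
      simp only [Nat.sub_zero, Nat.sub_self, segment, List.nil_append, square, Mem.set_arr_self,
        Mem.set_arr_ne (show (10 : Fin 16) ≠ 11 by decide)]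
      rw [← h1.2]
      exact (cast_ne _ h1.1).2 hne
  swap
  · rintro m' ⟨h1, h2⟩
    rw [Nat.sub_self] at h2
    exact ⟨h1.mono hFP, h2.route⟩
  rintro jj hjj m₁ ⟨hfr₁, h₁⟩
  obtain ⟨j, hj⟩ : ∃ j, k - jj = j + 1 := ⟨k - jj - 1, by omega⟩
  have hjk : j < k := by omega
  rw [hj] at h₁
  rw [show k - (jj + 1) = j by omega]
  set V : ℕ → ℕ := fun i => m₁.arr 10 i 0 0 0 0 with hV
  set D : ℕ → ℕ := fun i => m₁.arr 11 i 0 0 0 0 with hD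
  have hDT : ∀ d i, j + 1 ≤ i → i + d = k → D i ≤ L := by
    intro d
    induction d with
    | zero =>
      intro i _ hi
      rw [show i = k by omega, h₁.last]
      exact hT
    | succ d ih =>
      intro i h1 hi
      rw [h₁.chain i h1 (by omega)]
      exact (latest_le _ _ _).trans (ih (i + 1) (by omega) (by omega))
  have hVn : V (j + 1) < n := h₁.lt (j + 1) le_rfl hjk
  have hDL : D (j + 1) ≤ L := hDT (k - (j + 1)) (j + 1) le_rfl (by omega)
  refine tr_let j (show k - jj - 1 = j by omega) (by omega) ?_
  refine tr_let (j + 1) rfl (by omega) ?_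
  refine tr_let (V (j + 1)) rfl (by omega) ?_
  refine tr_let (D (j + 1)) rfl (by omega) ?_
  refine tr_letRead (m₁.arr 2 (D (j + 1)) (V (j + 1)) 0 0 0) rfl fun hcz => ?_
  set c := m₁.arr 2 (D (j + 1)) (V (j + 1)) 0 0 0 with hc
  have hlat : ∀ m', Frame F m m' → ∀ v < n, m'.arr 3 (D (j + 1)) v c 0 0 =
      τ v (V (j + 1)) (D (j + 1)) := fun m' h v hv => by
    have := (hRf m' h).latest (D (j + 1)) hDL v hv (V (j + 1)) hVn
    rwa [h.2 2 _ _ _ _ _ (by simp [hF]), ← hfr₁.2 2 _ _ _ _ _ (by simp [hF]), ← hc] at this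
  -- Every successful candidate overwrites the previous one, so the last one wins; the invariant
  -- only says that some admissible vertex is stored once one has been met.
  refine tr_for n _ _ (fun x m' => Frame F m m' ∧ (∀ i, j < i → m'.arr 10 i 0 0 0 0 = V i) ∧
    (∀ i, j < i → m'.arr 11 i 0 0 0 0 = D i) ∧ ((∃ v < x, IsNext n k s r τ j V D v) →
      m'.arr 10 j 0 0 0 0 < n ∧ IsNext n k s r τ j V D (m'.arr 10 j 0 0 0 0) ∧
      m'.arr 11 j 0 0 0 0 = τ (m'.arr 10 j 0 0 0 0) (V (j + 1)) (D (j + 1)))) rfl le_rfl hnp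
    (by positivity) hn ⟨hfr₁, fun _ _ => rfl, fun _ _ => rfl, by simp⟩ ?_ ?_
  swap
  · rintro m' ⟨h1, h2, h3, h4⟩
    obtain ⟨h5, h6, h7⟩ := h4 (h₁.exists_isNext hjk)
    exact ⟨h1, h₁.cons hjk (fun i hi _ => h2 i hi) (fun i hi _ => h3 i hi) h5 h6 h7⟩
  rintro v hv m₂ ⟨hfr₂, hV₂, hD₂, hx₂⟩
  have hτL : τ v (V (j + 1)) (D (j + 1)) ≤ L := (latest_le _ _ _).trans hDL
  set tv := τ v (V (j + 1)) (D (j + 1)) with htv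
  refine tr_let (k + 1) rfl (by omega) ?_
  refine tr_let tv (hlat m₂ hfr₂ v hv) (by omega) ?_
  set G : Fin 16 → ℕ → ℕ → ℕ → Prop := fun a i₁ _ _ => a = 5 ∧ i₁ = k + 1 ∨ a = 7 with hG
  have hGF : ∀ a i₁ i₂ i₃, G a i₁ i₂ i₃ → F a i₁ i₂ i₃ := by
    intro a i₁ i₂ i₃ h
    simp only [hG] at h
    simp only [hF]
    tauto
  set E := table n s k τ j v tv with hE
  refine tr_seq (Q₁ := fun m' => Frame G m₂ m' ∧ Represents k r m' (k + 1) 0 0 E) ?_ ?_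
  · set good : Mem → ℕ → ℕ → Prop := fun m' A B => m'.arr 5 (k + 1) 0 0 A B < r ∧
      (m'.arr 5 (k + 1) 0 0 A B : ZMod r) = (E A B : ℤ) with hgood
    refine (tr_for (2 ^ k) (2 ^ k) (2 ^ k * 1) (fun j m' => Frame G m₂ m' ∧ ∀ A < j, ∀ B < 2 ^ k,
      good m' A B) rfl le_rfl hp1 (by positivity) (by omega) ⟨Frame.refl _ _, by simp⟩ ?_
      fun m' h => h).mono (le_of_eq_mul (c := (k + 1) * (k + 1) * (k + 1)) (by ring) (by positivity))
      (Nat.succ_le_of_lt (by positivity)) fun _ h => h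
    rintro A hA m₄ ⟨hfr₄, h₄⟩
    refine tr_for (2 ^ k) _ _ (fun j m' => Frame G m₂ m' ∧ ∀ A' B, (A' < A ∧ B < 2 ^ k ∨
      A' = A ∧ B < j) → good m' A' B) rfl le_rfl hp1 one_pos (by omega)
      ⟨hfr₄, fun A' B h => h₄ A' (by omega) B (by omega)⟩ ?_
      fun m' h => ⟨h.1, fun A' hA' B hB => h.2 A' B (by omega)⟩
    rintro B hB m₅ ⟨hfr₅, h₅⟩
    have hq := hQf m₅ (hfr₂.trans (hfr₅.mono hGF)) j hjk.le tv hτL v hv A hA B hB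
    refine tr_set (k + 1) 0 0 A B (m₅.arr 5 j tv v A B) rfl (hq.1.trans hrZ)
      ⟨hfr₅.set (by simp [hG]) _ _ _, fun A' B' h => ?_⟩
    by_cases hc : A' = A ∧ B' = B
    · obtain ⟨rfl, rfl⟩ := hc
      simp only [hgood, Mem.set_arr_self]
      exact hq
    · simp only [hgood]
      rw [Mem.set_arr, if_neg (by tauto)]
      exact h₅ A' B' (by omega)
  rintro m₃ ⟨hfr₃, h₃⟩
  refine tr_seq (Q₁ := fun m' => Frame G m₂ m' ∧
    Represents k r m' (k + 1) (k - j) 0 ((segment V j (k - j)).foldr (extend k) E)) ?_ ?_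
  · refine tr_for (k - j) _ _ (fun d m' => Frame G m₂ m' ∧
      Represents k r m' (k + 1) d 0 ((segment V j d).foldr (extend k) E)) rfl
      (show k - j ≤ k + 1 by omega) (Nat.succ_pos k) (by positivity) (by omega) ⟨hfr₃, h₃⟩ ?_ fun _ h => h
    rintro d hd m₄ ⟨hfr₄, h₄⟩
    have hZ1 : 0 < Z := by omega
    have hxn : V (j + d + 1) < n := h₁.lt _ (by omega) (by omega)
    have hF₄ : Frame F m m₄ := hfr₂.trans (hfr₄.mono hGF)
    refine tr_let (j + 1 + d) rfl (by omega) <| tr_let (k + 1) rfl (by omega) <|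
      tr_let d rfl (by omega) <| tr_let 0 rfl hZ1 <| tr_let (k + 1) rfl (by omega) <|
      tr_let (d + 1) rfl (by omega) <| tr_let 0 rfl hZ1 <| tr_let (V (j + d + 1)) ?_ (by omega) ?_
    · change m₄.arr 10 (j + 1 + d) 0 0 0 0 = _
      rw [hfr₄.2 _ _ _ _ _ _ (by simp [hG]), hV₂ _ (by omega)]
      congr 1
      omega
    refine (tr_extendStmt hL hr hrZ hxn (hWf _ hF₄) (hRf _ hF₄).powers h₄ (by omega)).conseq ?_
    rintro m₅ ⟨hfr₅, h₅⟩
    refine ⟨hfr₄.trans (hfr₅.mono fun a i₁ i₂ i₃ h => ?_), h₅⟩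
    simp only [hG]
    tauto
  rintro m₄ ⟨hfr₄, h₄⟩
  have hres := h₄ (2 ^ k - 1) (by omega) (2 ^ k - 1) (by omega)
  rw [hE, foldr_extend_table] at hres
  refine tr_let (k - j) rfl (by omega) ?_
  have hF₄ : Frame F m m₄ := hfr₂.trans (hfr₄.mono hGF)
  have hV₄ : ∀ i, m₄.arr 10 i 0 0 0 0 = m₂.arr 10 i 0 0 0 0 := fun i =>
    hfr₄.2 _ _ _ _ _ _ (by simp [hG])
  have hD₄ : ∀ i, m₄.arr 11 i 0 0 0 0 = m₂.arr 11 i 0 0 0 0 := fun i =>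
    hfr₄.2 _ _ _ _ _ _ (by simp [hG])
  refine tr_if (fun hif => ?_) fun hif => tr_skip ⟨hF₄, fun i hi => by rw [hV₄, hV₂ i hi],
    fun i hi => by rw [hD₄, hD₂ i hi], ?_⟩
  · change m₄.arr 5 (k + 1) (k - j) 0 (2 ^ k - 1) (2 ^ k - 1) ≠ 0 at hif
    rw [← cast_ne _ hres.1, hres.2] at hif
    refine tr_seq (tr_set j 0 0 0 0 v rfl (by omega) rfl) ?_
    rintro _ rfl
    refine tr_set j 0 0 0 0 tv rfl (by omega) ⟨(hF₄.set (by simp [hF]) _ _ _).set (by simp [hF]) _ _ _,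
      fun i hi => ?_, fun i hi => ?_, fun _ => ?_⟩
    · simp [Mem.set_arr, hi.ne', hV₄, hV₂ i hi]
    · simp [Mem.set_arr, hi.ne', hD₄, hD₂ i hi]
    · simp only [Mem.set_arr, and_self, and_true, if_true, show (10 : Fin 16) ≠ 11 by decide, if_false]
      exact ⟨hv, hif, htv⟩
  · change m₄.arr 5 (k + 1) (k - j) 0 (2 ^ k - 1) (2 ^ k - 1) = 0 at hif
    rintro ⟨v', hv', hn'⟩
    rw [hV₄, hD₄]
    refine hx₂ ⟨v', ?_, hn'⟩
    rcases Nat.lt_succ_iff_lt_or_eq.1 hv' with h | rfl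
    · exact h
    · refine absurd ?_ hn'
      have := hres.2
      rw [hif, Nat.cast_zero] at this
      exact this.symm

end

section

variable {w b Z n L k s : ℕ}

/-! ### From a feasible sequence of vertices to a walk -/

/-- The state of the backward construction of a walk through the vertices `V 0, …, V k`: one has to
be at `y` at time `t`, the vertices `V 0, …, V (c - 1)` are still to be visited, and `Y` lists the
vertices at the times after `t`. -/
structure Backward (n s k T : ℕ) (cid : ℕ → ℕ → ℕ) (V D : ℕ → ℕ) (t y c : ℕ) (Y : ℕ → ℕ) : Prop where
  y_lt : y < n
  c_le : c ≤ k
  start : c = 0 → y = s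
  departs : ∀ j, c = j + 1 → latest n cid (V j) y t = D j
  visits : ∀ i, c ≤ i → i ≤ k →
    cid t (V i) = cid t y ∨ ∃ t', t < t' ∧ t' ≤ T ∧ cid t' (V i) = cid t' (Y t')
  lt : ∀ t', t < t' → t' ≤ T → Y t' < n
  next : ∀ t', t < t' → t' < T → ∃ v < n, cid t' v = cid t' (Y t') ∧
    cid (t' + 1) v = cid (t' + 1) (Y (t' + 1))
  link : t < T → ∃ v < n, cid t v = cid t y ∧ cid (t + 1) v = cid (t + 1) (Y (t + 1))

/-- All vertices that need not be visited any more are visited after time `t`. -/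
def IsClear (k T : ℕ) (cid : ℕ → ℕ → ℕ) (V : ℕ → ℕ) (t y c : ℕ) (Y : ℕ → ℕ) : Prop :=
  t < T → cid (t + 1) y = cid (t + 1) (Y (t + 1)) ∧
    ∀ i, c ≤ i → i ≤ k → ∃ t', t < t' ∧ t' ≤ T ∧ cid t' (V i) = cid t' (Y t')

section

variable {T t y c : ℕ} {cid : ℕ → ℕ → ℕ} {V D Y : ℕ → ℕ}

theorem Route.pos_of_le (h : Route n k s T (latest n cid) V D) {i : ℕ} (hi : i ≤ k) : 1 ≤ D i := by
  induction i with
  | zero => exact h.pos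
  | succ i ih =>
    refine (ih (by omega)).trans ?_
    rw [h.chain i hi]
    exact latest_le _ _ _

theorem Route.backward (h : Route n k s T (latest n cid) V D) : Backward n s k T cid V D T (V k) k Y := by
  refine ⟨h.lt k le_rfl, le_rfl, ?_, ?_, ?_, by omega, by omega, by omega⟩
  · rintro rfl
    exact h.start
  · rintro j rfl
    rw [h.chain j (by omega), h.last]
  · intro i h1 h2
    obtain rfl : i = k := by omega
    exact .inl rfl

/-- A latest departure equal to the current time means that `V c` and `y` share a component. The
visit to `V c` then happens in this very component, and the next target becomes `V (c - 1)`, if any.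
-/
theorem Backward.jump (h : Route n k s T (latest n cid) V D)
    (hb : Backward n s k T cid V D t y (c + 1) Y) (ht : 1 ≤ t) (hl : latest n cid (V c) y t = t) :
    Backward n s k T cid V D t (V c) c Y := by
  have hck := hb.c_le
  have hc := cid_eq_of_latest_eq ht hl
  refine ⟨h.lt c (by omega), by omega, ?_, ?_, fun i h1 h2 => ?_, hb.lt, hb.next, ?_⟩
  · rintro rfl
    exact h.start
  · rintro j rfl
    rw [h.chain j (by omega), ← hb.departs _ rfl, hl]
  · rcases h1.eq_or_lt with rfl | h1
    · exact .inl rfl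
    · rw [← hc]
      exact hb.visits i h1 h2
  · rw [← hc]
    exact hb.link

/-- The component of `y` is recorded for time `t + 1`; `y'` lies in it, so it witnesses that the
recorded component meets the one used at time `t`. -/
theorem Backward.step (hb : Backward n s k T cid V D (t + 1) y c Y) (htT : t < T) {y' : ℕ} (hy : y' < n)
    (h0 : c = 0 → y' = s) (h1 : ∀ j, c = j + 1 → latest n cid (V j) y' t = D j)
    (h2 : cid (t + 1) y' = cid (t + 1) y) :
    Backward n s k T cid V D t y' c (Function.update Y (t + 1) y) ∧
      IsClear k T cid V t y' c (Function.update Y (t + 1) y) := by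
  have hne : ∀ t', t + 1 < t' → Function.update Y (t + 1) y t' = Y t' := fun t' h =>
    Function.update_of_ne (by omega) _ _
  have hv : ∀ i, c ≤ i → i ≤ k → ∃ t', t < t' ∧ t' ≤ T ∧
      cid t' (V i) = cid t' (Function.update Y (t + 1) y t') := by
    intro i hi hik
    rcases hb.visits i hi hik with h | ⟨t', h3, h4, h5⟩
    · exact ⟨t + 1, by omega, by omega, by rw [Function.update_self, h]⟩
    · exact ⟨t', by omega, h4, by rw [hne t' h3, h5]⟩
  refine ⟨⟨hy, hb.c_le, h0, h1, fun i hi hik => .inr (hv i hi hik), fun t' h3 h4 => ?_,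
    fun t' h3 h4 => ?_, fun _ => ⟨y', hy, rfl, by rw [h2, Function.update_self]⟩⟩,
    fun _ => ⟨by rw [h2, Function.update_self], hv⟩⟩
  · rcases Nat.lt_or_ge (t + 1) t' with h | h
    · rw [hne t' h]
      exact hb.lt t' h h4
    · obtain rfl : t' = t + 1 := by omega
      rw [Function.update_self]
      exact hb.y_lt
  · rw [hne (t' + 1) (by omega)]
    rcases Nat.lt_or_ge (t + 1) t' with h | h
    · rw [hne t' h]
      exact hb.next t' h h4
    · obtain rfl : t' = t + 1 := by omega
      rw [Function.update_self]
      exact hb.link h4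

end

/-- At time `0` nothing can be left to visit: departure times are at least `1`, whereas latest
departures for time `0` are `0`. Hence the construction has arrived at `s`. -/
theorem Backward.isPath {I : Instance} {R : Listing I} {T y c : ℕ} {V D Y : ℕ → ℕ}
    (h : Route I.n I.k I.s T (latest I.n R.compIndex) V D) (hT : 1 ≤ T) (hTL : T ≤ I.L)
    (hb : Backward I.n I.s I.k T R.compIndex V D 0 y c Y) (hc : IsClear I.k T R.compIndex V 0 y c Y) :
    IsPath R (segment V 0 I.k) T Y := by
  obtain ⟨h1, h2⟩ := hc hT
  have hc0 : c = 0 := by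
    by_contra hc0
    obtain ⟨j, rfl⟩ : ∃ j, c = j + 1 := ⟨c - 1, by omega⟩
    have h3 := hb.departs j rfl
    have h4 := latest_le (n := I.n) (cid := R.compIndex) (V j) y 0
    have h5 := h.pos_of_le (i := j) (by have := hb.c_le; omega)
    omega
  refine ⟨hT, hTL, hb.lt, ?_, hb.next, fun x hx => ?_⟩
  · rw [← hb.start hc0]
    exact h1
  · obtain ⟨i, h3, h4, rfl⟩ := mem_segment.1 hx
    exact h2 i (by omega) (by omega)

/-- Constructing a walk, backwards. -/
def walkStmt : Stmt :=
  .seq (.store 12 0 0 0 0 0 (.read 10 3 0 0 0 0)) <| .seq (.store 13 0 0 0 0 0 (.var 3)) <|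
  .seq (.forE (.var 11) <| .letE (.var 11 - .var 14) <|
    .seq (.forE (.var 3) <| .letE (.read 13 0 0 0 0 0) <| .ite (.var 18)
      (.letE (.var 18 - .lit 1) <| .letE (.read 10 19 0 0 0 0) <| .letE (.read 12 0 0 0 0 0) <|
        .letE (.read 2 15 21 0 0 0) <| .letE (.read 3 15 20 22 0 0) <|
        .ite (.bin .eq (.var 23) (.var 15))
          (.seq (.store 12 0 0 0 0 0 (.var 20)) (.store 13 0 0 0 0 0 (.var 19))) .skip) .skip) <|
    .letE (.read 12 0 0 0 0 0) <| .letE (.read 2 15 16 0 0 0) <| .seq (.out (.var 15) (.var 17)) <|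
    .letE (.read 13 0 0 0 0 0) <| .ite (.var 18)
      (.letE (.var 18 - .lit 1) <| .letE (.read 10 19 0 0 0 0) <| .letE (.read 3 15 20 17 0 0) <|
        .letE (.var 15 - .lit 1) <| .forE (.var 1) <| .letE (.read 2 15 24 0 0 0) <|
        .letE (.read 2 22 24 0 0 0) <|
        .ite (.bin .eq (.var 25) (.var 17) * .bin .eq (.read 3 22 20 26 0 0) (.var 21))
          (.store 12 0 0 0 0 0 (.var 24)) .skip) .skip) <|
  .out (.lit 0) (.var 11)

/-- The low memory holds a walk of length `T`. -/
def HoldsWalk (T : ℕ) (cid : ℕ → ℕ → ℕ) (Y : ℕ → ℕ) (m : Mem) : Prop :=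
  m.low 0 = T ∧ ∀ t, 1 ≤ t → t ≤ T → m.low t = cid t (Y t)

/-- The memories differ only in places that satisfy `P`, except for the low part. -/
def ArrFrame (P : Fin 16 → Prop) (m m' : Mem) : Prop :=
  ∀ a i₁ i₂ i₃ i₄ i₅, ¬ P a → m'.arr a i₁ i₂ i₃ i₄ i₅ = m.arr a i₁ i₂ i₃ i₄ i₅

/-- At each time, from `T` down to `1`, all possible jumps inside the current component are made,
the component is written down, and one step back is taken along a vertex that keeps the latest
departure time of the current target. -/
theorem tr_walkStmt (hL : Large Z n L k) {km r i N T : ℕ} {m : Mem} {cid : ℕ → ℕ → ℕ}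
    (hR : Ready n L k cid m) (hLb : L < b) (hT1 : 1 ≤ T) (hT : T ≤ L)
    (hV : Route n k s T (latest n cid) (fun i => m.arr 10 i 0 0 0 0) (fun i => m.arr 11 i 0 0 0 0)) :
    Tr w b Z walkStmt (km :: T :: r :: i :: N :: globals n L k s) m (L * ((k + 1) * (n * 1)))
      fun m' => ArrFrame (fun a => a = 12 ∨ a = 13) m m' ∧ ∃ Y y c, HoldsWalk T cid Y m' ∧
        Backward n s k T cid (fun i => m.arr 10 i 0 0 0 0) (fun i => m.arr 11 i 0 0 0 0) 0 y c Y ∧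
        IsClear k T cid (fun i => m.arr 10 i 0 0 0 0) 0 y c Y := by
  have hn := hL.n_lt
  have hnp := hL.pos
  have hLZ := hL.L_lt
  have hkZ := hL.k_lt
  set F : Fin 16 → Prop := fun a => a = 12 ∨ a = 13 with hF
  set V : ℕ → ℕ := fun i => m.arr 10 i 0 0 0 0 with hVdef
  set D : ℕ → ℕ := fun i => m.arr 11 i 0 0 0 0 with hDdef
  have hset : ∀ m' (a : Fin 16) v, F a → ArrFrame F m m' → ArrFrame F m (m'.set a 0 0 0 0 0 v) := by
    intro m' a v ha h a' i₁ i₂ i₃ i₄ i₅ hn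
    rw [Mem.set_arr_ne (by rintro rfl; exact hn ha), h _ _ _ _ _ _ hn]
  have hVr : ∀ m', ArrFrame F m m' → ∀ i, m'.arr 10 i 0 0 0 0 = V i := fun m' h i =>
    h _ _ _ _ _ _ (by simp [hF])
  have hcr : ∀ m', ArrFrame F m m' → ∀ t, 1 ≤ t → t ≤ L → ∀ v < n, m'.arr 2 t v 0 0 0 = cid t v :=
    fun m' h t h1 h2 v hv => by rw [h _ _ _ _ _ _ (by simp [hF]), hR.comps t h1 h2 v hv]
  have hlr : ∀ m', ArrFrame F m m' → ∀ t ≤ L, ∀ v < n, ∀ u < n,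
      m'.arr 3 t v (m'.arr 2 t u 0 0 0) 0 0 = latest n cid v u t := fun m' h t ht v hv u hu => by
    rw [h _ _ _ _ _ _ (by simp [hF]), h _ _ _ _ _ _ (by simp [hF]), hR.latest t ht v hv u hu]
  refine tr_seq (Q₁ := fun m' => m' = m.set 12 0 0 0 0 0 (V k))
    (tr_set 0 0 0 0 0 (V k) rfl ((hV.lt k le_rfl).trans hn) rfl) ?_
  rintro _ rfl
  refine tr_seq (Q₁ := fun m' => m' = (m.set 12 0 0 0 0 0 (V k)).set 13 0 0 0 0 0 k)
    (tr_set 0 0 0 0 0 k rfl (by omega) rfl) ?_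
  rintro _ rfl
  refine tr_seq (Q₁ := fun m' => ArrFrame F m m' ∧ ∃ Y y c,
    (∀ t, 0 < t → t ≤ T → m'.low t = cid t (Y t)) ∧ Backward n s k T cid V D 0 y c Y ∧
      IsClear k T cid V 0 y c Y) ?_ ?_
  swap
  · rintro m' ⟨h1, Y, y, c, h2, h3, h4⟩
    refine tr_out (x := 0) trivial trivial rfl (by omega) rfl (show T < Z by omega)
      ⟨h1, Y, y, c, ⟨rfl, fun t ht1 ht2 => ?_⟩, h3, h4⟩
    rw [← h2 t ht1 ht2]
    exact Function.update_of_ne (by omega) _ _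
  refine tr_for T _ _ (fun j m' => ArrFrame F m m' ∧ ∃ Y,
    (∀ t, T - j < t → t ≤ T → m'.low t = cid t (Y t)) ∧
    Backward n s k T cid V D (T - j) (m'.arr 12 0 0 0 0 0) (m'.arr 13 0 0 0 0 0) Y ∧
      IsClear k T cid V (T - j) (m'.arr 12 0 0 0 0 0) (m'.arr 13 0 0 0 0 0) Y) rfl hT
    (hT1.trans hT) (by positivity) (by omega)
    ⟨hset _ _ _ (.inr rfl) (hset _ _ _ (.inl rfl) fun _ _ _ _ _ _ _ => rfl), fun _ => 0, by omega,
      ?_, by simp [IsClear]⟩ ?_ ?_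
  · simpa [Mem.set_arr] using hV.backward
  swap
  · rintro m' ⟨h1, Y, h2, h3, h4⟩
    rw [Nat.sub_self] at h2 h3 h4
    exact ⟨h1, Y, _, _, h2, h3, h4⟩
  rintro j hj m₁ ⟨hfr₁, Y, hlow₁, hb₁, -⟩
  obtain ⟨t, ht⟩ : ∃ t, T - j = t + 1 := ⟨T - j - 1, by omega⟩
  rw [ht] at hlow₁ hb₁
  rw [show T - (j + 1) = t by omega]
  refine tr_let (t + 1) ht (by omega) ?_
  refine tr_seq (Q₁ := fun m' => ArrFrame F m m' ∧
    (∀ t', t + 1 < t' → t' ≤ T → m'.low t' = cid t' (Y t')) ∧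
    Backward n s k T cid V D (t + 1) (m'.arr 12 0 0 0 0 0) (m'.arr 13 0 0 0 0 0) Y ∧
    ∀ c, m'.arr 13 0 0 0 0 0 = c + 1 → latest n cid (V c) (m'.arr 12 0 0 0 0 0) (t + 1) ≠ t + 1) ?_ ?_
  · refine (tr_for k (k + 1) 1 (fun i m' => ArrFrame F m m' ∧
      (∀ t', t + 1 < t' → t' ≤ T → m'.low t' = cid t' (Y t')) ∧
      Backward n s k T cid V D (t + 1) (m'.arr 12 0 0 0 0 0) (m'.arr 13 0 0 0 0 0) Y ∧
      ∀ c, m'.arr 13 0 0 0 0 0 = c + 1 →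
        latest n cid (V c) (m'.arr 12 0 0 0 0 0) (t + 1) ≠ t + 1 ∨ c + 1 ≤ k - i) rfl (Nat.le_succ k)
      (Nat.succ_pos k) one_pos (by omega)
      ⟨hfr₁, hlow₁, hb₁, fun c hc => .inr (by have := hb₁.c_le; omega)⟩ ?_ ?_).mono
      (le_of_eq_mul (c := n) (by ring) hnp) (Nat.succ_pos _) fun _ h => h
    swap
    · rintro m' ⟨h1, h2, h3, h4⟩
      refine ⟨h1, h2, h3, fun c hc => (h4 c hc).resolve_right (by omega)⟩
    rintro i hi m₂ ⟨hfr₂, hlow₂, hb₂, hc₂⟩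
    refine tr_letRead (m₂.arr 13 0 0 0 0 0) rfl fun hcz => ?_
    refine tr_if (fun hif => ?_) fun hif => tr_skip ⟨hfr₂, hlow₂, hb₂, fun c hc => ?_⟩
    swap
    · change m₂.arr 13 0 0 0 0 0 = 0 at hif
      omega
    obtain ⟨c, hc⟩ : ∃ c, m₂.arr 13 0 0 0 0 0 = c + 1 := Nat.exists_eq_succ_of_ne_zero hif
    rw [hc] at hb₂ hcz ⊢
    have hck := hb₂.c_le
    have hVn : V c < n := hV.lt c (by omega)
    refine tr_let c rfl (by omega) ?_
    refine tr_let (V c) (hVr _ hfr₂ c) (by omega) ?_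
    have hyn := hb₂.y_lt
    refine tr_let (m₂.arr 12 0 0 0 0 0) rfl (by omega) ?_
    refine tr_letRead (m₂.arr 2 (t + 1) (m₂.arr 12 0 0 0 0 0) 0 0 0) rfl fun _ => ?_
    refine tr_letRead (latest n cid (V c) (m₂.arr 12 0 0 0 0 0) (t + 1))
      (hlr _ hfr₂ (t + 1) (by omega) (V c) hVn _ hyn) fun _ => ?_
    refine tr_if (fun hif => ?_) fun hif => tr_skip ⟨hfr₂, hlow₂, by rwa [hc], fun c' hc' => ?_⟩
    · have hif : latest n cid (V c) (m₂.arr 12 0 0 0 0 0) (t + 1) = t + 1 := by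
        by_contra h
        exact hif (if_neg h)
      refine tr_seq (tr_set 0 0 0 0 0 (V c) rfl (by omega) rfl) ?_
      rintro _ rfl
      refine tr_set 0 0 0 0 0 c rfl (by omega) ⟨hset _ _ _ (.inr rfl) (hset _ _ _ (.inl rfl) hfr₂),
        hlow₂, ?_, fun c' hc' => ?_⟩
      · simpa [Mem.set_arr] using hb₂.jump hV (Nat.succ_pos t) hif
      · simp only [Mem.set_arr_self] at hc'
        have := (hc₂ c hc).resolve_left (not_not.2 hif)
        exact .inr (by omega)
    · obtain rfl : c = c' := by omega
      refine .inl fun h => ?_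
      have hif : (if latest n cid (V c) (m₂.arr 12 0 0 0 0 0) (t + 1) = t + 1 then 1 else 0) = 0 := hif
      simp [h] at hif
  rintro m₂ ⟨hfr₂, hlow₂, hb₂, hc₂⟩
  have hyn := hb₂.y_lt
  generalize hy : m₂.arr 12 0 0 0 0 0 = y at hb₂ hc₂ hyn
  generalize hc : m₂.arr 13 0 0 0 0 0 = c at hb₂ hc₂
  have hck := hb₂.c_le
  refine tr_let y hy (by omega) ?_
  refine tr_letRead (cid (t + 1) y) (hcr _ hfr₂ (t + 1) (by omega) (by omega) y hyn) fun hcz => ?_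
  refine tr_seq (Q₁ := fun m' => m' = m₂.setLow (t + 1) (cid (t + 1) y))
    (tr_out (x := t + 1) trivial trivial rfl (by omega) rfl hcz rfl) ?_
  rintro _ rfl
  have hlow : ∀ t', t < t' → t' ≤ T → (m₂.setLow (t + 1) (cid (t + 1) y)).low t' =
      cid t' (Function.update Y (t + 1) y t') := by
    intro t' h1 h2
    rcases Nat.lt_or_ge (t + 1) t' with h | h
    · rw [Function.update_of_ne (by omega), ← hlow₂ t' h h2]
      exact Function.update_of_ne (by omega) _ _
    · obtain rfl : t' = t + 1 := by omega
      rw [Function.update_self]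
      exact Function.update_self _ _ _
  refine tr_let c hc (by omega) ?_
  have h12 : (m₂.setLow (t + 1) (cid (t + 1) y)).arr 12 0 0 0 0 0 = y := hy
  have h13 : (m₂.setLow (t + 1) (cid (t + 1) y)).arr 13 0 0 0 0 0 = c := hc
  have hfr : ArrFrame F m (m₂.setLow (t + 1) (cid (t + 1) y)) := hfr₂
  generalize m₂.setLow (t + 1) (cid (t + 1) y) = m₃ at hlow h12 h13 hfr
  refine tr_if (fun hif => ?_) fun hif => tr_skip ⟨hfr, Function.update Y (t + 1) y, hlow, ?_⟩
  -- When nothing is left to visit, the current vertex is `s`, and one simply stays there.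
  swap
  · change c = 0 at hif
    subst hif
    rw [h12, h13]
    exact hb₂.step (by omega) hyn hb₂.start (by omega) rfl
  obtain ⟨c, rfl⟩ : ∃ c', c = c' + 1 := Nat.exists_eq_succ_of_ne_zero hif
  have hVn : V c < n := hV.lt c (by omega)
  have hdep := hb₂.departs c rfl
  have hpos := hV.pos_of_le (i := c) (by omega)
  -- No jump being possible, the latest departure is not the current time, and it is positive; so a
  -- vertex for the step back exists and the search below finds one.
  have hex := exists_latest_eq (hc₂ c rfl) (by rw [hdep]; omega)
  rw [hdep] at hex
  have htpos : 1 ≤ t := by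
    obtain ⟨v, -, -, hv⟩ := hex
    have := latest_le (n := n) (cid := cid) (V c) v t
    omega
  refine tr_let c rfl (by omega) ?_
  refine tr_let (V c) (hVr _ hfr c) (by omega) ?_
  have hDr : m₃.arr 3 (t + 1) (V c) (cid (t + 1) y) 0 0 = D c := by
    rw [← hcr _ hfr (t + 1) (by omega) (by omega) y hyn, hlr _ hfr (t + 1) (by omega) _ hVn _ hyn, hdep]
  refine tr_letRead (D c) hDr fun _ => ?_
  refine tr_let t rfl (by omega) ?_
  refine (tr_for n n 1 (fun x m' => ArrFrame F m m' ∧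
    (∀ t', t < t' → t' ≤ T → m'.low t' = cid t' (Function.update Y (t + 1) y t')) ∧
    m'.arr 13 0 0 0 0 0 = c + 1 ∧ ((∃ v < x, cid (t + 1) v = cid (t + 1) y ∧
      latest n cid (V c) v t = D c) → m'.arr 12 0 0 0 0 0 < n ∧
      cid (t + 1) (m'.arr 12 0 0 0 0 0) = cid (t + 1) y ∧
      latest n cid (V c) (m'.arr 12 0 0 0 0 0) t = D c)) rfl le_rfl hnp one_pos hn
    ⟨hfr, hlow, h13, by simp⟩ ?_ ?_).mono (le_of_eq_mul (c := k + 1) (by ring) (Nat.succ_pos k))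
    (Nat.mul_pos hnp one_pos) fun _ h => h
  swap
  · rintro m' ⟨h1, h2, h3, h4⟩
    obtain ⟨h5, h6, h7⟩ := h4 hex
    refine ⟨h1, _, h2, ?_⟩
    rw [h3]
    refine hb₂.step (by omega) h5 (by omega) (fun j hj => ?_) h6
    obtain rfl : c = j := by omega
    exact h7
  rintro x hx m₄ ⟨hfr₄, hlow₄, h13₄, h₄⟩
  refine tr_letRead (cid (t + 1) x) (hcr _ hfr₄ (t + 1) (by omega) (by omega) x hx) fun _ => ?_
  refine tr_letRead (m₄.arr 2 t x 0 0 0) rfl fun _ => ?_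
  have hval : ∀ (a₁ a₂ b₁ b₂ : ℕ), (if a₁ = a₂ then 1 else 0) * (if b₁ = b₂ then 1 else 0) ≠ 0 ↔
      a₁ = a₂ ∧ b₁ = b₂ := fun a₁ a₂ b₁ b₂ => by
    split_ifs <;> simp_all
  have hlx := hlr _ hfr₄ t (by omega) (V c) hVn x hx
  refine tr_if (fun hif => ?_) fun hif => tr_skip ⟨hfr₄, hlow₄, h13₄, ?_⟩
  · obtain ⟨h1, h2⟩ := (hval (cid (t + 1) x) (cid (t + 1) y)
      (m₄.arr 3 t (V c) (m₄.arr 2 t x 0 0 0) 0 0) (D c)).1 hif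
    refine tr_set 0 0 0 0 0 x rfl (by omega) ⟨hset _ _ _ (.inl rfl) hfr₄, hlow₄,
      by simpa [Mem.set_arr] using h13₄, fun _ => ?_⟩
    rw [Mem.set_arr_self, ← hlx]
    exact ⟨hx, h1, h2⟩
  · rintro ⟨v, hv, h1, h2⟩
    refine h₄ ⟨v, ?_, h1, h2⟩
    rcases Nat.lt_succ_iff_lt_or_eq.1 hv with h | rfl
    · exact h
    · refine absurd hif ((hval _ _ _ _).2 ⟨h1, ?_⟩)
      exact hlx.trans h2

end

/-! ### The moduli combined: correctness and optimality of the whole algorithm. -/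

section

variable {w b Z : ℕ}

/-! ### A nonzero entry is found -/

/-- The sum of the squares of the determinants of the feasible sequences that lead to `u` at time `t`. -/
def total (n k s : ℕ) (cid : ℕ → ℕ → ℕ) (t u : ℕ) : ℤ :=
  table n s k (latest n cid) k u t (2 ^ k - 1) (2 ^ k - 1)

theorem total_eq (n k s : ℕ) (cid : ℕ → ℕ → ℕ) (t u : ℕ) :
    total n k s cid t u = sumFeasible n s (latest n cid) k u t (square k) :=
  table_eq _ _ _ _ _

theorem total_nonneg (n k s : ℕ) (cid : ℕ → ℕ → ℕ) (t u : ℕ) : 0 ≤ total n k s cid t u := by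
  rw [total_eq]
  exact sumFeasible_nonneg (fun l => mul_self_nonneg _) _ _ _

theorem total_pos {n k s t u : ℕ} {cid : ℕ → ℕ → ℕ} {l : List ℕ} (hl : l.Nodup) (hk : l.length = k)
    (h : Feasible n s (latest n cid) l u t) : 0 < total n k s cid t u := by
  subst hk
  rw [total_eq]
  refine sumFeasible_pos (fun l => mul_self_nonneg _) h ?_
  exact mul_self_ne_zero.2 (minor_full_ne_zero hl le_rfl)

/-- At most `n ^ k` sequences with squared determinants at most `(k * n ^ k) ^ (2 * k)`. With `X = n
* (k + 1)` this is at most `X ^ (k + 2 * k * (k + 1))`, and the exponent is below `3 * (k + 1) ^ 2`,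
which explains the choice of `numModuli`. The factor `firstModulus` makes the inequality strict. -/
theorem total_lt {n k s t u : ℕ} {cid : ℕ → ℕ → ℕ} (hu : u < n) :
    total n k s cid t u < firstModulus n k * ((n * (k + 1) : ℕ) : ℤ) ^ numModuli k := by
  have hn : 1 ≤ n := by omega
  have h1 : total n k s cid t u ≤ (n : ℤ) ^ k * (((k : ℤ) * (n : ℤ) ^ k) ^ k) ^ 2 := by
    rw [total_eq]
    refine sumFeasible_le (by positivity) (fun l hl hx => ?_) hu t
    rw [square, ← sq, ← sq_abs]
    refine pow_le_pow_left₀ (abs_nonneg _) ?_ 2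
    have := abs_minor_le (K := k) hx (2 ^ k - 1)
    rwa [hl] at this
  have h2 : (n : ℤ) ^ k * (((k : ℤ) * (n : ℤ) ^ k) ^ k) ^ 2 ≤ ((n * (k + 1) : ℕ) : ℤ) ^ numModuli k := by
    have hX : 1 ≤ n * (k + 1) := Nat.mul_pos hn (Nat.succ_pos k)
    have ha : n ≤ n * (k + 1) := Nat.le_mul_of_pos_right n (Nat.succ_pos k)
    have hb : k ≤ n * (k + 1) := by nlinarith
    norm_cast
    calc n ^ k * ((k * n ^ k) ^ k) ^ 2
        ≤ (n * (k + 1)) ^ k * (((n * (k + 1)) * (n * (k + 1)) ^ k) ^ k) ^ 2 := by gcongr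
      _ = (n * (k + 1)) ^ (k + (k + 1) * k * 2) := by
        rw [← pow_succ', ← pow_mul, ← pow_mul, ← pow_add, ← mul_assoc (k + 1)]
      _ ≤ (n * (k + 1)) ^ numModuli k := Nat.pow_le_pow_right hX (by unfold numModuli; nlinarith)
  have h3 : 2 ≤ firstModulus n k := by
    unfold firstModulus numModuli
    have : 1 ≤ n * (k + 1) := Nat.mul_pos hn (Nat.succ_pos k)
    nlinarith [Nat.mul_le_mul this (show 1 ≤ (k + 1) * (k + 1) from Nat.mul_pos k.succ_pos k.succ_pos)]
  have h4 : (0 : ℤ) < ((n * (k + 1) : ℕ) : ℤ) ^ numModuli k := by positivity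
  have h5 : (2 : ℤ) ≤ (firstModulus n k : ℤ) := by exact_mod_cast h3
  nlinarith [h1.trans h2]

/-- A nonnegative number smaller than one of its divisors is zero. The choice `firstModulus = X *
numModuli` with `X = n * (k + 1)` is exactly what `pow_le_choose_add` requires. -/
theorem total_eq_zero {n k s t u : ℕ} {cid : ℕ → ℕ → ℕ} (hu : u < n)
    (h : ∀ j ≤ numModuli k, ((firstModulus n k + j : ℕ) : ℤ) ∣ total n k s cid t u) :
    total n k s cid t u = 0 := by
  have hn : 1 ≤ n := by omega
  have hN : 1 ≤ firstModulus n k :=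
    Nat.mul_pos (Nat.mul_pos hn k.succ_pos) (Nat.mul_pos (Nat.mul_pos (by norm_num) k.succ_pos) k.succ_pos)
  have h1 := mul_choose_dvd hN _ h
  refine Int.eq_zero_of_abs_lt_dvd h1 ?_
  rw [abs_of_nonneg (total_nonneg _ _ _ _ _ _)]
  refine (total_lt hu).trans_le ?_
  have h2 := pow_le_choose_add (N := firstModulus n k) (X := n * (k + 1)) (R := numModuli k) le_rfl
  push_cast
  refine mul_le_mul_of_nonneg_left ?_ (by positivity)
  exact_mod_cast h2

/-! ### The program -/

/-- Using the modulus `firstModulus + i`, where `i` is the local variable `9`. -/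
def modulusStmt : Stmt :=
  .letE (.var 7 + .var 9) <| .seq weightsStmt <| .seq baseStmt <| .seq tableStmt <| .seq findStmt <|
    .letE (.read 8 0 0 0 0 0) <|
    .ite (.bin .lt (.lit 0) (.var 11) *
        (.bin .eq (.inp (.lit 0)) (.lit 0) + .bin .lt (.var 11) (.inp (.lit 0))))
      (.letE (.var 5 - .lit 1) <| .seq routeStmt walkStmt) .skip

/-- The low memory holds `0` or a tour. -/
structure Partial {I : Instance} (R : Listing I) (m : Mem) : Prop where
  ready : Ready I.n I.L I.k R.compIndex m
  walk : m.low 0 ≠ 0 → ∃ Y V, IsPath R V (m.low 0) Y ∧ V.Nodup ∧ V.length = I.k ∧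
    (∀ x ∈ V, x < I.n) ∧ HoldsWalk (m.low 0) R.compIndex Y m

/-- The modulus `r` does not show the existence of a tour that is better than the one in the low
memory. -/
def Excluded {I : Instance} (R : Listing I) (m : Mem) (r : ℕ) : Prop :=
  ∀ t, 1 ≤ t → t ≤ I.L → (m.low 0 = 0 ∨ t < m.low 0) → ∀ u < I.n,
    (r : ℤ) ∣ total I.n I.k I.s R.compIndex t u

/-- A bound for the running time for one modulus. -/
def modulusTime (n L k : ℕ) : ℕ :=
  (k + 1) * ((k + 1) * ((L + 1) * (n * (2 ^ k * (2 ^ k * ((k + 1) * ((k + 1) * n)))))))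

/-- The left side is `modulusTime` multiplied out; with the complementary factor `c` given, each
comparison of running times is left to `ring`. -/
theorem le_modulusTime {n L k a c : ℕ} (hn : 1 ≤ n)
    (h : (k + 1) ^ 4 * (L + 1) * n * n * 2 ^ k * 2 ^ k = a * c) : a ≤ modulusTime n L k := by
  have : modulusTime n L k = a * c := by
    rw [← h, modulusTime]
    ring
  refine le_of_eq_mul this (Nat.pos_of_ne_zero fun hc => ?_)
  rw [hc, mul_zero] at h
  have : 0 < (k + 1) ^ 4 * (L + 1) * n * n * 2 ^ k * 2 ^ k := by positivity
  omega

/-- A stored tour is replaced only by a strictly earlier one. Therefore the range of times that has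
to be excluded only shrinks, and what earlier moduli excluded stays excluded. -/
theorem tr_modulusStmt {I : Instance} {R : Listing I} (hL : Large Z I.n I.L I.k) (hLb : I.L < b)
    {i N : ℕ} (hi : i ≤ numModuli I.k) {m : Mem} (hm : Partial R m) :
    Tr w b Z modulusStmt (i :: N :: globals I.n I.L I.k I.s) m (modulusTime I.n I.L I.k)
      fun m' => Partial R m' ∧ (∀ r, Excluded R m r → Excluded R m' r) ∧
        Excluded R m' (firstModulus I.n I.k + i) := by
  have hnp := hL.pos
  have hLp := I.L_pos
  have hmod := hL.moduli_lt
  have hpow := hL.pow_lt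
  have hLZ := hL.L_lt
  rw [pow_succ] at hpow
  have hp1 := Nat.one_le_two_pow (n := I.k)
  have hr2 : 2 ≤ firstModulus I.n I.k + i := by
    have : 3 ≤ firstModulus I.n I.k := by
      unfold firstModulus numModuli
      have : 1 ≤ I.n * (I.k + 1) := Nat.mul_pos hnp (Nat.succ_pos _)
      nlinarith [Nat.mul_le_mul this
        (show 1 ≤ (I.k + 1) * (I.k + 1) from Nat.mul_pos (Nat.succ_pos _) (Nat.succ_pos _))]
    omega
  refine tr_let (firstModulus I.n I.k + i) rfl (by omega) ?_
  generalize hr : firstModulus I.n I.k + i = r at hr2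
  have hrZ : r < Z := by omega
  refine tr_seq ((tr_weightsStmt hL hr2 hrZ hm.ready.powers).mono
    (le_modulusTime (c := (I.k + 1) ^ 3 * (I.L + 1) * I.n * 2 ^ I.k) hnp (by ring))
    (Nat.succ_le_of_lt (by positivity)) fun _ h => h) ?_
  rintro m₁ ⟨hfr₁, hW₁⟩
  refine tr_seq ((tr_baseStmt (τ := latest I.n R.compIndex) hL hr2).mono
    (le_modulusTime (c := (I.k + 1) ^ 4 * I.n) hnp (by ring))
    (Nat.succ_le_of_lt (by positivity)) fun _ h => h) ?_
  rintro m₂ ⟨hfr₂, h0₂⟩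
  have hR₂ : Ready I.n I.L I.k R.compIndex m₂ :=
    (hm.ready.frame hfr₁ (by simp) (by simp) (by simp)).frame hfr₂ (by simp) (by simp) (by simp)
  have hW₂ : WeightsOk I.n I.k r m₂ := fun x hx A hA a ha => by
    rw [hfr₂.2 _ _ _ _ _ _ (by simp), hW₁ x hx A hA a ha]
  refine tr_seq ((tr_tableStmt hL (by omega) hrZ hR₂ hW₂ h0₂).mono
    (le_modulusTime (c := I.k + 1) hnp (by ring))
    (Nat.succ_le_of_lt (by positivity)) fun _ h => h) ?_
  rintro m₃ ⟨hfr₃, hQ₃⟩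
  refine tr_seq ((tr_findStmt hL hLp).mono (le_trans (Nat.mul_le_mul_right _ (Nat.le_add_right _ 1))
    (le_modulusTime (c := (I.k + 1) ^ 4 * I.n * 2 ^ I.k * 2 ^ I.k) hnp (by ring)))
    (Nat.succ_le_of_lt (by positivity)) fun _ h => h) ?_
  rintro m₄ ⟨hfr₄, hT₄⟩
  have hR₄ : Ready I.n I.L I.k R.compIndex m₄ :=
    (hR₂.frame hfr₃ (by simp) (by simp) (by simp)).frame hfr₄ (by simp) (by simp) (by simp)
  have hW₄ : WeightsOk I.n I.k r m₄ := fun x hx A hA a ha => by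
    rw [hfr₄.2 _ _ _ _ _ _ (by simp), hfr₃.2 _ _ _ _ _ _ (by simp), hW₂ x hx A hA a ha]
  have hQ₄ : TableOk I.n I.L I.k I.s r R.compIndex m₄ := fun p hp t ht v hv A hA B hB => by
    rw [hfr₄.2 _ _ _ _ _ _ (by simp)]
    exact hQ₃ p hp t ht v hv A hA B hB
  have hlow : m₄.low = m.low := by rw [hfr₄.1, hfr₃.1, hfr₂.1, hfr₁.1]
  have hex : ∀ t, 1 ≤ t → t ≤ I.L → (m₄.arr 8 0 0 0 0 0 = 0 ∨ t < m₄.arr 8 0 0 0 0 0) →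
      ∀ u < I.n, (r : ℤ) ∣ total I.n I.k I.s R.compIndex t u := by
    intro t h1 h2 h3 u hu
    have h4 := (hQ₃ I.k le_rfl t h2 u hu (2 ^ I.k - 1) (by omega) (2 ^ I.k - 1) (by omega)).2
    have h5 : m₃.arr 5 I.k t u (2 ^ I.k - 1) (2 ^ I.k - 1) = 0 := hT₄.1 t h1 h2 h3 u hu
    rw [h5, Nat.cast_zero] at h4
    exact (ZMod.intCast_zmod_eq_zero_iff_dvd _ _).1 h4.symm
  have hfound : m₄.arr 8 0 0 0 0 0 ≠ 0 → m₄.arr 8 0 0 0 0 0 ≤ I.L ∧ m₄.arr 9 0 0 0 0 0 < I.n ∧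
      m₄.arr 5 I.k (m₄.arr 8 0 0 0 0 0) (m₄.arr 9 0 0 0 0 0) (2 ^ I.k - 1) (2 ^ I.k - 1) ≠ 0 := by
    intro h
    rw [hfr₄.2 5 _ _ _ _ _ (by simp)]
    exact hT₄.2 h
  refine tr_letRead (m₄.arr 8 0 0 0 0 0) rfl fun _ => ?_
  generalize m₄.arr 8 0 0 0 0 0 = T at hex hfound
  have hval : Expr.val (T :: r :: i :: N :: globals I.n I.L I.k I.s) m₄ (.bin .lt (.lit 0) (.var 11) *
      (.bin .eq (.inp (.lit 0)) (.lit 0) + .bin .lt (.var 11) (.inp (.lit 0)))) ≠ 0 ↔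
      T ≠ 0 ∧ (m.low 0 = 0 ∨ T < m.low 0) := by
    rw [← hlow]
    change (if 0 < T then 1 else 0) * ((if m₄.low 0 = 0 then 1 else 0) +
      (if T < m₄.low 0 then 1 else 0)) ≠ 0 ↔ _
    split_ifs <;> simp <;> omega
  have hb0 : 0 < b := by omega
  refine tr_ite ⟨⟨trivial, trivial⟩, ⟨⟨trivial, hb0⟩, trivial⟩, trivial, ⟨trivial, hb0⟩⟩ (fun hif => ?_)
    fun hif => tr_skip ?_
  swap
  · have hif : ¬ (T ≠ 0 ∧ (m.low 0 = 0 ∨ T < m.low 0)) := fun h => hval.2 h hif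
    refine ⟨⟨hR₄, ?_⟩, fun r' h => ?_, fun t h1 h2 h3 => hex t h1 h2 ?_⟩
    · rw [hlow]
      intro h
      obtain ⟨Y, V, h1, h2, h3, h4, h5⟩ := hm.walk h
      refine ⟨Y, V, h1, h2, h3, h4, ?_⟩
      rwa [HoldsWalk, hlow]
    · rwa [Excluded, hlow]
    · rw [hlow] at h3
      omega
  obtain ⟨hT0, hTb⟩ := hval.1 hif
  obtain ⟨hTL, hU, hne⟩ := hfound hT0
  refine tr_let (2 ^ I.k - 1) rfl (by omega) ?_
  refine tr_seq ((tr_routeStmt hL (by omega) hrZ hR₄ hW₄ hQ₄ hTL hU hne).mono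
    (le_modulusTime (c := (I.L + 1) * I.n) hnp (by ring))
    (Nat.succ_le_of_lt (by positivity)) fun _ h => h) ?_
  rintro m₅ ⟨hfr₅, hroute⟩
  have hR₅ := hR₄.frame hfr₅ (by simp) (by simp) (by simp)
  refine (tr_walkStmt hL hR₅ hLb (Nat.pos_of_ne_zero hT0) hTL hroute).mono
    (le_trans (Nat.mul_le_mul_right _ (Nat.le_add_right _ 1))
    (le_modulusTime (c := (I.k + 1) ^ 3 * I.n * 2 ^ I.k * 2 ^ I.k) hnp (by ring)))
    (Nat.succ_le_of_lt (by positivity)) ?_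
  rintro m₆ ⟨hfr₆, Y, y, c, hwalk, hback, hclear⟩
  have hlow₆ := hwalk.1
  refine ⟨⟨⟨fun a ha => ?_, fun t h1 h2 v hv => ?_, fun t ht v hv u hu => ?_⟩, fun _ => ?_⟩,
    fun r' h t h1 h2 h3 => h t h1 h2 ?_, fun t h1 h2 h3 => hex t h1 h2 (by rwa [hlow₆] at h3)⟩
  · rw [hfr₆ _ _ _ _ _ _ (by simp), hR₅.powers a ha]
  · rw [hfr₆ _ _ _ _ _ _ (by simp), hR₅.comps t h1 h2 v hv]
  · rw [hfr₆ _ _ _ _ _ _ (by simp), hfr₆ _ _ _ _ _ _ (by simp), hR₅.latest t ht v hv u hu]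
  · rw [hlow₆]
    refine ⟨Y, _, hback.isPath hroute (Nat.pos_of_ne_zero hT0) hTL hclear, hroute.nodup,
      length_segment _ _ _, fun x hx => ?_, hwalk⟩
    obtain ⟨j, -, hj, rfl⟩ := mem_segment.1 hx
    exact hroute.lt j (by omega)
  · rw [hlow₆] at h3
    omega

/-- The whole program. -/
def mainStmt : Stmt :=
  .letE (.lit 0) <| .letE (.inp (.lit 0)) <| .letE (.inp (.lit 1)) <| .letE (.inp (.lit 2)) <|
  .letE (.inp (.lit 3)) <| .seq powersStmt <| .letE (.read 1 3 0 0 0 0) <|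
  .letE (.lit 3 * (.var 3 + .lit 1) * (.var 3 + .lit 1)) <|
  .letE (.var 1 * (.var 3 + .lit 1) * .var 6) <| .seq parseStmt <| .seq latestStmt <|
  .seq (.out (.lit 0) (.lit 0)) <| .forE (.var 6 + .lit 1) modulusStmt

theorem tr_mainStmt {I : Instance} {R : Listing I} (hL : Large Z I.n I.L I.k) (hLb : I.L < b)
    (hbZ : b < Z) {m : Mem} (hin : InputOk b R.encode m) (h0 : ∀ t v c, m.arr 3 t v c 0 0 = 0) :
    Tr w b Z mainStmt [] m ((numModuli I.k + 1) * modulusTime I.n I.L I.k)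
      fun m' => Partial R m' ∧ ∀ i ≤ numModuli I.k, Excluded R m' (firstModulus I.n I.k + i) := by
  have hnp := hL.pos
  have hLp := I.L_pos
  have hmod := hL.moduli_lt
  have hpow := hL.pow_lt
  have hLZ := hL.L_lt
  rw [pow_succ] at hpow
  have hZ0 : 0 < Z := by omega
  have htime : modulusTime I.n I.L I.k ≤ (numModuli I.k + 1) * modulusTime I.n I.L I.k :=
    Nat.le_mul_of_pos_left _ (Nat.succ_pos _)
  have hpos : 0 < modulusTime I.n I.L I.k := by
    unfold modulusTime
    positivity
  refine tr_let 0 rfl hZ0 ?_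
  refine tr_letInp hin (p := 0) rfl (show R.encode.drop 0 = _ from rfl) fun _ => ?_
  refine tr_letInp hin (p := 1) rfl (show R.encode.drop 1 = _ from rfl) fun _ => ?_
  refine tr_letInp hin (p := 2) rfl (show R.encode.drop 2 = _ from rfl) fun _ => ?_
  refine tr_letInp hin (p := 3) rfl (show R.encode.drop 3 = _ from rfl) fun _ => ?_
  refine tr_seq ((tr_powersStmt hL).mono ((le_modulusTime
    (c := (I.k + 1) ^ 3 * (I.L + 1) * I.n * I.n * 2 ^ I.k * 2 ^ I.k) hnp (by ring)).trans htime)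
    (Nat.succ_le_of_lt (by positivity)) fun _ h => h) ?_
  rintro m₁ ⟨hfr₁, hP₁⟩
  refine tr_let (2 ^ I.k) (hP₁ I.k le_rfl) (by omega) ?_
  refine tr_let (numModuli I.k) rfl (by omega) ?_
  refine tr_let (firstModulus I.n I.k) rfl (by omega) ?_
  have hin₁ : InputOk b R.encode m₁ := ⟨hin.1, fun x hx => by rw [hfr₁.1, hin.2 x hx]⟩
  refine tr_seq ((tr_parseStmt R hL hbZ hin₁).mono ((le_trans (Nat.mul_le_mul_right _ (Nat.le_add_right _ 1))
    (le_modulusTime (c := (I.k + 1) ^ 4 * 2 ^ I.k * 2 ^ I.k) hnp (by ring))).trans htime)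
    (Nat.succ_le_of_lt (by positivity)) fun _ h => h) ?_
  rintro m₂ ⟨hfr₂, hC₂⟩
  have h0₂ : ∀ t v c, m₂.arr 3 t v c 0 0 = 0 := fun t v c => by
    rw [hfr₂.2 _ _ _ _ _ _ (by simp), hfr₁.2 _ _ _ _ _ _ (by simp), h0]
  refine tr_seq ((tr_latestStmt hL hLp hC₂ h0₂).mono
    ((le_trans (Nat.mul_le_mul_right _ (Nat.le_add_right _ 1))
    (le_modulusTime (c := (I.k + 1) ^ 4 * 2 ^ I.k * 2 ^ I.k) hnp (by ring))).trans htime)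
    (Nat.succ_le_of_lt (by positivity)) fun _ h => h) ?_
  rintro m₃ ⟨hfr₃, hT₃⟩
  have hR₃ : Ready I.n I.L I.k R.compIndex m₃ :=
    ⟨fun a ha => by rw [hfr₃.2 _ _ _ _ _ _ (by simp), hfr₂.2 _ _ _ _ _ _ (by simp), hP₁ a ha],
      fun t h1 h2 v hv => by rw [hfr₃.2 _ _ _ _ _ _ (by simp), hC₂ t h1 h2 v hv], hT₃⟩
  refine tr_seq (Q₁ := fun m' => m' = m₃.setLow 0 0)
    (tr_out (x := 0) trivial trivial rfl (by omega) rfl hZ0 rfl) ?_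
  rintro _ rfl
  refine tr_for (numModuli I.k + 1) _ _ (fun j m' => Partial R m' ∧
    ∀ i < j, Excluded R m' (firstModulus I.n I.k + i)) rfl le_rfl (Nat.succ_pos _) hpos (by omega)
    ⟨⟨⟨hR₃.powers, hR₃.comps, hR₃.latest⟩, fun h => absurd rfl h⟩, by simp⟩ ?_
    fun m' h => ⟨h.1, fun i hi => h.2 i (by omega)⟩
  rintro i hi m₄ ⟨h₄, hex₄⟩
  refine (tr_modulusStmt hL hLb (by omega) h₄).conseq ?_
  rintro m₅ ⟨h₅, hold, hnew⟩
  refine ⟨h₅, fun j hj => ?_⟩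
  rcases Nat.lt_succ_iff_lt_or_eq.1 hj with h | rfl
  exacts [hold _ (hex₄ j h), hnew]

/-- A tour arriving before the stored one, or any tour if none is stored, would give a positive sum
at its arrival time; but all moduli divide that sum, so it is zero. -/
theorem solved_of_excluded {I : Instance} {R : Listing I} {m : Mem} {σ : State} (hLb : I.L < b)
    (hσ : ∀ x < b, σ.mem x = m.low x) (hm : Partial R m)
    (hex : ∀ i ≤ numModuli I.k, Excluded R m (firstModulus I.n I.k + i)) : Solved R ⟨[], σ⟩ := by
  have hno : ∀ W, IsTour I.graph I.s 1 I.k W → m.low 0 ≠ 0 ∧ m.low 0 ≤ W.length := by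
    intro W hW
    obtain ⟨h1, h2, l, u, hu, hl, hlk, hF⟩ := exists_feasible_of_isTour (R := R) hW
    by_contra hc
    have h3 := total_eq_zero (s := I.s) (cid := R.compIndex) (t := W.length) hu fun j hj =>
      hex j hj W.length h1 h2 (by omega) u hu
    exact (total_pos hl hlk hF).ne' h3
  have hyes : m.low 0 ≠ 0 → ∃ W, W.length = m.low 0 ∧ IsTour I.graph I.s 1 I.k W ∧ Outputs R σ W := by
    intro h
    obtain ⟨Y, V, h1, h2, h3, h4, h5⟩ := hm.walk h
    refine h1.exists_isTour h2 h3 h4 (hσ 0 (by omega)) fun t ht1 ht2 => ?_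
    rw [hσ t (by have := h1.le_lifetime; omega)]
    exact h5.2 t ht1 ht2
  refine ⟨rfl, fun ⟨W₀, hW₀⟩ => ?_, fun hn => ?_⟩
  · obtain ⟨W, h1, h2, h3⟩ := hyes (hno W₀ hW₀).1
    refine ⟨W, ⟨h2, fun W' hW' => ?_⟩, h3⟩
    have := (hno W' hW').2
    unfold arrivalTime
    omega
  · rw [show (Config.mk [] σ).state.mem 0 = σ.mem 0 from rfl, hσ 0 (by omega)]
    by_contra h
    obtain ⟨W, -, hW, -⟩ := hyes h
    exact hn ⟨W, hW⟩

end

/-! ### The size of the input -/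

theorem length_flatMap_le {α : Type*} {l : List α} {f : α → List ℕ} {M : ℕ}
    (h : ∀ x ∈ l, (f x).length ≤ M) : (l.flatMap f).length ≤ l.length * M := by
  induction l with
  | nil => simp
  | cons x l ih =>
    rw [List.flatMap_cons, List.length_append, List.length_cons, Nat.succ_mul, add_comm]
    exact Nat.add_le_add (ih fun y hy => h y (List.mem_cons_of_mem _ hy)) (h x List.mem_cons_self)

theorem Listing.length_encode_le {I : Instance} (R : Listing I) :
    R.encode.length ≤ 4 + I.L * (1 + I.n * (1 + I.n)) := by
  rw [R.encode_eq, List.length_append]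
  refine Nat.add_le_add le_rfl ?_
  refine (length_flatMap_le (M := 1 + I.n * (1 + I.n)) fun t _ => ?_).trans_eq (by simp)
  rw [List.length_cons, add_comm]
  refine Nat.add_le_add le_rfl ((length_flatMap_le (M := 1 + I.n) fun c hc => ?_).trans
    (Nat.mul_le_mul_right _ (R.length_comps_le t)))
  rw [List.length_cons, List.length_map, add_comm]
  exact Nat.add_le_add le_rfl (R.length_le hc)

theorem Listing.encode_le {I : Instance} (R : Listing I) {x : ℕ} (hx : x ∈ R.encode) :
    x ≤ I.n + I.L + I.k := by
  have hs := I.s.2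
  rw [R.encode_eq] at hx
  simp only [List.mem_append, List.mem_cons, List.not_mem_nil, or_false, List.mem_flatMap,
    List.mem_map] at hx
  rcases hx with (rfl | rfl | rfl | rfl) | ⟨t, -, rfl | ⟨c, hc, rfl | ⟨v, -, rfl⟩⟩⟩
  · omega
  · omega
  · omega
  · omega
  · have := R.length_comps_le t
    omega
  · have := R.length_le hc
    omega
  · have := v.2
    omega

/-- A number that is polynomial in the running time. -/
def scale (n L k : ℕ) : ℕ := (n + 1) * (L + 1) * (k + 1) * 2 ^ k

theorem scale_bounds (n L k : ℕ) : 1 ≤ scale n L k ∧ n + L + k + 1 ≤ scale n L k ∧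
    (n + 1) * (k + 1) ≤ scale n L k ∧ (n + 1) * (L + 1) ≤ scale n L k ∧ 2 ^ k ≤ scale n L k := by
  have hp := Nat.one_le_two_pow (n := k)
  have h1 : (n + 1) * (L + 1) * (k + 1) ≤ scale n L k := Nat.le_mul_of_pos_right _ hp
  have h2 : (n + 1) * (L + 1) ≤ (n + 1) * (L + 1) * (k + 1) := Nat.le_mul_of_pos_right _ k.succ_pos
  have h3 : (n + 1) * (k + 1) ≤ (n + 1) * (L + 1) * (k + 1) := by
    rw [mul_right_comm]
    exact Nat.le_mul_of_pos_right _ L.succ_pos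
  refine ⟨le_trans (Nat.succ_le_of_lt (by positivity)) h1, le_trans ?_ h1, h3.trans h1, h2.trans h1,
    Nat.le_mul_of_pos_left _ (by positivity)⟩
  have h4 : n + L + 1 ≤ (n + 1) * (L + 1) := by nlinarith
  nlinarith

/-- The largest requirement comes from the moduli, which are of order `n * (k + 1) ^ 3` and hence
bounded by a multiple of the cube of `scale`. -/
theorem Instance.large (I : Instance) {Z : ℕ} (hZ : 64 * scale I.n I.L I.k ^ 3 ≤ Z) :
    Large Z I.n I.L I.k := by
  have hs := I.s.2
  obtain ⟨h1, h2, h3, -, h5⟩ := scale_bounds I.n I.L I.k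
  generalize scale I.n I.L I.k = D at *
  have h6 : D ≤ D ^ 3 := Nat.le_self_pow (by norm_num) D
  refine ⟨by omega, by omega, by omega, by rw [pow_succ]; omega, ?_, by omega⟩
  have h7 : numModuli I.k ≤ 3 * D ^ 2 := by
    unfold numModuli
    have : I.k + 1 ≤ D := by omega
    nlinarith [Nat.mul_le_mul this this]
  have h8 : firstModulus I.n I.k ≤ D * (3 * D ^ 2) := by
    unfold firstModulus
    refine Nat.mul_le_mul (le_trans ?_ h3) h7
    exact Nat.mul_le_mul_right _ (Nat.le_succ _)
  have h9 : D ^ 2 ≤ D ^ 3 := Nat.pow_le_pow_right h1 (by norm_num)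
  have h10 : D * (3 * D ^ 2) = 3 * D ^ 3 := by ring
  omega

theorem Listing.length_encode_lt {I : Instance} (R : Listing I) :
    R.encode.length < 16 * scale I.n I.L I.k ^ 3 := by
  have hs := I.s.2
  refine R.length_encode_le.trans_lt ?_
  obtain ⟨h1, -, h3, h4, -⟩ := scale_bounds I.n I.L I.k
  generalize scale I.n I.L I.k = D at *
  have h5 : I.n + 1 ≤ D := by nlinarith
  have h6 := Nat.mul_le_mul h4 h5
  have h7 : D ^ 2 ≤ D ^ 3 := Nat.pow_le_pow_right h1 (by norm_num)
  have h8 : 1 ≤ D ^ 3 := Nat.one_le_pow _ _ h1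
  nlinarith

/-! ### The complete machine program -/

/-- Computing the registers `0` and `1`. -/
def preamble : Prog :=
  .seq (.const 10 0) <| .seq (.load 2 10) <| .seq (.const 10 1) <| .seq (.load 3 10) <|
  .seq (.const 10 2) <| .seq (.load 4 10) <| .seq (.const 10 1) <| .seq (.op .add 5 2 10) <|
  .seq (.op .add 6 3 10) <| .seq (.op .add 7 4 10) <| .seq (.op .shl 8 10 4) <|
  .seq (.op .mul 9 5 6) <| .seq (.op .mul 9 9 7) <| .seq (.op .mul 9 9 8) <|
  .seq (.op .mul 11 9 9) <| .seq (.op .mul 11 11 9) <| .seq (.const 12 16) <|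
  .seq (.op .mul 0 11 12) <| .seq (.const 12 4) <| .op .mul 1 0 12

theorem exec_const_eq {w d a : ℕ} {σ : State} (h : a < 2 ^ w) :
    Exec w (.const d a) σ (σ.setReg d a) 1 := by
  have := exec_const w d a σ
  rwa [Nat.mod_eq_of_lt h] at this

theorem exec_load_eq {w d x v : ℕ} {σ : State} (h : σ.mem (σ.reg x) = v) :
    Exec w (.load d x) σ (σ.setReg d v) 1 := by
  have := exec_load w d x σ
  rwa [h] at this

theorem exec_op_eq {w d x y a b v : ℕ} {o : Op} {σ : State} (hx : σ.reg x = a) (hy : σ.reg y = b)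
    (h : o.eval w a b = v) : Exec w (.op o d x y) σ (σ.setReg d v) 1 := by
  have := exec_op w o d x y σ
  rwa [hx, hy, h] at this

/-- All intermediate results are at most `64 * scale ^ 3`, so they fit into a word. The first
address `16 * scale ^ 3` of the arrays lies behind the input, by `Listing.length_encode_lt`. -/
theorem exec_preamble {w n L k : ℕ} {σ : State} (h0 : σ.mem 0 = n) (h1 : σ.mem 1 = L)
    (h2 : σ.mem 2 = k) (hw : 64 * scale n L k ^ 3 < 2 ^ w) :
    ∃ σ' t, t ≤ 60 ∧ Exec w preamble σ σ' t ∧ σ'.mem = σ.mem ∧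
      σ'.reg 0 = 16 * scale n L k ^ 3 ∧ σ'.reg 1 = 64 * scale n L k ^ 3 := by
  obtain ⟨b1, b2, b3, b4, b5⟩ := scale_bounds n L k
  have b6 : (n + 1) * (L + 1) * (k + 1) ≤ scale n L k :=
    Nat.le_mul_of_pos_right _ Nat.one_le_two_pow
  have b7 : scale n L k ≤ scale n L k ^ 3 := Nat.le_self_pow (by norm_num) _
  have b8 : scale n L k * scale n L k ≤ scale n L k ^ 3 := by
    rw [← sq]
    exact Nat.pow_le_pow_right b1 (by norm_num)
  have b9 : scale n L k * scale n L k * scale n L k = scale n L k ^ 3 := by ring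
  have hD : (n + 1) * (L + 1) * (k + 1) * 2 ^ k = scale n L k := rfl
  generalize scale n L k = D at *
  refine ⟨_, _, ?_, exec_seq (exec_const_eq ?_) <| exec_seq (exec_load_eq (v := n) ?_) <|
    exec_seq (exec_const_eq ?_) <| exec_seq (exec_load_eq (v := L) ?_) <|
    exec_seq (exec_const_eq ?_) <| exec_seq (exec_load_eq (v := k) ?_) <|
    exec_seq (exec_const_eq ?_) <| exec_seq (exec_op_eq (a := n) (b := 1) (v := n + 1) ?_ ?_ ?_) <|
    exec_seq (exec_op_eq (a := L) (b := 1) (v := L + 1) ?_ ?_ ?_) <|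
    exec_seq (exec_op_eq (a := k) (b := 1) (v := k + 1) ?_ ?_ ?_) <|
    exec_seq (exec_op_eq (a := 1) (b := k) (v := 2 ^ k) ?_ ?_ ?_) <|
    exec_seq (exec_op_eq (a := n + 1) (b := L + 1) (v := (n + 1) * (L + 1)) ?_ ?_ ?_) <|
    exec_seq (exec_op_eq (a := (n + 1) * (L + 1)) (b := k + 1)
      (v := (n + 1) * (L + 1) * (k + 1)) ?_ ?_ ?_) <|
    exec_seq (exec_op_eq (a := (n + 1) * (L + 1) * (k + 1)) (b := 2 ^ k) (v := D) ?_ ?_ ?_) <|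
    exec_seq (exec_op_eq (a := D) (b := D) (v := D * D) ?_ ?_ ?_) <|
    exec_seq (exec_op_eq (a := D * D) (b := D) (v := D ^ 3) ?_ ?_ ?_) <|
    exec_seq (exec_const_eq ?_) <|
    exec_seq (exec_op_eq (a := D ^ 3) (b := 16) (v := 16 * D ^ 3) ?_ ?_ ?_) <|
    exec_seq (exec_const_eq ?_) <| exec_op_eq (a := 16 * D ^ 3) (b := 4) (v := 64 * D ^ 3) ?_ ?_ ?_,
    rfl, ?_, ?_⟩
  all_goals first
    | (simp [State.setReg_reg, h0, h1, h2]; done)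
    | omega
    | (rw [Op.eval, Nat.mod_eq_of_lt] <;> first | (simp [Nat.shiftLeft_eq]; done) | omega)

/-- The program that solves the problem. -/
def solver : Prog := .seq preamble (mainStmt.compile 0)

theorem isDeterministic_solver : solver.IsDeterministic := by
  refine ⟨?_, Stmt.isDeterministic_compile _ _⟩
  simp [preamble, Prog.IsDeterministic]

/-- A bound for the running time. -/
def solverTime (n L k : ℕ) : ℕ :=
  mainStmt.size * ((numModuli k + 1) * modulusTime n L k) + 61

theorem run_solver {I : Instance} (R : Listing I) {w : ℕ}
    (hw : (64 * scale I.n I.L I.k ^ 3) ^ mainStmt.size ≤ 2 ^ w) :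
    ∃ d, run w (solverTime I.n I.L I.k) (initial w solver R.encode) = PMF.pure d ∧ Solved R d := by
  have hL := I.large le_rfl
  have hlen := R.length_encode_lt
  have hle : ∀ x ∈ R.encode, x < 64 * scale I.n I.L I.k ^ 3 := by
    intro x hx
    have h1 := R.encode_le hx
    have h2 := (scale_bounds I.n I.L I.k).2.1
    have h3 : scale I.n I.L I.k ≤ scale I.n I.L I.k ^ 3 := Nat.le_self_pow (by norm_num) _
    omega
  have hD : 1 ≤ scale I.n I.L I.k ^ 3 := Nat.one_le_pow _ _ (scale_bounds I.n I.L I.k).1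
  have hLb : I.L < 16 * scale I.n I.L I.k ^ 3 := by
    have h2 := (scale_bounds I.n I.L I.k).2.1
    have h3 : scale I.n I.L I.k ≤ scale I.n I.L I.k ^ 3 := Nat.le_self_pow (by norm_num) _
    omega
  have hbZ : 16 * scale I.n I.L I.k ^ 3 < 64 * scale I.n I.L I.k ^ 3 := by omega
  have hZ16 : 16 ≤ 64 * scale I.n I.L I.k ^ 3 := by omega
  have hsize : 2 ≤ mainStmt.size := by
    simp only [mainStmt, Stmt.size, Expr.size]
    omega
  have hw1 : 64 * scale I.n I.L I.k ^ 3 < 2 ^ w := by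
    refine lt_of_lt_of_le ?_ ((Nat.pow_le_pow_right (by omega) hsize).trans hw)
    rw [sq]
    exact lt_mul_self (by omega)
  have hget : ∀ i, R.encode.getD i 0 < 64 * scale I.n I.L I.k ^ 3 := by
    intro i
    rcases Nat.lt_or_ge i R.encode.length with h | h
    · rw [List.getD_eq_getElem _ _ h]
      exact hle _ (List.getElem_mem h)
    · rw [List.getD_eq_default _ _ h]
      omega
  set σ₀ : State := ⟨fun _ => 0, fun i => R.encode.getD i 0 % 2 ^ w⟩ with hσ₀
  have hmem : ∀ i, σ₀.mem i = R.encode.getD i 0 := fun i =>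
    Nat.mod_eq_of_lt ((hget i).trans hw1)
  obtain ⟨σ₁, t₁, ht₁, e₁, m₁, r₀, r₁⟩ := exec_preamble (n := I.n) (L := I.L) (k := I.k) (σ := σ₀)
    (hmem 0) (hmem 1) (hmem 2) hw1
  generalize 16 * scale I.n I.L I.k ^ 3 = b at *
  generalize 64 * scale I.n I.L I.k ^ 3 = Z at *
  set m : Mem := ⟨fun x => R.encode.getD x 0, fun _ _ _ _ _ _ => 0⟩ with hm
  obtain ⟨m', σ', t, ⟨hp, hex⟩, -, ht, he, -, hh⟩ := tr_mainStmt (w := w) (R := R) hL hLb hbZ (m := m)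
    ⟨hlen, fun x _ => rfl⟩ (fun _ _ _ => rfl) hZ16 hbZ hw
    (fun i => by rw [lookup]; omega) ⟨fun x _ => hget x, fun _ _ _ _ _ _ => by change 0 < Z; omega⟩
    (Nat.succ_le_of_lt (Nat.mul_pos (Nat.succ_pos _) (by
      have := hL.pos
      unfold modulusTime
      positivity))) σ₁ ⟨r₀, r₁, fun i hi => absurd hi (Nat.not_lt_zero i)⟩
    -- Array elements live at addresses `≥ b`, beyond the end of the input, where the memory is
    -- initially `0`; so all arrays start as zero.
    ⟨fun x _ => by rw [m₁, hmem], fun a i₁ i₂ i₃ i₄ i₅ _ _ _ _ _ => by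
      rw [m₁, hmem, List.getD_eq_default _ _ (by unfold address; omega)]⟩
  have hrun := exec_seq e₁ he []
  refine ⟨⟨[], σ'⟩, ?_, solved_of_excluded hLb hh.1 hp hex⟩
  -- The actual number of steps may be smaller than the bound; a halted configuration does not
  -- change in the remaining ones.
  have hT : solverTime I.n I.L I.k = (t₁ + t + 1) + (solverTime I.n I.L I.k - (t₁ + t + 1)) := by
    unfold solverTime
    omega
  rw [hT, run_add]
  change (run w _ ⟨[solver], σ₀⟩).bind _ = _
  have hrun' : run w (t₁ + t + 1) ⟨[solver], σ₀⟩ = PMF.pure ⟨[], σ'⟩ := hrun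
  rw [hrun', PMF.pure_bind, run_halted]

/-! ### The bounds -/

/-- The bound without logarithmic factors. -/
def mainTerm (n L k : ℕ) : ℝ := (2 * Real.exp 1) ^ k * (L : ℝ) * (n : ℝ) ^ 2

theorem le_two_mul_exp_one : (5.43 : ℝ) ≤ 2 * Real.exp 1 := by
  have := Real.exp_one_gt_d9
  norm_num at this ⊢
  linarith

theorem one_le_mainTerm {n L : ℕ} (hn : 1 ≤ n) (hL : 1 ≤ L) (k : ℕ) : 1 ≤ mainTerm n L k := by
  have h1 : (1 : ℝ) ≤ n := by exact_mod_cast hn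
  have h2 : (1 : ℝ) ≤ L := by exact_mod_cast hL
  have h3 : (1 : ℝ) ≤ (2 * Real.exp 1) ^ k := one_le_pow₀ (le_trans (by norm_num) le_two_mul_exp_one)
  unfold mainTerm
  exact one_le_mul_of_one_le_of_one_le (one_le_mul_of_one_le_of_one_le h3 h2) (one_le_pow₀ h1)

/-- Bernoulli's inequality gives `k + 1 ≤ 24 * (25/24)^k`, and `(25/24)^6 * 4` is still below `5.43
≤ 2e`. This is where the gap between `4` and `2e` pays for all polynomial factors in `k`. -/
theorem pow_six_mul_le (k : ℕ) : ((k : ℝ) + 1) ^ 6 * 4 ^ k ≤ 24 ^ 6 * (2 * Real.exp 1) ^ k := by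
  have h1 : (k : ℝ) + 1 ≤ 24 * (25 / 24) ^ k := by
    have := one_add_mul_le_pow (a := (1 / 24 : ℝ)) (by norm_num) k
    norm_num at this
    nlinarith
  calc ((k : ℝ) + 1) ^ 6 * 4 ^ k ≤ (24 * (25 / 24) ^ k) ^ 6 * 4 ^ k := by gcongr
    _ = 24 ^ 6 * ((25 / 24) ^ 6 * 4) ^ k := by
      rw [mul_pow, mul_pow, ← pow_mul, ← pow_mul, mul_comm k 6]
      ring
    _ ≤ _ := mul_le_mul_of_nonneg_left (pow_le_pow_left₀ (by positivity)
      ((show (25 / 24 : ℝ) ^ 6 * 4 ≤ 5.43 by norm_num).trans le_two_mul_exp_one) k) (by positivity)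

theorem solverTime_le {n L : ℕ} (hn : 1 ≤ n) (hL : 1 ≤ L) (k : ℕ) :
    (solverTime n L k : ℝ) ≤ ((mainStmt.size * 8 * 24 ^ 6 + 61 : ℕ) : ℝ) * mainTerm n L k := by
  have h0 : (numModuli k + 1) * modulusTime n L k ≤ 8 * ((k + 1) ^ 6 * 4 ^ k) * (L * n ^ 2) := by
    have h1 : numModuli k + 1 ≤ 4 * (k + 1) ^ 2 := by
      unfold numModuli
      nlinarith
    have h2 : modulusTime n L k = (k + 1) ^ 4 * (L + 1) * n ^ 2 * 4 ^ k := by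
      rw [show 4 = 2 * 2 from rfl, mul_pow, modulusTime]
      ring
    calc (numModuli k + 1) * modulusTime n L k
        ≤ 4 * (k + 1) ^ 2 * ((k + 1) ^ 4 * (2 * L) * n ^ 2 * 4 ^ k) := by
          rw [h2]
          gcongr
          omega
      _ = _ := by ring
  have h3 : (((numModuli k + 1) * modulusTime n L k : ℕ) : ℝ) ≤ 8 * 24 ^ 6 * mainTerm n L k := by
    refine le_trans (by exact_mod_cast h0 : _ ≤ ((8 * ((k + 1) ^ 6 * 4 ^ k) * (L * n ^ 2) : ℕ) : ℝ)) ?_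
    have := mul_le_mul_of_nonneg_right (pow_six_mul_le k) (by positivity : (0 : ℝ) ≤ 8 * (L * n ^ 2))
    push_cast
    unfold mainTerm
    linarith
  have h4 := one_le_mainTerm hn hL k
  have h5 := mul_le_mul_of_nonneg_left h3 (Nat.cast_nonneg (α := ℝ) mainStmt.size)
  unfold solverTime
  push_cast at h5 ⊢
  nlinarith

/-- One factor `2 ^ k` dominates `k + 1`, the other is part of `scale`; their product `4 ^ k` is at
most `(2e)^k`. -/
theorem scale_le {n L : ℕ} (hn : 1 ≤ n) (hL : 1 ≤ L) (k : ℕ) : (scale n L k : ℝ) ≤ 4 * mainTerm n L k := by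
  have h1 : scale n L k ≤ 4 * (4 ^ k * L * n ^ 2) := by
    have hk : k + 1 ≤ 2 ^ k := Nat.lt_two_pow_self
    calc scale n L k ≤ 2 * n * (2 * L) * 2 ^ k * 2 ^ k := by
          unfold scale
          gcongr <;> omega
      _ = 4 * (4 ^ k * L * n) := by
        rw [show 4 ^ k = 2 ^ k * 2 ^ k by rw [← mul_pow]; norm_num]
        ring
      _ ≤ _ := by
        gcongr
        exact Nat.le_self_pow (by norm_num) n
  refine le_trans (by exact_mod_cast h1 : _ ≤ ((4 * (4 ^ k * L * n ^ 2) : ℕ) : ℝ)) ?_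
  push_cast
  unfold mainTerm
  have := le_two_mul_exp_one
  gcongr
  linarith

/-- Since `scale ≤ 4 * B` and `B ≥ 1`, one has `64 * scale ^ 3 ≤ 2 ^ 12 * B ^ 3 ≤ (2 * B) ^ 12`;
this is the origin of the `12` in the constant for the word length. -/
theorem word_length_le {n L : ℕ} (hn : 1 ≤ n) (hL : 1 ≤ L) (k : ℕ) {w : ℕ} {B : ℝ}
    (hB : mainTerm n L k ≤ B)
    (hw : ((12 * mainStmt.size : ℕ) : ℝ) * (1 + Real.logb 2 B) ≤ w) :
    (64 * scale n L k ^ 3) ^ mainStmt.size ≤ 2 ^ w := by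
  have h1 := (one_le_mainTerm hn hL k).trans hB
  have h2 : (2 * B) ^ (12 * mainStmt.size) ≤ (2 : ℝ) ^ w := by
    have h3 : Real.logb 2 ((2 * B) ^ (12 * mainStmt.size)) ≤ (w : ℝ) := by
      rw [Real.logb_pow, Real.logb_mul (by norm_num) (by positivity),
        Real.logb_self_eq_one (by norm_num)]
      exact hw
    rw [Real.logb_le_iff_le_rpow (by norm_num) (by positivity), Real.rpow_natCast] at h3
    exact h3
  have h3 : ((64 * scale n L k ^ 3 : ℕ) : ℝ) ≤ (2 * B) ^ 12 := by
    push_cast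
    have h4 := (scale_le hn hL k).trans (mul_le_mul_of_nonneg_left hB (by norm_num : (0 : ℝ) ≤ 4))
    calc (64 : ℝ) * (scale n L k : ℝ) ^ 3 ≤ 64 * (4 * B) ^ 3 := by gcongr
      _ = 2 ^ 12 * B ^ 3 := by ring
      _ ≤ 2 ^ 12 * B ^ 12 := by
        gcongr
        norm_num
      _ = _ := by ring
  have h4 : (((64 * scale n L k ^ 3) ^ mainStmt.size : ℕ) : ℝ) ≤ ((2 ^ w : ℕ) : ℝ) := by
    rw [Nat.cast_pow]
    refine le_trans (pow_le_pow_left₀ (by positivity) h3 _) ?_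
    rw [← pow_mul]
    push_cast
    exact h2
  exact_mod_cast h4

/-- The program solves the problem in time `O((2e)^k L n ^ 2)`. -/
theorem exists_run_solver {I : Instance} (R : Listing I) {w : ℕ} {B : ℝ}
    (hB : mainTerm I.n I.L I.k ≤ B)
    (hw : ((12 * mainStmt.size : ℕ) : ℝ) * (1 + Real.logb 2 B) ≤ w) :
    (solverTime I.n I.L I.k : ℝ) ≤
        ((mainStmt.size * 8 * 24 ^ 6 + 61 : ℕ) : ℝ) * mainTerm I.n I.L I.k ∧
      ∃ d, run w (solverTime I.n I.L I.k) (initial w solver R.encode) = PMF.pure d ∧ Solved R d := by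
  have hn : 1 ≤ I.n := by
    have := I.s.2
    omega
  exact ⟨solverTime_le hn I.L_pos I.k, run_solver R (word_length_le hn I.L_pos I.k hB hw)⟩

end NSTexp

end

theorem corollary10 :
    -- the Monte Carlo algorithms
    (∃ C c : ℕ, ∀ ε : ℝ, 0 < ε → ∃ P : NSTexp.Prog,
      ∀ (I : NSTexp.Instance) (R : NSTexp.Listing I) (w : ℕ),
        -- words can hold numbers polynomial in the time bound
        (c : ℝ) * (1 + Real.logb 2 ((2 * Real.exp 1) ^ I.k * (I.L : ℝ) * (I.n : ℝ) ^ 2 *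
          max 1 (Real.log (1 / ε)))) ≤ (w : ℝ) →
        ∃ T : ℕ,
          (T : ℝ) ≤ (C : ℝ) * ((2 * Real.exp 1) ^ I.k * (I.L : ℝ) * (I.n : ℝ) ^ 2 *
            max 1 (Real.log (1 / ε))) ∧
          NSTexp.HaltsWithin w P R.encode T ∧
          1 - ENNReal.ofReal ε ≤
            (NSTexp.run w T (NSTexp.initial w P R.encode)).toOuterMeasure
              {d | NSTexp.Solved R d}) ∧
    -- the deterministic algorithm
    (∃ C c a : ℕ, ∃ P : NSTexp.Prog, P.IsDeterministic ∧
      ∀ (I : NSTexp.Instance) (R : NSTexp.Listing I) (w : ℕ),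
        (c : ℝ) * (1 + Real.logb 2 ((2 * Real.exp 1) ^ I.k * (I.L : ℝ) * (I.n : ℝ) ^ 2)) ≤ (w : ℝ) →
        ∃ T : ℕ,
          (T : ℝ) ≤ (C : ℝ) * ((2 * Real.exp 1) ^ I.k *
            (I.k : ℝ) ^ ((a : ℝ) * Real.log (I.k : ℝ)) * (I.L : ℝ) * (I.n : ℝ) ^ 2 *
            max 1 (Real.log (I.n : ℝ))) ∧
          ∀ d ∈ (NSTexp.run w T (NSTexp.initial w P R.encode)).support, NSTexp.Solved R d) := by
  have hmono : ∀ (I : NSTexp.Instance) (x : ℝ), NSTexp.mainTerm I.n I.L I.k ≤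
      NSTexp.mainTerm I.n I.L I.k * max 1 x := fun I x =>
    le_mul_of_one_le_right (by unfold NSTexp.mainTerm; positivity) (le_max_left _ _)
  -- The same program serves for every `ε`. It draws no random numbers, so its success probability
  -- is `1`; the factor `max 1 _` only enlarges the time bound and the word length.
  refine ⟨⟨NSTexp.mainStmt.size * 8 * 24 ^ 6 + 61, 12 * NSTexp.mainStmt.size, fun ε _ =>
    ⟨NSTexp.solver, fun I R w hw => ?_⟩⟩, NSTexp.mainStmt.size * 8 * 24 ^ 6 + 61,
    12 * NSTexp.mainStmt.size, 0, NSTexp.solver, NSTexp.isDeterministic_solver, fun I R w hw => ?_⟩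
  · obtain ⟨hT, d, hd, hs⟩ := NSTexp.exists_run_solver R (hmono I _) hw
    refine ⟨_, hT.trans (mul_le_mul_of_nonneg_left (hmono I _) (Nat.cast_nonneg _)),
      fun d' hd' => ?_, ?_⟩
    · rw [hd, PMF.support_pure, Set.mem_singleton_iff] at hd'
      rw [hd']
      exact hs.1
    · rw [hd, PMF.toOuterMeasure_pure_apply, if_pos (show d ∈ {d | NSTexp.Solved R d} from hs)]
      exact tsub_le_self
  · obtain ⟨hT, d, hd, hs⟩ := NSTexp.exists_run_solver R le_rfl hw
    refine ⟨_, hT.trans (mul_le_mul_of_nonneg_left ?_ (Nat.cast_nonneg _)), fun d' hd' => ?_⟩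
    -- With `a = 0` the factor `k ^ (a log k)` is `1`, also for `k = 0`.
    · rw [Nat.cast_zero, zero_mul, Real.rpow_zero, mul_one]
      exact hmono I _
    · rw [hd, PMF.support_pure, Set.mem_singleton_iff] at hd'
      rwa [hd']
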